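/- Let $\xi:[-1,1]\to\mathbb R$ be three times continuously differentiable and let $n\ge 0$ be an integer. For $N\ge 2$ let $S_N\subset\mathbb R^N$ be the sphere of radius $\sqrt N$ and $\lambda_N$ the uniform probability measure on it. For $\sigma\in S_N$ write $\varepsilon=\sigma_N$ and $\hat\sigma_i=\sigma_i\big/\sqrt{(N-\varepsilon^2)/(N-1)}$ for $i\le N-1$, so that $\hat\sigma\in S_{N-1}$ (when $\varepsilon^2=N$, a $\lambda_N$-null event, $\hat\sigma$ is a fixed point of $S_{N-1}$). Let $\beta,h\in\mathbb R$, let $q\in[0,1)$ satisfy $h^2+\beta^2\xi'(q)=q/(1-q)^2$ and $\xi'(q)\ge 0$, and put $r=h(1-q)$, $b=h^2(1-q)+\beta^2(1-q)\xi'(q)$. Let $H_N$ and $H_{N-1}$ be independent centered, jointly measurable Gaussian processes on $S_N$ and $S_{N-1}$ with $$\frac1N\mathbb E H_N(\sigma^1)H_N(\sigma^2)=\xi\Bigl(\frac1N\sum_{i\le N}\sigma^1_i\sigma^2_i\Bigr),\qquad \frac1{N-1}\mathbb E H_{N-1}(\tau^1)H_{N-1}(\tau^2)=\xi\Bigl(\frac1{N-1}\sum_{i\le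 N-1}\tau^1_i\tau^2_i\Bigr),$$ let $z$ be a standard Gaussian variable independent of $(H_N,H_{N-1})$, and for $t\in[0,1]$ let $$H_t(\sigma)=\sqrt t\,\beta H_N(\sigma)+\sqrt{1-t}\,\beta H_{N-1}(\hat\sigma)+h\sum_{i\le N-1}\hat\sigma_i\Bigl(1+t\Bigl(\sqrt{\tfrac{N-\varepsilon^2}{N-1}}-1\Bigr)\Bigr)+h\varepsilon+\sqrt{1-t}\,\varepsilon z\beta\sqrt{\xi'(q)}-\tfrac12(1-t)\varepsilon^2 b.$$ For a function $f$ of $m$ replicas $(\sigma^1,\dots,\sigma^m)\in S_N^m$ let $$\langle f\rangle_t=\frac{1}{Z_t^m}\int_{S_N^m} f\,\exp\Bigl(\sum_{l\le m}H_t(\sigma^l)\Bigr)d\lambda_N^{m},\qquad Z_t=\int_{S_N}\exp H_t\,d\lambda_N,\qquad \nu_t(f)=\mathbb E\langle f\rangle_t.$$ Write $\varepsilon_l=\sigma^l_N$, $\hat R_l=\frac1{N-1}\sum_{i\le N-1}\hat\sigma^l_i$, $\hat R_{l,l'}=\frac1{N-1}\sum_{i\le N-1}\hat\sigma^l_i\hat\sigma^{l'}_i$,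 and $$a_l=1-\varepsilon_l^2,\qquad 2a_{l,l'}=\xi'(q)-\tfrac12(\varepsilon_l^2+\varepsilon_{l'}^2)\bigl(q\xi''(q)+\xi'(q)\bigr)+\varepsilon_l\varepsilon_{l'}\xi''(q).$$ There is a constant $L>0$, depending only on $\xi$ and $n$, such that for all $N,\beta,h,q$ as above there is a measurable function $\mathcal R:S_N^{n+2}\to\mathbb R$ with $$|\mathcal R|\le\frac LN(\beta^2+|h|)\Bigl(1+\sum_{l\le n+2}\varepsilon_l^4\Bigr)+L\beta^2\sum_{1\le l\ne l'\le n+2}(1+\varepsilon_l^2)(\hat R_{l,l'}-q)^2$$ for which the following holds. For all $H_N,H_{N-1},z$ as above and every $f:S_N^n\to\mathbb R$ that is integrable with respect to $\lambda_N^n$ (regarded also as a function of $n+2$ replicas), the function $t\mapsto\nu_t(f)$ is differentiable on $[0,1]$ (one-sidedly at the end points), and for every $t\in[0,1]$ $$\begin{aligned}\nu_t'(f)={}&\frac h2\sum_{l\le n}\nu_t\bigl(f a_l(\hat R_l-r)\bigr)-n\frac h2\,\nu_t\bigl(f a_{n+1}(\hat R_{n+1}-r)\bigr)\\&+2\beta^2\sum_{1\le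 l<l'\le n}\nu_t\bigl(f a_{l,l'}(\hat R_{l,l'}-q)\bigr)-2n\beta^2\sum_{l\le n}\nu_t\bigl(f a_{l,n+1}(\hat R_{l,n+1}-q)\bigr)\\&+n(n+1)\beta^2\,\nu_t\bigl(f a_{n+1,n+2}(\hat R_{n+1,n+2}-q)\bigr)+\nu_t(f\mathcal R).\end{aligned}$$ -/

import Mathlib

open MeasureTheory ProbabilityTheory Set

namespace SphericalSK

/-- Spin configurations: the sphere `S_N` of radius `√N` in `ℝ^N`. -/
abbrev Config (N : ℕ) : Type :=
  Metric.sphere (0 : EuclideanSpace ℝ (Fin N)) (√(N : ℝ))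

/-- The dilation of the unit sphere onto `S_N`. -/
noncomputable def dilate (N : ℕ)
    (x : Metric.sphere (0 : EuclideanSpace ℝ (Fin N)) 1) : Config N :=
  ⟨√(N : ℝ) • (x : EuclideanSpace ℝ (Fin N)), by
    simp [norm_smul, abs_of_nonneg (Real.sqrt_nonneg _)]⟩

/-- The uniform probability measure `λ_N` on `S_N`: the normalized surface measure. -/
noncomputable def unif (N : ℕ) : Measure (Config N) :=
  (((volume : Measure (EuclideanSpace ℝ (Fin N))).toSphere univ)⁻¹ •
    (volume : Measure (EuclideanSpace ℝ (Fin N))).toSphere).map (dilate N)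

/-- The overlap `R_{1,2} = N⁻¹ ∑_{i ≤ N} σ¹_i σ²_i`. -/
noncomputable def overlap {N : ℕ} (σ τ : Config N) : ℝ :=
  (∑ i, σ.1 i * τ.1 i) / N

/-- The magnetization `N⁻¹ ∑_{i ≤ N} σ_i`. -/
noncomputable def mag {N : ℕ} (σ : Config N) : ℝ := (∑ i, σ.1 i) / N

/-- `H` is a (centered, jointly measurable) Gaussian Hamiltonian on `S_N`
with `N⁻¹ E H(σ¹) H(σ²) = ξ(R_{1,2})`. -/
structure IsHamiltonian {Ω : Type*} [MeasurableSpace Ω] (P : Measure Ω) (ξ : ℝ → ℝ) (N : ℕ)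
    (H : Config N → Ω → ℝ) : Prop where
  gaussian : IsGaussianProcess H P
  measurable : Measurable fun p : Config N × Ω => H p.1 p.2
  centered : ∀ σ, ∫ ω, H σ ω ∂P = 0
  cov : ∀ σ τ, ∫ ω, H σ ω * H τ ω ∂P = N * ξ (overlap σ τ)

/-! In what follows the system has size `N = M + 1`, so that `N - 1 = M`. -/

/-- The last coordinate `ε = σ_N`. -/
noncomputable def eps {M : ℕ} (σ : Config (M + 1)) : ℝ := σ.1 (Fin.last M)

/-- The factor `√((N - ε²) / (N - 1))`. -/
noncomputable def ratio {M : ℕ} (σ : Config (M + 1)) : ℝ :=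
  √(((M : ℝ) + 1 - eps σ ^ 2) / M)

theorem hat_norm {M : ℕ} (σ : Config (M + 1)) (hσ : eps σ ^ 2 ≠ (M : ℝ) + 1) :
    ‖WithLp.toLp 2 (fun i : Fin M => σ.1 i.castSucc / ratio σ)‖ = √(M : ℝ) := by
  have h1 : ∑ i, σ.1 i ^ 2 = (M : ℝ) + 1 := by
    have h := σ.2
    rw [mem_sphere_zero_iff_norm] at h
    rw [← EuclideanSpace.real_norm_sq_eq, h, Real.sq_sqrt (by positivity)]
    push_cast; ring
  rw [Fin.sum_univ_castSucc] at h1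
  have h2 : ∑ i : Fin M, σ.1 i.castSucc ^ 2 = (M : ℝ) + 1 - eps σ ^ 2 := by
    unfold eps; linarith
  have h3 : 0 < (M : ℝ) + 1 - eps σ ^ 2 := by
    have : 0 ≤ ∑ i : Fin M, σ.1 i.castSucc ^ 2 := Finset.sum_nonneg fun i _ => sq_nonneg _
    rw [h2] at this
    exact lt_of_le_of_ne this fun h => hσ (by linarith)
  have hM : (0 : ℝ) < M := by
    rcases Nat.eq_zero_or_pos M with rfl | h
    · simp only [Finset.univ_eq_empty, Finset.sum_empty] at h2
      linarith
    · exact_mod_cast h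
  rw [EuclideanSpace.norm_eq]
  congr 1
  simp only [Real.norm_eq_abs, sq_abs, div_pow, ratio]
  rw [← Finset.sum_div, h2, Real.sq_sqrt (by positivity)]
  field_simp

/-- The configuration `σ̂ ∈ S_{N-1}` with `σ̂_i = σ_i / √((N - ε²) / (N - 1))`, `i ≤ N - 1`.
At the two poles `ε² = N`, where this quotient has no meaning,
its value is immaterial and set to be `(1, …, 1)`. -/
noncomputable def hat {M : ℕ} (σ : Config (M + 1)) : Config M :=
  open Classical in
  if hσ : eps σ ^ 2 ≠ (M : ℝ) + 1 then
    ⟨WithLp.toLp 2 (fun i : Fin M => σ.1 i.castSucc / ratio σ), by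
      rw [mem_sphere_zero_iff_norm]; exact hat_norm σ hσ⟩
  else ⟨WithLp.toLp 2 (fun _ => 1), by simp [EuclideanSpace.norm_eq]⟩

/-- `b = h² (1 - q) + β² (1 - q) ξ'(q)`. -/
noncomputable def bPar (ξ : ℝ → ℝ) (β h q : ℝ) : ℝ :=
  h ^ 2 * (1 - q) + β ^ 2 * (1 - q) * deriv ξ q

/-- The interpolating Hamiltonian `H_t(σ)` built from given values of
`H_N`, `H_{N-1}` and `z`. -/
noncomputable def interp (ξ : ℝ → ℝ) (β h q t : ℝ) {M : ℕ} (HN : Config (M + 1) → ℝ)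
    (HN1 : Config M → ℝ) (z : ℝ) (σ : Config (M + 1)) : ℝ :=
  √t * β * HN σ + √(1 - t) * β * HN1 (hat σ)
    + h * (∑ i, (hat σ).1 i) * (1 + t * (ratio σ - 1))
    + h * eps σ + √(1 - t) * eps σ * z * β * √(deriv ξ q)
    - 1 / 2 * (1 - t) * eps σ ^ 2 * bPar ξ β h q

/-- The Gibbs average `⟨f⟩` of a function of `n` replicas for the Hamiltonian `E`. -/
noncomputable def gibbs {N : ℕ} (E : Config N → ℝ) (n : ℕ) (f : (Fin n → Config N) → ℝ) : ℝ :=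
  (∫ s, f s * Real.exp (∑ l, E (s l)) ∂(Measure.pi fun _ : Fin n => unif N))
    / (∫ σ, Real.exp (E σ) ∂(unif N)) ^ n

/-- `ν_t(f) = E ⟨f⟩_t` for a function of `n` replicas. -/
noncomputable def nu {Ω : Type*} [MeasurableSpace Ω] (P : Measure Ω) (ξ : ℝ → ℝ) (β h q : ℝ)
    {M : ℕ} (HN : Config (M + 1) → Ω → ℝ) (HN1 : Config M → Ω → ℝ) (z : Ω → ℝ)
    (t : ℝ) (n : ℕ) (f : (Fin n → Config (M + 1)) → ℝ) : ℝ :=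
  ∫ ω, gibbs (interp ξ β h q t (fun σ => HN σ ω) (fun σ => HN1 σ ω) (z ω)) n f ∂P

/-- `a_l (R̂_l - r)` with `a_l = 1 - ε_l²` and `r = h (1 - q)`. -/
noncomputable def oneTerm (h q : ℝ) {M : ℕ} (σ : Config (M + 1)) : ℝ :=
  (1 - eps σ ^ 2) * (mag (hat σ) - h * (1 - q))

/-- `a_{l,l'}`, where
`2 a_{l,l'} = ξ'(q) - (ε_l² + ε_{l'}²) (q ξ''(q) + ξ'(q)) / 2 + ε_l ε_{l'} ξ''(q)`. -/
noncomputable def pairCoef (ξ : ℝ → ℝ) (q : ℝ) {M : ℕ} (σ τ : Config (M + 1)) : ℝ :=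
  (deriv ξ q - 1 / 2 * (eps σ ^ 2 + eps τ ^ 2) * (q * deriv (deriv ξ) q + deriv ξ q)
    + eps σ * eps τ * deriv (deriv ξ) q) / 2

/-- `a_{l,l'} (R̂_{l,l'} - q)`. -/
noncomputable def twoTerm (ξ : ℝ → ℝ) (q : ℝ) {M : ℕ} (σ τ : Config (M + 1)) : ℝ :=
  pairCoef ξ q σ τ * (overlap (hat σ) (hat τ) - q)

end SphericalSK

open SphericalSK

open MeasureTheory ProbabilityTheory Set
open scoped NNReal ENNReal

set_option linter.unusedSectionVars false

namespace SphericalSK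

/-! Differentiating the Gibbs average gives `ν_t'(f) = ν_t(f (∑_{l≤n} H_t'(σ^l) - n
H_t'(σ^{n+1})))`. The centered Gaussian part of `H_t'` carries factors `t^{-1/2}` and
`(1-t)^{-1/2}`, but its covariance with the Gaussian part of `H_t` is half the difference of the
covariances of the two fields being interpolated, a kernel `U(σ,τ)` free of `t`. Gaussian
integration by parts (`rep_ibp`) therefore turns the derivative into `ν_t(f · genTerm)`, with the
deterministic drift `u` entering linearly. This holds on the open interval; the result is continuous
in `t` up to the end points, so it holds there one-sidedly (`GaussPair.hasDerivWithinAt_rep`).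

It remains to expand `U`. With `x = R̂_{l,l'}` and `y = R_{l,l'}`, the quantity `N(y - x)` does not
grow with `N` for fixed `ε`'s, so `N ξ(y) - (N-1) ξ(x)` is `ξ(x) + ξ'(x) N(y - x)` up to `O(1/N)`.
Expanding about `x = q` (`pair_expansion`), with `ε ε' ξ'(q)` removed by the field `z`, gives `U =
k₀ - k₁(ε² + ε'²) + β² a_{l,l'}(x - q) + error`. The value of `b` is what gives the diagonal `U(σ,σ)
+ u(σ)` the matching form `d₀ - 2k₁ε² + (h/2) a_l(R̂_l - r) + error` (`covarGap_self_add_drift₁`).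
In the generator the constants have total weight zero, and the `ε²` terms collapse to `k₁
n(n+1)(ε_{n+1}² - ε_{n+2}²)`, whose average vanishes by exchangeability of the last two replicas
(`genTerm_eq_lead_add_err`, `rep_last_swap`). The errors form `R`, a deterministic function of the
replicas.

Two analytic points need care. The partition function is an integral over a continuum of Gaussian
variables, so integration by parts is first proved with it replaced by an empirical average plus `δ
> 0`, and then passed to the limit (`gaussian_ibp`). And `f` is only integrable: every integrand is
dominated by `|f|` times a random weight whose mean is bounded uniformly in the replicas
(`ExpMoments.lintegral_bnd`), which rests on the bound of `1/Z` in `Dom.inv_partFn_le`. -/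

/-! ### Gaussian integration by parts in one variable -/

theorem hasDerivAt_gaussianPDFReal (v : ℝ≥0) (hv : v ≠ 0) (x : ℝ) :
    HasDerivAt (gaussianPDFReal 0 v) (-(x / v) * gaussianPDFReal 0 v x) x := by
  have hv' : (v : ℝ) ≠ 0 := by exact_mod_cast hv
  have h : HasDerivAt (fun x : ℝ => -(x - 0) ^ 2 / (2 * (v : ℝ))) (-(x / v)) x := by
    have := (((hasDerivAt_id x).sub_const 0).pow 2).neg.div_const (2 * (v : ℝ))
    convert! this using 1
    simp; field_simp
  have := h.exp.const_mul (√(2 * Real.pi * v))⁻¹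
  rw [gaussianPDFReal_def]
  convert! this using 1
  ring

/-- Gaussian integration by parts (Stein's identity) in one dimension. -/
theorem integral_id_mul_gaussianReal (v : ℝ≥0) {g g' : ℝ → ℝ} (hg : ∀ x, HasDerivAt g (g' x) x)
    (h1 : Integrable (fun x => x * g x) (gaussianReal 0 v))
    (h2 : Integrable g' (gaussianReal 0 v)) (h0 : Integrable g (gaussianReal 0 v)) :
    ∫ x, x * g x ∂(gaussianReal 0 v) = v * ∫ x, g' x ∂(gaussianReal 0 v) := by
  -- For zero variance the law is the Dirac mass at `0` and both sides vanish.
  by_cases hv : v = 0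
  · subst hv
    simp [gaussianReal_zero_var]
  have hv' : (v : ℝ) ≠ 0 := by exact_mod_cast hv
  have hi : ∀ f : ℝ → ℝ, Integrable f (gaussianReal 0 v) →
      Integrable (fun x => f x * gaussianPDFReal 0 v x) := by
    intro f hf
    rw [gaussianReal_of_var_ne_zero _ hv, integrable_withDensity_iff
      (measurable_gaussianPDF 0 v) (ae_of_all _ fun _ => gaussianPDF_lt_top)] at hf
    simpa only [toReal_gaussianPDF] using hf
  have key := integral_mul_deriv_eq_deriv_mul_of_integrable (u := g)
    (v := gaussianPDFReal 0 v) (u' := g') (v' := fun x => -(x / v) * gaussianPDFReal 0 v x)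
    (fun x _ => hg x) (fun x _ => hasDerivAt_gaussianPDFReal v hv x)
    (by
      have := ((hi _ h1).const_mul (-(1 / (v : ℝ))))
      refine this.congr (ae_of_all _ fun x => ?_)
      simp only [Pi.mul_apply]; ring)
    (hi _ h2) (hi _ h0)
  rw [integral_gaussianReal_eq_integral_smul hv, integral_gaussianReal_eq_integral_smul hv]
  simp only [smul_eq_mul]
  have e1 : ∫ x, gaussianPDFReal 0 v x * (x * g x)
      = -(v : ℝ) * ∫ x, g x * (-(x / v) * gaussianPDFReal 0 v x) := by
    rw [← integral_const_mul]
    congr 1; ext x; field_simp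
  rw [e1, key]
  simp only [mul_comm (gaussianPDFReal 0 v _)]
  ring

/-- Gaussian integration by parts with an independent parameter. -/
theorem integral_mul_of_indepFun {Ω 𝓨 : Type*} [MeasurableSpace Ω] [MeasurableSpace 𝓨]
    {P : Measure Ω} [IsProbabilityMeasure P] {v : ℝ≥0} {X : Ω → ℝ} {Y : Ω → 𝓨}
    (hX : HasLaw X (gaussianReal 0 v) P) (hY : AEMeasurable Y P) (hind : IndepFun X Y P)
    {Ψ Ψ' : ℝ × 𝓨 → ℝ} (mΨ : Measurable Ψ) (mΨ' : Measurable Ψ')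
    (hd : ∀ x y, HasDerivAt (fun x => Ψ (x, y)) (Ψ' (x, y)) x)
    (h1 : Integrable (fun ω => X ω * Ψ (X ω, Y ω)) P)
    (h2 : Integrable (fun ω => Ψ' (X ω, Y ω)) P)
    (h0 : Integrable (fun ω => Ψ (X ω, Y ω)) P) :
    ∫ ω, X ω * Ψ (X ω, Y ω) ∂P = v * ∫ ω, Ψ' (X ω, Y ω) ∂P := by
  have hXY : AEMeasurable (fun ω => (X ω, Y ω)) P := hX.aemeasurable.prodMk hY
  have hmap : P.map (fun ω => (X ω, Y ω)) = (gaussianReal 0 v).prod (P.map Y) := by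
    rw [(indepFun_iff_map_prod_eq_prod_map_map hX.aemeasurable hY).1 hind, hX.map_eq]
  have : IsProbabilityMeasure (P.map Y) := Measure.isProbabilityMeasure_map hY
  have mx : Measurable fun p : ℝ × 𝓨 => p.1 * Ψ p := measurable_fst.mul mΨ
  have tr : ∀ f : ℝ × 𝓨 → ℝ, Measurable f → Integrable (fun ω => f (X ω, Y ω)) P →
      Integrable f ((gaussianReal 0 v).prod (P.map Y)) := by
    intro f mf hf
    rw [← hmap]
    exact (integrable_map_measure mf.aestronglyMeasurable hXY).2 hf
  have ti : ∀ f : ℝ × 𝓨 → ℝ, Measurable f →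
      ∫ ω, f (X ω, Y ω) ∂P = ∫ p, f p ∂((gaussianReal 0 v).prod (P.map Y)) := by
    intro f mf
    rw [← hmap, integral_map hXY mf.aestronglyMeasurable]
  have i1 := tr _ mx h1
  have i2 := tr _ mΨ' h2
  have i0 := tr _ mΨ h0
  -- By independence the joint law is a product, so the one-dimensional identity can be applied for
  -- almost every frozen `y`.
  rw [ti _ mx, ti _ mΨ', integral_prod_symm _ i1, integral_prod_symm _ i2, ← integral_const_mul]
  refine integral_congr_ae ?_
  filter_upwards [i1.prod_left_ae, i2.prod_left_ae, i0.prod_left_ae] with y a1 a2 a0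
  exact integral_id_mul_gaussianReal v (fun x => hd x y) a1 a2 a0

/-- The empirical average of `g` over the first `K` sample points. -/
noncomputable def avg (K : ℕ) (g : ℕ → ℝ) : ℝ := (∑ k ∈ Finset.range K, g k) / K

theorem avg_nonneg {K : ℕ} {g : ℕ → ℝ} (hg : ∀ k, 0 ≤ g k) : 0 ≤ avg K g :=
  div_nonneg (Finset.sum_nonneg fun k _ => hg k) (Nat.cast_nonneg _)

theorem abs_avg_mul_le {K : ℕ} {c g : ℕ → ℝ} {C : ℝ} (hc : ∀ k, |c k| ≤ C) (hg : ∀ k, 0 ≤ g k) :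
    |avg K fun k => c k * g k| ≤ C * avg K g := by
  unfold avg
  rw [abs_div, Nat.abs_cast, ← mul_div_assoc, Finset.mul_sum]
  gcongr
  refine (Finset.abs_sum_le_sum_abs _ _).trans (Finset.sum_le_sum fun k _ => ?_)
  rw [abs_mul, abs_of_nonneg (hg k)]
  exact mul_le_mul_of_nonneg_right (hc k) (hg k)

/-! ### Integration by parts for functionals of finitely many Gaussian variables -/

section Cylinder

variable {Ω S : Type*} [MeasurableSpace Ω] {P : Measure Ω} [IsProbabilityMeasure P]
  {X : Ω → ℝ} {G : S → Ω → ℝ}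

/-- The shift `δ > 0` keeps the denominator positive even for `K = 0`, where the empirical average
is `0`. -/
theorem hasDerivAt_cylinder {n p K : ℕ} {δ : ℝ} (hδ : 0 < δ) (a b : S → ℝ) (s : Fin n → S)
    (τ : ℕ → S) (x : ℝ) :
    HasDerivAt (fun x => Real.exp (∑ l, (a (s l) + b (s l) * x)) /
        (avg K (fun k => Real.exp (a (τ k) + b (τ k) * x)) + δ) ^ p)
      ((∑ l, b (s l)) * (Real.exp (∑ l, (a (s l) + b (s l) * x)) /
        (avg K (fun k => Real.exp (a (τ k) + b (τ k) * x)) + δ) ^ p)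
       - p * (Real.exp (∑ l, (a (s l) + b (s l) * x)) *
          avg K (fun k => b (τ k) * Real.exp (a (τ k) + b (τ k) * x)) /
        (avg K (fun k => Real.exp (a (τ k) + b (τ k) * x)) + δ) ^ (p + 1))) x := by
  have e1 : ∀ σ, HasDerivAt (fun x => a σ + b σ * x) (b σ) x := fun σ => by
    simpa using ((hasDerivAt_id x).const_mul (b σ)).const_add (a σ)
  have hN : HasDerivAt (fun x => Real.exp (∑ l, (a (s l) + b (s l) * x)))
      (Real.exp (∑ l, (a (s l) + b (s l) * x)) * ∑ l, b (s l)) x :=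
    (HasDerivAt.fun_sum fun l _ => e1 (s l)).exp
  have hA : HasDerivAt (fun x => avg K (fun k => Real.exp (a (τ k) + b (τ k) * x)) + δ)
      (avg K (fun k => b (τ k) * Real.exp (a (τ k) + b (τ k) * x))) x := by
    unfold avg
    refine HasDerivAt.add_const _ (HasDerivAt.div_const (HasDerivAt.fun_sum fun k _ => ?_) _)
    simpa [mul_comm] using (e1 (τ k)).exp
  have hpos : 0 < avg K (fun k => Real.exp (a (τ k) + b (τ k) * x)) + δ :=
    add_pos_of_nonneg_of_pos (avg_nonneg fun k => (Real.exp_pos _).le) hδ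
  have := hN.fun_div (hA.fun_pow p) (pow_ne_zero _ hpos.ne')
  convert! this using 1
  rcases p with _ | p
  · simp; ring
  · simp only [Nat.add_sub_cancel]
    generalize avg K (fun k => Real.exp (a (τ k) + b (τ k) * x)) + δ = A at *
    generalize Real.exp (∑ l, (a (s l) + b (s l) * x)) = E
    generalize avg K (fun k => b (τ k) * Real.exp (a (τ k) + b (τ k) * x)) = B
    field_simp
    ring

/-- Regression on `X`: write `G σ = (c σ / v) X + Y σ` with `v` the variance of `X`. The residual
field `Y` is uncorrelated with `X` and jointly Gaussian with it, hence independent, so Stein's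
identity applies with `Y` as a parameter. Regularising by `δ` bounds all denominators, so
integrability of the two numerators is enough. -/
theorem gaussian_ibp_cylinder (hG : IsGaussianProcess (Sum.elim (fun _ : Unit => X) G) P)
    (mX : Measurable X) (mG : ∀ σ, Measurable (G σ)) (X0 : ∫ ω, X ω ∂P = 0)
    {c : S → ℝ} (hc : ∀ σ, ∫ ω, X ω * G σ ω ∂P = c σ) {C : ℝ}
    (hC : ∀ σ, |c σ| ≤ C) (m : S → ℝ) {n p K : ℕ} {δ : ℝ} (hδ : 0 < δ) (s : Fin n → S) (τ : ℕ → S)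
    (h0 : Integrable (fun ω => Real.exp (∑ l, (G (s l) ω + m (s l)))) P)
    (h1 : Integrable (fun ω => X ω * Real.exp (∑ l, (G (s l) ω + m (s l)))) P) :
    ∫ ω, X ω * (Real.exp (∑ l, (G (s l) ω + m (s l))) /
        (avg K (fun k => Real.exp (G (τ k) ω + m (τ k))) + δ) ^ p) ∂P
      = (∑ l, c (s l)) * ∫ ω, Real.exp (∑ l, (G (s l) ω + m (s l))) /
        (avg K (fun k => Real.exp (G (τ k) ω + m (τ k))) + δ) ^ p ∂P
       - p * ∫ ω, Real.exp (∑ l, (G (s l) ω + m (s l))) *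
          avg K (fun k => c (τ k) * Real.exp (G (τ k) ω + m (τ k))) /
        (avg K (fun k => Real.exp (G (τ k) ω + m (τ k))) + δ) ^ (p + 1) ∂P := by
  have hXg : HasGaussianLaw X P := hG.hasGaussianLaw_eval (Sum.inl ())
  have hGg : ∀ σ, HasGaussianLaw (G σ) P := fun σ => hG.hasGaussianLaw_eval (Sum.inr σ)
  set v : ℝ≥0 := Var[X; P].toNNReal with hv
  have hvv : (v : ℝ) = ∫ ω, X ω * X ω ∂P := by
    rw [hv, Real.coe_toNNReal _ (variance_nonneg _ _),
      variance_of_integral_eq_zero mX.aemeasurable X0]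
    congr 1; ext ω; ring
  have hlaw : HasLaw X (gaussianReal 0 v) P := by
    refine ⟨mX.aemeasurable, ?_⟩
    rw [hXg.map_eq_gaussianReal, X0]
  -- integrability of the three regularised quantities
  have hmA : ∀ (d : S → ℝ), Measurable fun ω =>
      avg K (fun k => d (τ k) * Real.exp (G (τ k) ω + m (τ k))) := by
    intro d; unfold avg
    refine (Finset.measurable_sum _ fun k _ => ?_).div_const _
    exact (((mG _).add_const _).exp).const_mul _
  have hmA1 : Measurable fun ω => avg K (fun k => Real.exp (G (τ k) ω + m (τ k))) := by
    simpa using hmA fun _ => 1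
  have hA0 : ∀ ω, 0 ≤ avg K (fun k => Real.exp (G (τ k) ω + m (τ k))) :=
    fun ω => avg_nonneg fun k => (Real.exp_pos _).le
  have hbd : ∀ ω (j : ℕ), ((avg K (fun k => Real.exp (G (τ k) ω + m (τ k))) + δ) ^ j)⁻¹
      ≤ (δ ^ j)⁻¹ := by
    intro ω j
    have := hA0 ω
    gcongr
    linarith
  have hmN : Measurable fun ω => Real.exp (∑ l, (G (s l) ω + m (s l))) :=
    (Finset.measurable_sum _ fun l _ => (mG _).add_const _).exp
  have i0 : Integrable (fun ω => Real.exp (∑ l, (G (s l) ω + m (s l))) /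
        (avg K (fun k => Real.exp (G (τ k) ω + m (τ k))) + δ) ^ p) P := by
    simp only [div_eq_mul_inv]
    refine h0.mul_bdd (c := (δ ^ p)⁻¹)
      ((hmA1.add_const δ).pow_const p).inv.aestronglyMeasurable (ae_of_all _ fun ω => ?_)
    rw [Real.norm_of_nonneg (by have := hA0 ω; positivity)]
    exact hbd ω p
  have i1 : Integrable (fun ω => X ω * (Real.exp (∑ l, (G (s l) ω + m (s l))) /
        (avg K (fun k => Real.exp (G (τ k) ω + m (τ k))) + δ) ^ p)) P := by
    simp only [div_eq_mul_inv, ← mul_assoc]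
    refine h1.mul_bdd (c := (δ ^ p)⁻¹)
      ((hmA1.add_const δ).pow_const p).inv.aestronglyMeasurable (ae_of_all _ fun ω => ?_)
    rw [Real.norm_of_nonneg (by have := hA0 ω; positivity)]
    exact hbd ω p
  have i2 : ∀ (d : S → ℝ) (D : ℝ), (∀ σ, |d σ| ≤ D) →
      Integrable (fun ω => Real.exp (∑ l, (G (s l) ω + m (s l))) *
          avg K (fun k => d (τ k) * Real.exp (G (τ k) ω + m (τ k))) /
        (avg K (fun k => Real.exp (G (τ k) ω + m (τ k))) + δ) ^ (p + 1)) P := by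
    intro d D hD
    simp only [mul_div_assoc]
    refine h0.mul_bdd (c := D * (δ ^ p)⁻¹)
      ((hmA d).div ((hmA1.add_const δ).pow_const _)).aestronglyMeasurable
      (ae_of_all _ fun ω => ?_)
    have hpos : 0 < avg K (fun k => Real.exp (G (τ k) ω + m (τ k))) + δ := by
      have := hA0 ω; positivity
    have hb := abs_avg_mul_le (K := K) (fun k => hD (τ k))
      (fun k => (Real.exp_pos (G (τ k) ω + m (τ k))).le)
    have hD0 : 0 ≤ D := (abs_nonneg _).trans (hD (τ 0))
    rw [norm_div, Real.norm_eq_abs, Real.norm_of_nonneg (pow_pos hpos _).le, pow_succ,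
      ← div_div, div_le_iff₀ hpos]
    calc |avg K fun k => d (τ k) * Real.exp (G (τ k) ω + m (τ k))| /
          (avg K (fun k => Real.exp (G (τ k) ω + m (τ k))) + δ) ^ p
        ≤ (D * (avg K (fun k => Real.exp (G (τ k) ω + m (τ k))) + δ)) * (δ ^ p)⁻¹ := by
          rw [div_eq_mul_inv]
          gcongr
          · exact hb.trans (by gcongr; linarith)
          · have := hA0 ω
            linarith
      _ = _ := by ring
  -- If `X` vanishes almost surely then so do all covariances `c σ`, and the identity is `0 = 0`.
  by_cases hv0 : v = 0
  · have hX0 : X =ᵐ[P] 0 := by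
      have h2 : ∫ ω, X ω * X ω ∂P = 0 := by rw [← hvv, hv0]; rfl
      have h3 := (integral_eq_zero_iff_of_nonneg (fun ω => mul_self_nonneg (X ω))
        (by simpa [sq] using hXg.memLp_two.integrable_sq)).1 h2
      filter_upwards [h3] with ω hω
      simpa using hω
    have hc0 : ∀ σ, c σ = 0 := fun σ => by
      rw [← hc σ]
      refine integral_eq_zero_of_ae ?_
      filter_upwards [hX0] with ω hω
      simp [hω]
    have hl : ∫ ω, X ω * (Real.exp (∑ l, (G (s l) ω + m (s l))) /
        (avg K (fun k => Real.exp (G (τ k) ω + m (τ k))) + δ) ^ p) ∂P = 0 := by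
      refine integral_eq_zero_of_ae ?_
      filter_upwards [hX0] with ω hω
      simp [hω]
    rw [hl]
    simp [hc0, avg]
  have hvr : (v : ℝ) ≠ 0 := by exact_mod_cast hv0
  let Y : S → Ω → ℝ := fun σ ω => G σ ω - c σ / v * X ω
  have mY : ∀ σ, Measurable (Y σ) := fun σ => (mG σ).sub (mX.const_mul _)
  have hXY : IsGaussianProcess (Sum.elim (fun _ : Unit => X) Y) P := by
    classical
    refine hG.of_isGaussianProcess ?_
    rintro (u | σ)
    · exact ⟨{Sum.inl ()}, .proj ⟨Sum.inl (), by simp⟩, fun ω => rfl⟩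
    · refine ⟨{Sum.inl (), Sum.inr σ}, .proj ⟨Sum.inr σ, by simp⟩ -
        (c σ / v) • .proj ⟨Sum.inl (), by simp⟩, fun ω => ?_⟩
      simp [Y, Finset.restrict]
  have hind : IndepFun (fun ω (_ : Unit) => X ω) (fun ω σ => Y σ ω) P := by
    refine hXY.indepFun_of_covariance_eq_zero (fun _ => mX.aemeasurable)
      (fun σ => (mY σ).aemeasurable) fun _ σ => ?_
    have hYg : HasGaussianLaw (Y σ) P := hXY.hasGaussianLaw_eval (Sum.inr σ)
    rw [covariance_eq_sub hXg.memLp_two hYg.memLp_two, X0, zero_mul, sub_zero]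
    have : ∫ ω, X ω * Y σ ω ∂P = ∫ ω, X ω * G σ ω - c σ / v * (X ω * X ω) ∂P := by
      congr 1; ext ω; simp only [Y]; ring
    simp only [Pi.mul_apply]
    rw [this, integral_sub, integral_const_mul, hc, ← hvv]
    · field_simp; simp
    · exact hXg.memLp_two.integrable_mul (hGg σ).memLp_two
    · exact (hXg.memLp_two.integrable_mul hXg.memLp_two).const_mul _
  have hind' : IndepFun X (fun ω σ => Y σ ω) P :=
    hind.comp (φ := fun f : Unit → ℝ => f ()) (measurable_pi_apply ()) measurable_id
  let Ψ : ℝ × (S → ℝ) → ℝ := fun q =>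
    Real.exp (∑ l, ((q.2 (s l) + m (s l)) + c (s l) / v * q.1)) /
        (avg K (fun k => Real.exp ((q.2 (τ k) + m (τ k)) + c (τ k) / v * q.1)) + δ) ^ p
  let Ψ' : ℝ × (S → ℝ) → ℝ := fun q =>
    (∑ l, c (s l) / v) * Ψ q
     - p * (Real.exp (∑ l, ((q.2 (s l) + m (s l)) + c (s l) / v * q.1)) *
        avg K (fun k => c (τ k) / v * Real.exp ((q.2 (τ k) + m (τ k)) + c (τ k) / v * q.1)) /
        (avg K (fun k => Real.exp ((q.2 (τ k) + m (τ k)) + c (τ k) / v * q.1)) + δ) ^ (p + 1))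
  have hlin : ∀ σ, Measurable fun q : ℝ × (S → ℝ) => (q.2 σ + m σ) + c σ / v * q.1 := fun σ =>
    (((measurable_pi_apply σ).comp measurable_snd).add_const _).add (measurable_fst.const_mul _)
  have hNm : Measurable fun q : ℝ × (S → ℝ) =>
      Real.exp (∑ l, ((q.2 (s l) + m (s l)) + c (s l) / v * q.1)) :=
    (Finset.measurable_sum _ fun l _ => hlin (s l)).exp
  have hAm : ∀ d : S → ℝ, Measurable fun q : ℝ × (S → ℝ) =>
      avg K (fun k => d (τ k) * Real.exp ((q.2 (τ k) + m (τ k)) + c (τ k) / v * q.1)) := fun d => by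
    unfold avg
    exact (Finset.measurable_sum _ fun k _ => (hlin (τ k)).exp.const_mul _).div_const _
  have hAm1 : Measurable fun q : ℝ × (S → ℝ) =>
      avg K (fun k => Real.exp ((q.2 (τ k) + m (τ k)) + c (τ k) / v * q.1)) := by
    simpa using hAm fun _ => 1
  have mΨ : Measurable Ψ := hNm.div ((hAm1.add_const δ).pow_const p)
  have mΨ' : Measurable Ψ' := (mΨ.const_mul _).sub
    (((hNm.mul (hAm fun σ => c σ / v)).div ((hAm1.add_const δ).pow_const _)).const_mul _)
  have hsub : ∀ σ ω, (Y σ ω + m σ) + c σ / v * X ω = G σ ω + m σ := fun σ ω => by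
    simp only [Y]; ring
  have eΨ : ∀ ω, Ψ (X ω, fun σ => Y σ ω) = Real.exp (∑ l, (G (s l) ω + m (s l))) /
        (avg K (fun k => Real.exp (G (τ k) ω + m (τ k))) + δ) ^ p := fun ω => by
    simp only [Ψ, hsub]
  have eΨ' : ∀ ω, Ψ' (X ω, fun σ => Y σ ω) =
     -- The derivative in `X` produces the slopes `c / v`; Stein's factor `v` then restores `c`.
     (∑ l, c (s l) / v) * (Real.exp (∑ l, (G (s l) ω + m (s l))) /
        (avg K (fun k => Real.exp (G (τ k) ω + m (τ k))) + δ) ^ p)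
     - p * (Real.exp (∑ l, (G (s l) ω + m (s l))) *
          avg K (fun k => c (τ k) / v * Real.exp (G (τ k) ω + m (τ k))) /
        (avg K (fun k => Real.exp (G (τ k) ω + m (τ k))) + δ) ^ (p + 1)) := fun ω => by
    simp only [Ψ', Ψ, hsub]
  have i2' := i2 (fun σ => c σ / v) (C / v) fun σ => by
    rw [abs_div, abs_of_nonneg v.coe_nonneg]; gcongr; exact hC σ
  have j1 : Integrable (fun ω => X ω * Ψ (X ω, fun σ => Y σ ω)) P := by simpa only [eΨ] using i1
  have j0 : Integrable (fun ω => Ψ (X ω, fun σ => Y σ ω)) P := by simpa only [eΨ] using i0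
  have j2 : Integrable (fun ω => Ψ' (X ω, fun σ => Y σ ω)) P := by
    simp only [eΨ']; exact (i0.const_mul _).sub (i2'.const_mul _)
  have key := integral_mul_of_indepFun hlaw (measurable_pi_lambda _ mY).aemeasurable hind' mΨ mΨ'
    (fun x y => hasDerivAt_cylinder hδ (fun σ => y σ + m σ) (fun σ => c σ / v) s τ x)
    j1 j2 j0
  rw [integral_congr_ae (ae_of_all _ fun ω => congrArg (X ω * ·) (eΨ ω)),
    integral_congr_ae (ae_of_all _ eΨ')] at key
  rw [key, integral_sub (i0.const_mul _) (i2'.const_mul _), integral_const_mul, integral_const_mul,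
    mul_sub, ← mul_assoc, ← mul_assoc, ← Finset.sum_div]
  congr 1
  · rw [mul_div_cancel₀ _ hvr]
  · rw [mul_comm (v : ℝ), mul_assoc, ← integral_const_mul]
    congr 1
    refine integral_congr_ae (ae_of_all _ fun ω => ?_)
    have : avg K (fun k => c (τ k) / v * Real.exp (G (τ k) ω + m (τ k))) =
        (avg K fun k => c (τ k) * Real.exp (G (τ k) ω + m (τ k))) / v := by
      unfold avg
      rw [div_right_comm]
      congr 1
      rw [Finset.sum_div]
      exact Finset.sum_congr rfl fun k _ => by ring
    simp only [this]
    field_simp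

end Cylinder

/-! ### Replacing the partition function by empirical averages -/

theorem measurable_comp₂ {S Ω α : Type*} [MeasurableSpace S] [MeasurableSpace Ω]
    [MeasurableSpace α] {g : S → Ω → ℝ} (mg : Measurable (Function.uncurry g)) {a : α → S}
    {b : α → Ω} (ha : Measurable a) (hb : Measurable b) : Measurable fun x => g (a x) (b x) :=
  mg.comp (ha.prodMk hb)

open Filter Topology in
/-- Almost every i.i.d. sample `τ` from `lam` has the property that for almost every `ω`
the empirical averages of `g (·) ω` along `τ` converge to its mean. -/
theorem ae_tendsto_avg {S Ω : Type*} [MeasurableSpace S] [MeasurableSpace Ω] (lam : Measure S)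
    [IsProbabilityMeasure lam] (P : Measure Ω) [IsProbabilityMeasure P] {g : S → Ω → ℝ}
    (mg : Measurable (Function.uncurry g)) (hg : ∀ᵐ ω ∂P, Integrable (fun σ => g σ ω) lam) :
    ∀ᵐ τ ∂(Measure.infinitePi fun _ : ℕ => lam), ∀ᵐ ω ∂P,
      Tendsto (fun K => avg K fun k => g (τ k) ω) atTop (𝓝 (∫ σ, g σ ω ∂lam)) := by
  -- The strong law gives, for each good `ω`, almost every `τ`; Fubini exchanges the quantifiers so
  -- that one deterministic sequence `τ` can serve almost every `ω`.
  rw [Measure.ae_ae_comm]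
  · filter_upwards [hg] with ω hω
    have mω : Measurable fun σ => g σ ω := mg.comp measurable_prodMk_right
    have mp : ∀ k, MeasurePreserving (Function.eval k) (Measure.infinitePi fun _ : ℕ => lam) lam :=
      fun k => measurePreserving_eval_infinitePi (fun _ : ℕ => lam) k
    have h := strong_law_ae_real (μ := Measure.infinitePi fun _ : ℕ => lam)
      (fun k τ => g (τ k) ω) ((mp 0).integrable_comp_of_integrable hω)
      (fun i j hij => (iIndepFun_infinitePi (P := fun _ : ℕ => lam)
        (X := fun _ σ => g σ ω) fun _ => mω).indepFun hij)
      (fun i => by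
        refine ⟨(mω.comp (measurable_pi_apply i)).aemeasurable,
          (mω.comp (measurable_pi_apply 0)).aemeasurable, ?_⟩
        rw [show (fun τ : ℕ → S => g (τ i) ω) = (fun σ => g σ ω) ∘ Function.eval i from rfl,
          show (fun τ : ℕ → S => g (τ 0) ω) = (fun σ => g σ ω) ∘ Function.eval 0 from rfl,
          ← Measure.map_map mω (mp i).measurable, ← Measure.map_map mω (mp 0).measurable,
          (mp i).map_eq, (mp 0).map_eq])
    filter_upwards [h] with τ hτ
    have e : ∫ τ : ℕ → S, g (τ 0) ω ∂(Measure.infinitePi fun _ : ℕ => lam) = ∫ σ, g σ ω ∂lam := by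
      have := integral_map (μ := Measure.infinitePi fun _ : ℕ => lam)
        (mp 0).measurable.aemeasurable (f := fun σ => g σ ω) mω.aestronglyMeasurable
      rw [(mp 0).map_eq] at this
      exact this.symm
    rw [e] at hτ
    exact hτ
  · refine measurableSet_tendsto_fun (fun K => ?_) ?_
    · unfold avg
      refine (Finset.measurable_sum _ fun k _ => ?_).div_const _
      exact measurable_comp₂ mg ((measurable_pi_apply k).comp measurable_fst) measurable_snd
    · have : StronglyMeasurable fun ω => ∫ σ, g σ ω ∂lam :=
        mg.stronglyMeasurable.integral_prod_left
      exact this.measurable.comp measurable_snd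

/-! ### Exponential moments and dominating weights -/

/-- Monotonicity of `L^p` norms on a probability space, applied to the positive part of `f`. -/
theorem lintegral_pow_le_lintegral_pow {S : Type*} [MeasurableSpace S] (lam : Measure S)
    [IsProbabilityMeasure lam] {f : S → ℝ} (hf : Measurable f) (p : ℕ) :
    (∫⁻ σ, ENNReal.ofReal (f σ) ∂lam) ^ p ≤ ∫⁻ σ, ENNReal.ofReal (f σ) ^ p ∂lam := by
  rcases Nat.eq_zero_or_pos p with rfl | hp
  · simp
  have h := eLpNorm'_le_eLpNorm'_of_exponent_le (μ := lam) (f := fun σ => max (f σ) 0)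
    one_pos (q := (p : ℝ)) (by exact_mod_cast hp)
    (hf.max measurable_const).aestronglyMeasurable
  have e : ∀ σ, ‖max (f σ) 0‖ₑ = ENNReal.ofReal (f σ) := fun σ => by
    rw [Real.enorm_of_nonneg (le_max_right _ _)]
    simp [ENNReal.ofReal_max]
  simp only [eLpNorm', e, ENNReal.rpow_one, div_one, ENNReal.rpow_natCast] at h
  have h2 := ENNReal.rpow_le_rpow h (z := (p : ℝ)) (by positivity)
  rwa [← ENNReal.rpow_mul, one_div, inv_mul_cancel₀ (by positivity), ENNReal.rpow_one,
    ENNReal.rpow_natCast] at h2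

/-- A crude substitute for Hölder: the product is at most the largest factor raised to the total
degree. -/
theorem prod_pow_le_sum_pow {ι : Type*} [Fintype ι] [Nonempty ι] (x : ι → ℝ≥0∞) (e : ι → ℕ) :
    ∏ i, x i ^ e i ≤ ∑ i, x i ^ ∑ j, e j := by
  obtain ⟨i, -, hi⟩ := Finset.exists_max_image Finset.univ x Finset.univ_nonempty
  calc ∏ j, x j ^ e j ≤ ∏ j, x i ^ e j :=
        Finset.prod_le_prod' fun j hj => pow_le_pow_left' (hi j hj) _
    _ = x i ^ ∑ j, e j := Finset.prod_pow_eq_pow_sum _ _ _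
    _ ≤ _ := Finset.single_le_sum (f := fun i => x i ^ ∑ j, e j) (fun _ _ => zero_le) (Finset.mem_univ i)

/-- `K` is a nonnegative, jointly measurable random field whose exponential moments are bounded
uniformly in the index. -/
structure ExpMoments {S Ω : Type*} [MeasurableSpace S] [MeasurableSpace Ω] (P : Measure Ω)
    (K : S → Ω → ℝ) : Prop where
  meas : Measurable (Function.uncurry K)
  nonneg : ∀ σ ω, 0 ≤ K σ ω
  moment : ∀ p : ℕ, ∃ C : ℝ≥0, ∀ σ, ∫⁻ ω, ENNReal.ofReal (Real.exp (K σ ω)) ^ p ∂P ≤ C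

/-- The random normalization `∫ exp(2 K) dλ`. -/
noncomputable def expMass {S Ω : Type*} [MeasurableSpace S] (lam : Measure S)
    (K : S → Ω → ℝ) (ω : Ω) : ℝ≥0∞ := ∫⁻ σ, ENNReal.ofReal (Real.exp (2 * K σ ω)) ∂lam

/-- The weight `exp(∑_l K(s_l))^a (∫ exp(2 K) dλ)^b` that dominates everything. -/
noncomputable def bnd {S Ω : Type*} [MeasurableSpace S] (lam : Measure S) (K : S → Ω → ℝ)
    {m : ℕ} (a b : ℕ) (s : Fin m → S) (ω : Ω) : ℝ :=
  Real.exp (∑ l, K (s l) ω) ^ a * (expMass lam K ω).toReal ^ b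

section Moments

variable {S Ω : Type*} [MeasurableSpace S] [MeasurableSpace Ω] {lam : Measure S}
  [IsProbabilityMeasure lam] {P : Measure Ω} [IsProbabilityMeasure P] {K : S → Ω → ℝ}

theorem ExpMoments.measurable_left (hK : ExpMoments P K) (ω : Ω) : Measurable fun σ => K σ ω :=
  hK.meas.comp measurable_prodMk_right

theorem ExpMoments.measurable_right (hK : ExpMoments P K) (σ : S) : Measurable (K σ) :=
  hK.meas.comp measurable_prodMk_left

theorem ExpMoments.measurable_expMass (hK : ExpMoments P K) : Measurable (expMass lam K) := by
  unfold expMass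
  refine Measurable.lintegral_prod_left' (f := fun p : S × Ω =>
    ENNReal.ofReal (Real.exp (2 * K p.1 p.2))) ?_
  exact (hK.meas.const_mul 2).exp.ennreal_ofReal

theorem ExpMoments.measurable_bnd (hK : ExpMoments P K) {m : ℕ} (a b : ℕ) :
    Measurable fun p : (Fin m → S) × Ω => bnd lam K a b p.1 p.2 := by
  unfold bnd
  refine Measurable.mul ?_ ?_
  · refine ((Finset.measurable_sum _ fun l _ => ?_).exp).pow_const _
    exact measurable_comp₂ hK.meas ((measurable_pi_apply l).comp measurable_fst) measurable_snd
  · exact ((hK.measurable_expMass.comp measurable_snd).ennreal_toReal).pow_const _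

/-- Jensen moves the power inside the `lam`-integral, and Tonelli then reduces to the uniform moment
of order `2p`. -/
theorem ExpMoments.expMass_pow (hK : ExpMoments P K) (p : ℕ) :
    ∃ C : ℝ≥0, ∫⁻ ω, expMass lam K ω ^ p ∂P ≤ C := by
  obtain ⟨C, hC⟩ := hK.moment (2 * p)
  refine ⟨C, ?_⟩
  calc ∫⁻ ω, expMass lam K ω ^ p ∂P
      ≤ ∫⁻ ω, ∫⁻ σ, ENNReal.ofReal (Real.exp (K σ ω)) ^ (2 * p) ∂lam ∂P := by
        refine lintegral_mono fun ω => ?_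
        refine (lintegral_pow_le_lintegral_pow lam
          ((hK.measurable_left ω).const_mul 2).exp p).trans (le_of_eq ?_)
        congr 1; ext σ
        rw [pow_mul, ← ENNReal.ofReal_pow (Real.exp_pos _).le 2, ← Real.exp_nat_mul]
        norm_num
    _ = ∫⁻ σ, ∫⁻ ω, ENNReal.ofReal (Real.exp (K σ ω)) ^ (2 * p) ∂P ∂lam := by
        rw [lintegral_lintegral_swap]
        exact ((hK.meas.comp measurable_swap).exp.ennreal_ofReal.pow_const _).aemeasurable
    _ ≤ ∫⁻ σ, C ∂lam := lintegral_mono hC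
    _ = C := by simp

theorem ExpMoments.ae_expMass_ne_top (hK : ExpMoments P K) : ∀ᵐ ω ∂P, expMass lam K ω ≠ ∞ := by
  obtain ⟨C, hC⟩ := hK.expMass_pow (lam := lam) 1
  simp only [pow_one] at hC
  filter_upwards [ae_lt_top hK.measurable_expMass (hC.trans_lt ENNReal.coe_lt_top).ne] with ω hω
  exact hω.ne

/-- The point is that `C` does not depend on `s`: this is what later allows a factor `F s` that is
merely integrable. -/
theorem ExpMoments.lintegral_bnd (hK : ExpMoments P K) (m a b : ℕ) :
    ∃ C : ℝ≥0, ∀ s : Fin m → S, ∫⁻ ω, ENNReal.ofReal (bnd lam K a b s ω) ∂P ≤ C := by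
  -- The index `none` stands for the mass `expMass`, with exponent `b`; `some l` stands for replica
  -- `l`, with exponent `a`.
  let e : Option (Fin m) → ℕ := fun o => o.elim b fun _ => a
  obtain ⟨C1, hC1⟩ := hK.moment (∑ j, e j)
  obtain ⟨C2, hC2⟩ := hK.expMass_pow (lam := lam) (∑ j, e j)
  refine ⟨C2 + m * C1, fun s => ?_⟩
  let x : Ω → Option (Fin m) → ℝ≥0∞ := fun ω o =>
    o.elim (expMass lam K ω) fun l => ENNReal.ofReal (Real.exp (K (s l) ω))
  have h1 : ∀ ω, ENNReal.ofReal (bnd lam K a b s ω) ≤ ∏ o, x ω o ^ e o := by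
    intro ω
    rw [Fintype.prod_option]
    simp only [x, e, Option.elim, bnd]
    rw [ENNReal.ofReal_mul (by positivity), ENNReal.ofReal_pow ENNReal.toReal_nonneg,
      mul_comm, Finset.prod_pow, ENNReal.ofReal_pow (Real.exp_pos _).le, Real.exp_sum,
      ENNReal.ofReal_prod_of_nonneg fun _ _ => (Real.exp_pos _).le]
    gcongr
    exact ENNReal.ofReal_toReal_le
  calc ∫⁻ ω, ENNReal.ofReal (bnd lam K a b s ω) ∂P
      ≤ ∫⁻ ω, ∑ o, x ω o ^ ∑ j, e j ∂P :=
        lintegral_mono fun ω => (h1 ω).trans (prod_pow_le_sum_pow _ _)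
    _ = ∑ o, ∫⁻ ω, x ω o ^ ∑ j, e j ∂P := by
        refine lintegral_finsetSum _ fun o _ => Measurable.pow_const ?_ _
        rcases o with _ | l
        · exact hK.measurable_expMass
        · exact (hK.measurable_right _).exp.ennreal_ofReal
    _ ≤ _ := by
        rw [Fintype.sum_option]
        simp only [x, Option.elim]
        push_cast
        gcongr
        refine (Finset.sum_le_sum fun l _ => hC1 (s l)).trans ?_
        simp

theorem bnd_nonneg {m : ℕ} (a b : ℕ) (s : Fin m → S) (ω : Ω) : 0 ≤ bnd lam K a b s ω := by
  unfold bnd; positivity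

theorem ExpMoments.measurable_bnd_right (hK : ExpMoments P K) {m : ℕ} (a b : ℕ) (s : Fin m → S) :
    Measurable (bnd lam K a b s) :=
  hK.measurable_bnd (lam := lam) a b |>.comp measurable_prodMk_left

theorem ExpMoments.integrable_bnd (hK : ExpMoments P K) {m : ℕ} (a b : ℕ) (s : Fin m → S) :
    Integrable (bnd lam K a b s) P := by
  obtain ⟨C, hC⟩ := hK.lintegral_bnd (lam := lam) m a b
  refine ⟨(hK.measurable_bnd_right a b s).aestronglyMeasurable, ?_⟩
  rw [hasFiniteIntegral_iff_ofReal (ae_of_all _ fun ω => bnd_nonneg a b s ω)]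
  exact (hC s).trans_lt ENNReal.coe_lt_top

theorem ExpMoments.integral_bnd_le (hK : ExpMoments P K) (m a b : ℕ) :
    ∃ C : ℝ, ∀ s : Fin m → S, ∫ ω, bnd lam K a b s ω ∂P ≤ C := by
  obtain ⟨C, hC⟩ := hK.lintegral_bnd (lam := lam) m a b
  refine ⟨C, fun s => ?_⟩
  rw [integral_eq_lintegral_of_nonneg_ae (ae_of_all _ fun ω => bnd_nonneg a b s ω)
    (hK.measurable_bnd_right a b s).aestronglyMeasurable]
  exact ENNReal.toReal_le_of_le_ofReal C.coe_nonneg (by simpa using hC s)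

theorem ExpMoments.integrable_mul_bnd (hK : ExpMoments P K) {m : ℕ} (a b : ℕ)
    {F : (Fin m → S) → ℝ} (hF : Integrable F (Measure.pi fun _ => lam)) :
    Integrable (fun p : (Fin m → S) × Ω => F p.1 * bnd lam K a b p.1 p.2)
      ((Measure.pi fun _ => lam).prod P) := by
  have hm : AEStronglyMeasurable (fun p : (Fin m → S) × Ω => F p.1 * bnd lam K a b p.1 p.2)
      ((Measure.pi fun _ => lam).prod P) :=
    hF.aestronglyMeasurable.comp_fst.mul (hK.measurable_bnd a b).aestronglyMeasurable
  rw [integrable_prod_iff hm]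
  refine ⟨ae_of_all _ fun s => (hK.integrable_bnd a b s).const_mul (F s), ?_⟩
  obtain ⟨C, hC⟩ := hK.integral_bnd_le (lam := lam) m a b
  refine (hF.norm.mul_const C).mono' hm.norm.integral_prod_right' (ae_of_all _ fun s => ?_)
  rw [Real.norm_of_nonneg (integral_nonneg fun _ => norm_nonneg _)]
  simp only [norm_mul, Real.norm_of_nonneg (bnd_nonneg _ _ _ _), integral_const_mul]
  exact mul_le_mul_of_nonneg_left (hC s) (norm_nonneg _)

end Moments

/-- A jointly measurable Hamiltonian dominated by the field `K`. -/
structure Dom {S Ω : Type*} [MeasurableSpace S] [MeasurableSpace Ω] (K H : S → Ω → ℝ) : Prop where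
  meas : Measurable (Function.uncurry H)
  abs_le : ∀ σ ω, |H σ ω| ≤ K σ ω

/-- The partition function. -/
noncomputable def partFn {S Ω : Type*} [MeasurableSpace S] (lam : Measure S)
    (H : S → Ω → ℝ) (ω : Ω) : ℝ := ∫ σ, Real.exp (H σ ω) ∂lam

/-- The Gibbs density of `m` replicas. -/
noncomputable def wt {S Ω : Type*} [MeasurableSpace S] (lam : Measure S)
    (H : S → Ω → ℝ) (m : ℕ) (s : Fin m → S) (ω : Ω) : ℝ :=
  Real.exp (∑ l, H (s l) ω) / partFn lam H ω ^ m

/-- The averaged Gibbs expectation of a random function of `m` replicas. -/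
noncomputable def rep {S Ω : Type*} [MeasurableSpace S] [MeasurableSpace Ω] (lam : Measure S)
    (P : Measure Ω) (H : S → Ω → ℝ) (m : ℕ) (Φ : (Fin m → S) → Ω → ℝ) : ℝ :=
  ∫ ω, (∫ s, Φ s ω * Real.exp (∑ l, H (s l) ω) ∂(Measure.pi fun _ : Fin m => lam))
    / partFn lam H ω ^ m ∂P

/-- Random functions of `m` replicas whose Gibbs averages are integrable. -/
structure Adm {S Ω : Type*} [MeasurableSpace S] [MeasurableSpace Ω] (lam : Measure S)
    (P : Measure Ω) (K : S → Ω → ℝ) {m : ℕ} (Φ : (Fin m → S) → Ω → ℝ) : Prop where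
  meas : AEStronglyMeasurable (fun p : (Fin m → S) × Ω => Φ p.1 p.2)
    ((Measure.pi fun _ : Fin m => lam).prod P)
  bound : ∃ F : (Fin m → S) → ℝ, Integrable F (Measure.pi fun _ : Fin m => lam) ∧
    ∃ a b : ℕ, ∀ ω, expMass lam K ω ≠ ∞ → ∀ s, |Φ s ω| ≤ |F s| * bnd lam K a b s ω

/-! ### Gibbs averages: integrability, linearity, adding a replica -/

section Basic

variable {S Ω : Type*} [MeasurableSpace S] [MeasurableSpace Ω] {lam : Measure S}
  [IsProbabilityMeasure lam] {P : Measure Ω} [IsProbabilityMeasure P] {K H : S → Ω → ℝ}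

theorem bnd_mul {m : ℕ} (a b a' b' : ℕ) (s : Fin m → S) (ω : Ω) :
    bnd lam K a b s ω * bnd lam K a' b' s ω = bnd lam K (a + a') (b + b') s ω := by
  unfold bnd; ring

theorem Dom.measurable_left (hH : Dom K H) (ω : Ω) : Measurable fun σ => H σ ω :=
  hH.meas.comp measurable_prodMk_right

theorem Dom.measurable_sum (hH : Dom K H) (m : ℕ) :
    Measurable fun p : (Fin m → S) × Ω => ∑ l, H (p.1 l) p.2 :=
  Finset.measurable_sum _ fun l _ =>
    measurable_comp₂ hH.meas ((measurable_pi_apply l).comp measurable_fst) measurable_snd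

theorem Dom.measurable_partFn (hH : Dom K H) : Measurable (partFn lam H) :=
  (StronglyMeasurable.integral_prod_left (f := fun σ ω => Real.exp (H σ ω))
    hH.meas.exp.stronglyMeasurable).measurable

theorem Dom.measurable_wt (hH : Dom K H) (m : ℕ) :
    Measurable fun p : (Fin m → S) × Ω => wt lam H m p.1 p.2 :=
  (hH.measurable_sum m).exp.div ((hH.measurable_partFn.comp measurable_snd).pow_const m)

theorem ExpMoments.integrable_exp_two (hK : ExpMoments P K) {ω : Ω} (hω : expMass lam K ω ≠ ∞) :
    Integrable (fun σ => Real.exp (2 * K σ ω)) lam := by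
  refine ⟨((hK.measurable_left ω).const_mul 2).exp.aestronglyMeasurable, ?_⟩
  rw [hasFiniteIntegral_iff_ofReal (ae_of_all _ fun σ => (Real.exp_pos _).le)]
  exact lt_top_iff_ne_top.2 hω

theorem ExpMoments.integral_exp_two (hK : ExpMoments P K) (ω : Ω) :
    ∫ σ, Real.exp (2 * K σ ω) ∂lam = (expMass lam K ω).toReal := by
  rw [integral_eq_lintegral_of_nonneg_ae (ae_of_all _ fun σ => (Real.exp_pos _).le)
    ((hK.measurable_left ω).const_mul 2).exp.aestronglyMeasurable]
  rfl

theorem ExpMoments.integrable_of_le (hK : ExpMoments P K) {ω : Ω} (hω : expMass lam K ω ≠ ∞)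
    {g : S → ℝ} (mg : Measurable g) {c : ℝ} (hg : ∀ σ, |g σ| ≤ c * Real.exp (2 * K σ ω)) :
    Integrable g lam :=
  ((hK.integrable_exp_two hω).const_mul c).mono' mg.aestronglyMeasurable (ae_of_all _ hg)

theorem ExpMoments.abs_integral_le (hK : ExpMoments P K) {ω : Ω} (hω : expMass lam K ω ≠ ∞)
    {g : S → ℝ} {c : ℝ} (hg : ∀ σ, |g σ| ≤ c * Real.exp (2 * K σ ω)) :
    |∫ σ, g σ ∂lam| ≤ c * (expMass lam K ω).toReal := by
  rw [← hK.integral_exp_two ω, ← integral_const_mul]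
  exact norm_integral_le_of_norm_le (f := g) ((hK.integrable_exp_two hω).const_mul c) (ae_of_all _ fun σ => hg σ)

theorem exp_le_exp_two (hK : ExpMoments P K) (σ : S) (ω : Ω) :
    Real.exp (K σ ω) ≤ Real.exp (2 * K σ ω) :=
  Real.exp_le_exp.2 (by linarith [hK.nonneg σ ω])

theorem Dom.exp_le (hH : Dom K H) (σ : S) (ω : Ω) : Real.exp (H σ ω) ≤ Real.exp (K σ ω) :=
  Real.exp_le_exp.2 ((le_abs_self _).trans (hH.abs_le σ ω))

theorem Dom.integrable_exp (hH : Dom K H) (hK : ExpMoments P K) {ω : Ω}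
    (hω : expMass lam K ω ≠ ∞) : Integrable (fun σ => Real.exp (H σ ω)) lam :=
  hK.integrable_of_le hω (hH.measurable_left ω).exp (c := 1) fun σ => by
    rw [one_mul, abs_of_pos (Real.exp_pos _)]
    exact (hH.exp_le σ ω).trans (exp_le_exp_two hK σ ω)

theorem one_le_expMass (hK : ExpMoments P K) {ω : Ω} (hω : expMass lam K ω ≠ ∞) :
    1 ≤ (expMass lam K ω).toReal := by
  rw [← hK.integral_exp_two ω]
  calc (1 : ℝ) = ∫ _, (1 : ℝ) ∂lam := by simp
    _ ≤ _ := integral_mono (integrable_const _) (hK.integrable_exp_two hω) fun σ =>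
      Real.one_le_exp (by linarith [hK.nonneg σ ω])

theorem Dom.partFn_pos (hH : Dom K H) (hK : ExpMoments P K) {ω : Ω}
    (hω : expMass lam K ω ≠ ∞) : 0 < partFn lam H ω :=
  integral_exp_pos (hH.integrable_exp hK hω)

/-- Jensen for `y ↦ 1/y` in tangent-line form: with `y = exp(2K)` of mean `W`, one has `exp H ≥ 1/y
≥ (2 - y/W)/W`, and the last expression has mean `1/W`. The second inequality is the nonnegativity
of `(W - y)²`. -/
theorem Dom.inv_partFn_le (hH : Dom K H) (hK : ExpMoments P K) {ω : Ω}
    (hω : expMass lam K ω ≠ ∞) : (partFn lam H ω)⁻¹ ≤ (expMass lam K ω).toReal := by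
  set W := (expMass lam K ω).toReal with hW
  have hW1 : 1 ≤ W := one_le_expMass hK hω
  have hW0 : 0 < W := by linarith
  refine inv_le_of_inv_le₀ hW0 ?_
  calc W⁻¹ = ∫ σ, (2 - Real.exp (2 * K σ ω) / W) / W ∂lam := by
        rw [integral_div, integral_sub (integrable_const _)
          ((hK.integrable_exp_two hω).div_const _), integral_div, hK.integral_exp_two]
        rw [← hW, div_self hW0.ne']
        simp; norm_num
    _ ≤ _ := by
        refine integral_mono (((integrable_const _).sub
          ((hK.integrable_exp_two hω).div_const _)).div_const _) (hH.integrable_exp hK hω)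
          fun σ => ?_
        have h1 : Real.exp (-(2 * K σ ω)) ≤ Real.exp (H σ ω) :=
          Real.exp_le_exp.2 (by linarith [neg_le_of_abs_le (hH.abs_le σ ω), hK.nonneg σ ω])
        refine le_trans ?_ h1
        have hx := Real.exp_pos (2 * K σ ω)
        rw [Real.exp_neg, div_le_iff₀ hW0, ← sub_nonneg]
        have : (Real.exp (2 * K σ ω))⁻¹ * W - (2 - Real.exp (2 * K σ ω) / W)
            = (W - Real.exp (2 * K σ ω)) ^ 2 / (Real.exp (2 * K σ ω) * W) := by
          field_simp; ring
        rw [this]; positivity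

theorem exp_sum_le (hH : Dom K H) {m : ℕ} (s : Fin m → S) (ω : Ω) :
    Real.exp (∑ l, H (s l) ω) ≤ Real.exp (∑ l, K (s l) ω) :=
  Real.exp_le_exp.2 (Finset.sum_le_sum fun _ _ => (le_abs_self _).trans (hH.abs_le _ _))

theorem Dom.wt_nonneg (hH : Dom K H) (hK : ExpMoments P K) {ω : Ω} (hω : expMass lam K ω ≠ ∞)
    {m : ℕ} (s : Fin m → S) : 0 ≤ wt lam H m s ω := by
  have := hH.partFn_pos hK hω
  unfold wt; positivity

theorem Dom.wt_le (hH : Dom K H) (hK : ExpMoments P K) {ω : Ω} (hω : expMass lam K ω ≠ ∞)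
    {m : ℕ} (s : Fin m → S) : wt lam H m s ω ≤ bnd lam K 1 m s ω := by
  have := hH.partFn_pos hK hω
  unfold wt bnd
  rw [div_eq_mul_inv, pow_one, ← inv_pow]
  gcongr
  · exact (le_abs_self _).trans (hH.abs_le _ _)
  · exact hH.inv_partFn_le hK hω

theorem Dom.abs_wt_le (hH : Dom K H) (hK : ExpMoments P K) {ω : Ω} (hω : expMass lam K ω ≠ ∞)
    {m : ℕ} (s : Fin m → S) : |wt lam H m s ω| ≤ bnd lam K 1 m s ω := by
  rw [abs_of_nonneg (hH.wt_nonneg hK hω s)]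
  exact hH.wt_le hK hω s

theorem ae_prod_expMass_ne_top (hK : ExpMoments P K) (m : ℕ) :
    ∀ᵐ p ∂((Measure.pi fun _ : Fin m => lam).prod P), expMass lam K p.2 ≠ ∞ := by
  have := hK.ae_expMass_ne_top (lam := lam)
  exact Measure.quasiMeasurePreserving_snd.ae this

/-- The weight of `Φ` has exponents `(a, b)` and the Gibbs density costs `(1, m)`; weights multiply
by adding exponents. -/
theorem Adm.integrable {m : ℕ} {Φ : (Fin m → S) → Ω → ℝ} (hΦ : Adm lam P K Φ)
    (hH : Dom K H) (hK : ExpMoments P K) :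
    Integrable (fun p : (Fin m → S) × Ω => Φ p.1 p.2 * wt lam H m p.1 p.2)
      ((Measure.pi fun _ : Fin m => lam).prod P) := by
  obtain ⟨F, hF, a, b, hb⟩ := hΦ.bound
  refine ((hK.integrable_mul_bnd (lam := lam) (a + 1) (b + m) hF).norm).mono'
    (hΦ.meas.mul (hH.measurable_wt m).aestronglyMeasurable) ?_
  filter_upwards [ae_prod_expMass_ne_top hK m] with p hp
  rw [norm_mul, norm_mul, ← bnd_mul, norm_mul, ← mul_assoc,
    Real.norm_of_nonneg (bnd_nonneg a b p.1 p.2), Real.norm_of_nonneg (bnd_nonneg 1 m p.1 p.2)]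
  exact mul_le_mul (hb p.2 hp p.1) (hH.abs_wt_le hK hp p.1) (norm_nonneg _)
    (mul_nonneg (norm_nonneg _) (bnd_nonneg _ _ _ _))

theorem rep_eq_iterated {m : ℕ} (Φ : (Fin m → S) → Ω → ℝ) :
    rep lam P H m Φ = ∫ ω, ∫ s, Φ s ω * wt lam H m s ω ∂(Measure.pi fun _ : Fin m => lam) ∂P := by
  unfold rep wt
  simp only [← mul_div_assoc, integral_div]

theorem Adm.rep_eq_prod {m : ℕ} {Φ : (Fin m → S) → Ω → ℝ} (hΦ : Adm lam P K Φ)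
    (hH : Dom K H) (hK : ExpMoments P K) :
    rep lam P H m Φ = ∫ p, Φ p.1 p.2 * wt lam H m p.1 p.2
      ∂((Measure.pi fun _ : Fin m => lam).prod P) := by
  rw [rep_eq_iterated, integral_prod_symm _ (hΦ.integrable hH hK)]

theorem rep_add {m : ℕ} {Φ Φ' : (Fin m → S) → Ω → ℝ} (hΦ : Adm lam P K Φ)
    (hΦ' : Adm lam P K Φ') (hH : Dom K H) (hK : ExpMoments P K)
    (hs : Adm lam P K fun s ω => Φ s ω + Φ' s ω) :
    rep lam P H m (fun s ω => Φ s ω + Φ' s ω) = rep lam P H m Φ + rep lam P H m Φ' := by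
  rw [hs.rep_eq_prod hH hK, hΦ.rep_eq_prod hH hK, hΦ'.rep_eq_prod hH hK,
    ← integral_add (hΦ.integrable hH hK) (hΦ'.integrable hH hK)]
  simp only [add_mul]

theorem rep_const_mul {m : ℕ} (c : ℝ) (Φ : (Fin m → S) → Ω → ℝ) :
    rep lam P H m (fun s ω => c * Φ s ω) = c * rep lam P H m Φ := by
  simp only [rep_eq_iterated, mul_assoc, integral_const_mul]

theorem rep_congr_ae {m : ℕ} {Φ Φ' : (Fin m → S) → Ω → ℝ}
    (h : ∀ᵐ ω ∂P, ∀ s, Φ s ω = Φ' s ω) : rep lam P H m Φ = rep lam P H m Φ' := by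
  unfold rep
  refine integral_congr_ae ?_
  filter_upwards [h] with ω hω
  simp only [hω]

theorem Adm.of_integrable {m : ℕ} {F : (Fin m → S) → ℝ}
    (hF : Integrable F (Measure.pi fun _ : Fin m => lam)) : Adm lam P K (fun s _ => F s) :=
  ⟨hF.aestronglyMeasurable.comp_fst, F, hF, 0, 0, fun ω _ s => by simp [bnd]⟩

theorem rep_sum {m : ℕ} {ι : Type*} (I : Finset ι) {Φ : ι → (Fin m → S) → Ω → ℝ}
    (hΦ : ∀ i ∈ I, Adm lam P K (Φ i)) (hH : Dom K H) (hK : ExpMoments P K)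
    (hs : Adm lam P K fun s ω => ∑ i ∈ I, Φ i s ω) :
    rep lam P H m (fun s ω => ∑ i ∈ I, Φ i s ω) = ∑ i ∈ I, rep lam P H m (Φ i) := by
  rw [hs.rep_eq_prod hH hK]
  simp only [Finset.sum_mul]
  rw [integral_finsetSum _ fun i hi => (hΦ i hi).integrable hH hK]
  exact Finset.sum_congr rfl fun i hi => ((hΦ i hi).rep_eq_prod hH hK).symm

theorem measurePreserving_pi_succ (m : ℕ) :
    MeasurePreserving (fun s : Fin (m + 1) → S => (s (Fin.last m), fun j : Fin m => s j.castSucc))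
      (Measure.pi fun _ => lam) (lam.prod (Measure.pi fun _ => lam)) := by
  have := measurePreserving_piFinSuccAbove (fun _ : Fin (m + 1) => lam) (Fin.last m)
  convert! this using 1
  ext s : 1
  refine Prod.ext rfl ?_
  ext j
  exact congrArg s (Fin.succAbove_last_apply j).symm

theorem integral_pi_succ {m : ℕ} (Ψ : S × (Fin m → S) → ℝ) :
    ∫ s, Ψ (s (Fin.last m), fun j : Fin m => s j.castSucc) ∂(Measure.pi fun _ : Fin (m + 1) => lam)
      = ∫ q, Ψ q ∂(lam.prod (Measure.pi fun _ => lam)) := by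
  have := (measurePreserving_piFinSuccAbove (fun _ : Fin (m + 1) => lam)
    (Fin.last m)).integral_comp' (g := Ψ)
  rw [← this]
  congr 1; ext s
  congr 1
  refine Prod.ext rfl ?_
  ext j
  exact congrArg s (Fin.succAbove_last_apply j).symm

theorem integrable_pi_succ {m : ℕ} {Ψ : S × (Fin m → S) → ℝ} :
    Integrable (fun s : Fin (m + 1) → S => Ψ (s (Fin.last m), fun j : Fin m => s j.castSucc))
      (Measure.pi fun _ : Fin (m + 1) => lam) ↔
    Integrable Ψ (lam.prod (Measure.pi fun _ => lam)) := by
  have := (measurePreserving_piFinSuccAbove (fun _ : Fin (m + 1) => lam)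
    (Fin.last m)).integrable_comp_emb (MeasurableEquiv.measurableEmbedding _) (g := Ψ)
  rw [← this]
  refine iff_of_eq (congrArg (fun f => Integrable f _) ?_)
  ext s
  simp only [Function.comp]
  congr 1
  refine Prod.ext rfl ?_
  ext j
  exact congrArg s (Fin.succAbove_last_apply j).symm

theorem integrable_castSucc {m : ℕ} {F : (Fin m → S) → ℝ}
    (hF : Integrable F (Measure.pi fun _ : Fin m => lam)) :
    Integrable (fun s : Fin (m + 1) → S => F fun j => s j.castSucc)
      (Measure.pi fun _ : Fin (m + 1) => lam) :=
  integrable_pi_succ (Ψ := fun q => F q.2) |>.2 (hF.comp_snd lam)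

/-- Integrating out the last replica. -/
theorem rep_succ {m : ℕ} {Ψ : (Fin m → S) → S → Ω → ℝ}
    (hΨ : Adm lam P K fun (s : Fin (m + 1) → S) ω =>
      Ψ (fun j => s j.castSucc) (s (Fin.last m)) ω) (hH : Dom K H) (hK : ExpMoments P K) :
    rep lam P H (m + 1) (fun s ω => Ψ (fun j => s j.castSucc) (s (Fin.last m)) ω)
      = rep lam P H m (fun s ω =>
        (∫ σ, Ψ s σ ω * Real.exp (H σ ω) ∂lam) / partFn lam H ω) := by
  rw [rep_eq_iterated, rep_eq_iterated]
  refine integral_congr_ae ?_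
  filter_upwards [(hΨ.integrable hH hK).prod_left_ae, hK.ae_expMass_ne_top (lam := lam)] with ω h1 hω
  have hZ := (hH.partFn_pos hK hω).ne'
  let Ψ' : S × (Fin m → S) → ℝ := fun q =>
    Ψ q.2 q.1 ω * Real.exp (H q.1 ω) / partFn lam H ω * wt lam H m q.2 ω
  have e : ∀ s : Fin (m + 1) → S, Ψ (fun j => s j.castSucc) (s (Fin.last m)) ω *
      wt lam H (m + 1) s ω = Ψ' (s (Fin.last m), fun j : Fin m => s j.castSucc) := by
    intro s
    simp only [Ψ', wt, Fin.sum_univ_castSucc, Real.exp_add, pow_succ]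
    field_simp
  simp only [e] at h1 ⊢
  rw [integral_pi_succ Ψ', integral_prod_symm _ (integrable_pi_succ.1 h1)]
  simp only [Ψ', integral_mul_const, integral_div]

theorem Adm.castSucc {m : ℕ} {Φ : (Fin m → S) → Ω → ℝ} (hK : ExpMoments P K)
    (hΦ : Adm lam P K Φ) :
    Adm lam P K fun (s : Fin (m + 1) → S) ω => Φ (fun j => s j.castSucc) ω := by
  obtain ⟨F, hF, a, b, hb⟩ := hΦ.bound
  refine ⟨?_, _, integrable_castSucc hF, a, b, fun ω hω s => (hb ω hω _).trans ?_⟩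
  · have mp : Measure.QuasiMeasurePreserving
        (fun p : (Fin (m + 1) → S) × Ω => ((fun j : Fin m => p.1 j.castSucc), p.2))
        ((Measure.pi fun _ => lam).prod P) ((Measure.pi fun _ => lam).prod P) :=
      (((measurePreserving_snd (μ := lam) (ν := Measure.pi fun _ : Fin m => lam)).comp
        (measurePreserving_pi_succ (lam := lam) m)).prod
          (MeasurePreserving.id P)).quasiMeasurePreserving
    exact hΦ.meas.comp_quasiMeasurePreserving mp
  · gcongr
    unfold bnd
    gcongr
    rw [Fin.sum_univ_castSucc (n := m)]
    linarith [hK.nonneg (s (Fin.last m)) ω]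

/-- A replica that the function ignores integrates to `Z / Z = 1`. -/
theorem rep_castSucc {m : ℕ} {Φ : (Fin m → S) → Ω → ℝ} (hΦ : Adm lam P K Φ)
    (hH : Dom K H) (hK : ExpMoments P K) :
    rep lam P H (m + 1) (fun s ω => Φ (fun j => s j.castSucc) ω) = rep lam P H m Φ := by
  rw [rep_succ (Ψ := fun s _ ω => Φ s ω) (hΦ.castSucc hK) hH hK]
  refine rep_congr_ae ?_
  filter_upwards [hK.ae_expMass_ne_top (lam := lam)] with ω hω s
  rw [integral_const_mul]
  exact mul_div_cancel_right₀ _ (hH.partFn_pos hK hω).ne'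

theorem abs_exp_le_bnd (hK : ExpMoments P K) {m : ℕ} (l : Fin m) (s : Fin m → S) (ω : Ω) :
    Real.exp (K (s l) ω) ≤ bnd lam K 1 0 s ω := by
  simp only [bnd, pow_one, pow_zero, mul_one]
  exact Real.exp_le_exp.2 (Finset.single_le_sum (f := fun l => K (s l) ω)
    (fun l _ => hK.nonneg _ _) (Finset.mem_univ l))

theorem Adm.mul_field {m : ℕ} {F : (Fin m → S) → ℝ} {X : S → Ω → ℝ} (hK : ExpMoments P K)
    (hF : Integrable F (Measure.pi fun _ : Fin m => lam)) (mX : Measurable (Function.uncurry X))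
    {c : ℝ} (hX : ∀ σ ω, |X σ ω| ≤ c * Real.exp (K σ ω)) (l : Fin m) :
    Adm lam P K (fun s ω => F s * X (s l) ω) := by
  refine ⟨hF.aestronglyMeasurable.comp_fst.mul (measurable_comp₂ mX
    ((measurable_pi_apply l).comp measurable_fst) measurable_snd).aestronglyMeasurable,
    _, hF.mul_const c, 1, 0, fun ω _ s => ?_⟩
  rw [abs_mul, abs_mul, mul_assoc]
  gcongr
  refine (hX _ _).trans ?_
  exact mul_le_mul (le_abs_self c) (abs_exp_le_bnd hK l s ω) (Real.exp_pos _).le (abs_nonneg _)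

theorem Adm.succ_field {m : ℕ} {F : (Fin m → S) → ℝ} {W : (Fin m → S) → S → Ω → ℝ}
    (hK : ExpMoments P K) (hF : Integrable F (Measure.pi fun _ : Fin m => lam))
    (mW : Measurable fun q : ((Fin m → S) × S) × Ω => W q.1.1 q.1.2 q.2)
    {c : ℝ} (hW : ∀ s σ ω, |W s σ ω| ≤ c * Real.exp (K σ ω)) :
    Adm lam P K (fun (s : Fin (m + 1) → S) ω =>
      F (fun j => s j.castSucc) * W (fun j => s j.castSucc) (s (Fin.last m)) ω) := by
  refine ⟨(integrable_castSucc hF).aestronglyMeasurable.comp_fst.mul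
    (mW.comp (f := fun p : (Fin (m + 1) → S) × Ω =>
      (((fun j : Fin m => p.1 j.castSucc), p.1 (Fin.last m)), p.2))
      (by fun_prop)).aestronglyMeasurable,
    _, (integrable_castSucc hF).mul_const c, 1, 0, fun ω _ s => ?_⟩
  rw [abs_mul, abs_mul, mul_assoc]
  gcongr
  refine (hW _ _ _).trans ?_
  exact mul_le_mul (le_abs_self c) (abs_exp_le_bnd hK _ s ω) (Real.exp_pos _).le (abs_nonneg _)

/-- Exponents `(0, 2)` suffice: one power of the mass bounds the numerator, since `|W| exp H ≤ |c|
exp(2K)`, and one bounds `1/Z`. The factor `2` in `expMass` is there for this product. -/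
theorem Adm.integral_field {m : ℕ} {F : (Fin m → S) → ℝ} {W : (Fin m → S) → S → Ω → ℝ}
    (hK : ExpMoments P K) (hH : Dom K H) (hF : Integrable F (Measure.pi fun _ : Fin m => lam))
    (mW : Measurable fun q : ((Fin m → S) × S) × Ω => W q.1.1 q.1.2 q.2)
    {c : ℝ} (hW : ∀ s σ ω, |W s σ ω| ≤ c * Real.exp (K σ ω)) :
    Adm lam P K (fun (s : Fin m → S) ω =>
      (∫ σ, F s * W s σ ω * Real.exp (H σ ω) ∂lam) / partFn lam H ω) := by
  have mi : Measurable fun p : (Fin m → S) × Ω => ∫ σ, W p.1 σ p.2 * Real.exp (H σ p.2) ∂lam := by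
    refine (StronglyMeasurable.integral_prod_right
      (f := fun (p : (Fin m → S) × Ω) σ => W p.1 σ p.2 * Real.exp (H σ p.2)) ?_).measurable
    refine Measurable.stronglyMeasurable (Measurable.mul ?_ ?_)
    · exact mW.comp (f := fun q : ((Fin m → S) × Ω) × S => ((q.1.1, q.2), q.1.2)) (by fun_prop)
    · exact (measurable_comp₂ hH.meas measurable_snd (measurable_snd.comp measurable_fst)).exp
  simp only [mul_assoc, integral_const_mul]
  refine ⟨(hF.aestronglyMeasurable.comp_fst.mul mi.aestronglyMeasurable).mul
    (hH.measurable_partFn.comp measurable_snd).inv.aestronglyMeasurable,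
    _, hF.mul_const c, 0, 2, fun ω hω s => ?_⟩
  have hZ := hH.partFn_pos hK hω
  rw [abs_div, abs_mul, abs_mul, abs_of_pos hZ, div_eq_mul_inv]
  have h1 : |∫ σ, W s σ ω * Real.exp (H σ ω) ∂lam| ≤ |c| * (expMass lam K ω).toReal := by
    refine hK.abs_integral_le hω fun σ => ?_
    rw [abs_mul, abs_of_pos (Real.exp_pos _)]
    calc |W s σ ω| * Real.exp (H σ ω)
        ≤ (|c| * Real.exp (K σ ω)) * Real.exp (K σ ω) :=
          mul_le_mul ((hW s σ ω).trans (mul_le_mul_of_nonneg_right (le_abs_self c)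
            (Real.exp_pos _).le)) (hH.exp_le σ ω) (Real.exp_pos _).le (by positivity)
      _ = |c| * Real.exp (2 * K σ ω) := by
          rw [two_mul, Real.exp_add]; ring
  calc |F s| * |∫ σ, W s σ ω * Real.exp (H σ ω) ∂lam| * (partFn lam H ω)⁻¹
      ≤ |F s| * (|c| * (expMass lam K ω).toReal) * (expMass lam K ω).toReal := by
        gcongr
        exact hH.inv_partFn_le hK hω
    _ = _ := by simp only [bnd]; ring

/-- The last two replicas are exchangeable. -/
theorem rep_last_swap {m : ℕ} {F : (Fin m → S) → ℝ} {g : S → ℝ}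
    (hF : Integrable F (Measure.pi fun _ : Fin m => lam)) (mg : Measurable g) {c : ℝ}
    (hg : ∀ σ, |g σ| ≤ c) (hH : Dom K H) (hK : ExpMoments P K) :
    rep lam P H (m + 2) (fun s _ => F (fun j => s j.castSucc.castSucc) * g (s (Fin.last (m + 1))))
      = rep lam P H (m + 2) (fun s _ => F (fun j => s j.castSucc.castSucc)
        * g (s (Fin.last m).castSucc)) := by
  have hc : ∀ σ ω, |g σ| ≤ c * Real.exp (K σ ω) := fun σ ω =>
    (hg σ).trans (le_mul_of_one_le_right ((abs_nonneg _).trans (hg σ))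
      (Real.one_le_exp (hK.nonneg σ ω)))
  have mW : ∀ k, Measurable fun q : ((Fin k → S) × S) × Ω => g q.1.2 := fun k =>
    mg.comp (measurable_snd.comp measurable_fst)
  have a1 := Adm.succ_field (W := fun _ σ _ => g σ) hK hF (mW m) fun _ => hc
  have a2 := Adm.succ_field (W := fun _ σ _ => g σ) hK (integrable_castSucc hF) (mW (m + 1))
    fun _ => hc
  have a3 := Adm.integral_field (W := fun _ σ _ => g σ) hK hH hF (mW m) fun _ => hc
  -- Integrating out whichever of the two last replicas carries `g` reduces both sides to the same
  -- average of `F` times the one-replica Gibbs mean of `g`.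
  rw [rep_succ (Ψ := fun s σ _ => F (fun j => s j.castSucc) * g σ) a2 hH hK,
    rep_castSucc (Φ := fun s ω => (∫ σ, F s * g σ * Real.exp (H σ ω) ∂lam) / partFn lam H ω)
      a3 hH hK,
    rep_castSucc (Φ := fun (s : Fin (m + 1) → S) (_ : Ω) =>
      F (fun j => s j.castSucc) * g (s (Fin.last m))) a1 hH hK,
    rep_succ (Ψ := fun s σ _ => F s * g σ) a1 hH hK]

end Basic

/-! ### Gaussian integration by parts for Gibbs densities -/

section

open Filter Topology

/-- The dominated convergence used for both limits, sample size to infinity and then `δ → 0`; only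
the factor `r j` varies. -/
theorem tendsto_integral_mul {Ω : Type*} [MeasurableSpace Ω] {P : Measure Ω} {N D R : Ω → ℝ}
    {r : ℕ → Ω → ℝ} (mN : Measurable N) (mr : ∀ j, Measurable (r j))
    (hD : Integrable (fun ω => N ω * D ω) P) (hb : ∀ᵐ ω ∂P, ∀ j, |r j ω| ≤ D ω)
    (hr : ∀ᵐ ω ∂P, Tendsto (fun j => r j ω) atTop (𝓝 (R ω))) :
    Tendsto (fun j => ∫ ω, N ω * r j ω ∂P) atTop (𝓝 (∫ ω, N ω * R ω ∂P)) := by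
  refine tendsto_integral_of_dominated_convergence (fun ω => ‖N ω * D ω‖)
    (fun j => (mN.mul (mr j)).aestronglyMeasurable) hD.norm (fun j => ?_) ?_
  · filter_upwards [hb] with ω hω
    rw [norm_mul, norm_mul]
    exact mul_le_mul_of_nonneg_left ((hω j).trans (le_abs_self _)) (norm_nonneg _)
  · filter_upwards [hr] with ω hω
    exact hω.const_mul _

/-- One power of the denominator is absorbed by `|B| ≤ C A`, so only `p` inverse powers need the
bound `D`. -/
theorem abs_div_pow_succ_le {A B C δ D : ℝ} {p : ℕ} (hδ : 0 ≤ δ) (hAδ : 0 < A + δ)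
    (hC : 0 ≤ C) (hB : |B| ≤ C * A) (hD : (A + δ)⁻¹ ≤ D) :
    |B / (A + δ) ^ (p + 1)| ≤ C * D ^ p := by
  rw [abs_div, abs_of_pos (pow_pos hAδ _), pow_succ', ← div_div]
  have h1 : |B| / (A + δ) ≤ C := by
    rw [div_le_iff₀ hAδ]
    exact hB.trans (mul_le_mul_of_nonneg_left (by linarith) hC)
  rw [div_eq_mul_inv, ← inv_pow]
  gcongr

section IBP

variable {S Ω : Type*} [MeasurableSpace S] [MeasurableSpace Ω] {lam : Measure S}
  [IsProbabilityMeasure lam] {P : Measure Ω} [IsProbabilityMeasure P] {K : S → Ω → ℝ}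
  {X : Ω → ℝ} {G : S → Ω → ℝ}

/-- Treating `s₀` as one more replica lets the weight absorb the factor `|X| ≤ c₀ exp (K s₀)`. -/
theorem bnd_cons {n : ℕ} (a b : ℕ) (s₀ : S) (s : Fin n → S) (ω : Ω) :
    bnd lam K a b (Fin.cons s₀ s : Fin (n + 1) → S) ω
      = Real.exp (K s₀ ω) ^ a * bnd lam K a b s ω := by
  simp only [bnd, Fin.sum_univ_succ, Fin.cons_zero, Fin.cons_succ, Real.exp_add, mul_pow]
  ring

/-- Gaussian integration by parts for the Gibbs density of `n` replicas. -/
theorem gaussian_ibp (hK : ExpMoments P K)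
    (hG : IsGaussianProcess (Sum.elim (fun _ : Unit => X) G) P)
    (mX : Measurable X) (mG : ∀ σ, Measurable (G σ)) (X0 : ∫ ω, X ω ∂P = 0)
    {c : S → ℝ} (hc : ∀ σ, ∫ ω, X ω * G σ ω ∂P = c σ) (mc : Measurable c) {C : ℝ}
    (hC : ∀ σ, |c σ| ≤ C) {m : S → ℝ} {H : S → Ω → ℝ} (hHG : ∀ σ ω, H σ ω = G σ ω + m σ)
    (hH : Dom K H) {c₀ : ℝ} {s₀ : S}
    (hX : ∀ ω, |X ω| ≤ c₀ * Real.exp (K s₀ ω)) {n : ℕ} (p : ℕ) (s : Fin n → S) :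
    ∫ ω, X ω * (Real.exp (∑ l, H (s l) ω) / partFn lam H ω ^ p) ∂P
      = (∑ l, c (s l)) * ∫ ω, Real.exp (∑ l, H (s l) ω) / partFn lam H ω ^ p ∂P
       - p * ∫ ω, Real.exp (∑ l, H (s l) ω) *
          (∫ σ, c σ * Real.exp (H σ ω) ∂lam) / partFn lam H ω ^ (p + 1) ∂P := by
  have hS : Nonempty S := ⟨s₀⟩
  have hC0 : 0 ≤ C := (abs_nonneg _).trans (hC s₀)
  have hgood := hK.ae_expMass_ne_top (lam := lam)
  set E : Ω → ℝ := fun ω => Real.exp (∑ l, H (s l) ω) with hE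
  set Z : Ω → ℝ := partFn lam H with hZdef
  set B : Ω → ℝ := fun ω => ∫ σ, c σ * Real.exp (H σ ω) ∂lam with hB
  have mHσ : ∀ σ, Measurable (H σ) := fun σ => hH.meas.comp measurable_prodMk_left
  have mE : Measurable E := (Finset.measurable_sum _ fun l _ => mHσ (s l)).exp
  have mZ : Measurable Z := hH.measurable_partFn
  have mcH : Measurable (Function.uncurry fun σ ω => c σ * Real.exp (H σ ω)) :=
    (mc.comp measurable_fst).mul hH.meas.exp
  have mB : Measurable B :=
    (StronglyMeasurable.integral_prod_left (f := fun σ ω => c σ * Real.exp (H σ ω))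
      mcH.stronglyMeasurable).measurable
  have iE : ∀ b : ℕ, Integrable (fun ω => E ω * (expMass lam K ω).toReal ^ b) P := fun b => by
    refine (hK.integrable_bnd (lam := lam) 1 b s).mono'
      (mE.mul (hK.measurable_expMass.ennreal_toReal.pow_const _)).aestronglyMeasurable
      (ae_of_all _ fun ω => ?_)
    rw [Real.norm_of_nonneg (by positivity)]
    simp only [bnd, pow_one]
    gcongr
    exact exp_sum_le hH s ω
  have iX : ∀ b : ℕ, Integrable (fun ω => X ω * E ω * (expMass lam K ω).toReal ^ b) P := fun b => by
    refine ((hK.integrable_bnd (lam := lam) 1 b (Fin.cons s₀ s : Fin (n + 1) → S)).const_mul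
      c₀).mono'
      ((mX.mul mE).mul (hK.measurable_expMass.ennreal_toReal.pow_const _)).aestronglyMeasurable
      (ae_of_all _ fun ω => ?_)
    have hle : E ω * (expMass lam K ω).toReal ^ b ≤ bnd lam K 1 b s ω := by
      simp only [bnd, pow_one]
      exact mul_le_mul_of_nonneg_right (exp_sum_le hH s ω) (by positivity)
    calc ‖X ω * E ω * (expMass lam K ω).toReal ^ b‖
        = |X ω| * (E ω * (expMass lam K ω).toReal ^ b) := by
          rw [mul_assoc, norm_mul, Real.norm_of_nonneg (r := E ω * _) (by positivity)]; rfl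
      _ ≤ (c₀ * Real.exp (K s₀ ω)) * bnd lam K 1 b s ω :=
          mul_le_mul (hX ω) hle (by positivity) ((abs_nonneg _).trans (hX ω))
      _ = _ := by rw [bnd_cons]; ring
  have iE0 : Integrable E P := by simpa using iE 0
  have iX0 : Integrable (fun ω => X ω * E ω) P := by simpa using iX 0
  have icH : ∀ᵐ ω ∂P, Integrable (fun σ => c σ * Real.exp (H σ ω)) lam := by
    filter_upwards [hgood] with ω hω
    exact (hH.integrable_exp hK hω).bdd_mul (c := C) mc.aestronglyMeasurable (ae_of_all _ hC)
  -- One fixed sample that works, for almost every `ω`, both for the partition function and for its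
  -- `c`-weighted version.
  obtain ⟨τ, hτ1, hτ2⟩ := ((ae_tendsto_avg lam P (g := fun σ ω => Real.exp (H σ ω)) hH.meas.exp
      (hgood.mono fun ω hω => hH.integrable_exp hK hω)).and
    (ae_tendsto_avg lam P mcH icH)).exists
  have mA : ∀ k, Measurable fun ω => avg k fun j => Real.exp (H (τ j) ω) := fun k => by
    unfold avg
    exact (Finset.measurable_sum _ fun j _ => (mHσ (τ j)).exp).div_const _
  have mA' : ∀ k, Measurable fun ω => avg k fun j => c (τ j) * Real.exp (H (τ j) ω) := fun k => by
    unfold avg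
    exact (Finset.measurable_sum _ fun j _ => (mHσ (τ j)).exp.const_mul _).div_const _
  have A0 : ∀ k ω, 0 ≤ avg k fun j => Real.exp (H (τ j) ω) := fun k ω =>
    avg_nonneg fun j => (Real.exp_pos _).le
  -- the regularised identity
  have key : ∀ δ : ℝ, 0 < δ → ∫ ω, X ω * E ω * ((Z ω + δ) ^ p)⁻¹ ∂P
      = (∑ l, c (s l)) * ∫ ω, E ω * ((Z ω + δ) ^ p)⁻¹ ∂P
        - p * ∫ ω, E ω * (B ω / (Z ω + δ) ^ (p + 1)) ∂P := by
    intro δ hδ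
    have cyl : ∀ k : ℕ, ∫ ω, X ω * E ω * (((avg k fun j => Real.exp (H (τ j) ω)) + δ) ^ p)⁻¹ ∂P
      = (∑ l, c (s l)) * ∫ ω, E ω * (((avg k fun j => Real.exp (H (τ j) ω)) + δ) ^ p)⁻¹ ∂P
        - p * ∫ ω, E ω * ((avg k fun j => c (τ j) * Real.exp (H (τ j) ω)) /
          ((avg k fun j => Real.exp (H (τ j) ω)) + δ) ^ (p + 1)) ∂P := by
      intro k
      have h := gaussian_ibp_cylinder hG mX mG X0 hc hC m (p := p) (K := k) hδ s τ
        (by simpa only [hE, hHG] using iE0) (by simpa only [hE, hHG] using iX0)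
      simp only [← hHG, mul_div_assoc] at h
      simpa only [div_eq_mul_inv, mul_assoc] using h
    have lim1 : ∀ N : Ω → ℝ, Measurable N → Integrable N P → Tendsto (fun k : ℕ =>
        ∫ ω, N ω * (((avg k fun j => Real.exp (H (τ j) ω)) + δ) ^ p)⁻¹ ∂P) atTop
        (𝓝 (∫ ω, N ω * ((Z ω + δ) ^ p)⁻¹ ∂P)) := by
      intro N mN iN
      refine tendsto_integral_mul (D := fun _ => (δ ^ p)⁻¹) mN
        (fun k => (((mA k).add_const δ).pow_const p).inv) (iN.mul_const _)
        (ae_of_all _ fun ω k => ?_) ?_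
      · have := A0 k ω
        rw [abs_of_nonneg (by positivity)]
        gcongr
        linarith
      · filter_upwards [hτ1, hgood] with ω h1 hω
        have := hH.partFn_pos hK hω
        exact ((h1.add_const δ).pow p).inv₀ (by positivity)
    have lim2 : Tendsto (fun k : ℕ =>
        ∫ ω, E ω * ((avg k fun j => c (τ j) * Real.exp (H (τ j) ω)) /
          ((avg k fun j => Real.exp (H (τ j) ω)) + δ) ^ (p + 1)) ∂P) atTop
        (𝓝 (∫ ω, E ω * (B ω / (Z ω + δ) ^ (p + 1)) ∂P)) := by
      refine tendsto_integral_mul (D := fun _ => C * δ⁻¹ ^ p) mE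
        (fun k => (mA' k).div (((mA k).add_const δ).pow_const _)) (iE0.mul_const _)
        (ae_of_all _ fun ω k => ?_) ?_
      · have := A0 k ω
        refine abs_div_pow_succ_le hδ.le (by positivity) hC0
          (abs_avg_mul_le (fun j => hC _) fun j => (Real.exp_pos _).le) ?_
        gcongr
        linarith
      · filter_upwards [hτ1, hτ2, hgood] with ω h1 h2 hω
        have := hH.partFn_pos hK hω
        exact h2.div ((h1.add_const δ).pow _) (by positivity)
    refine tendsto_nhds_unique (lim1 _ (mX.mul mE) iX0) ?_
    simp only [cyl]
    exact ((lim1 _ mE iE0).const_mul _).sub (lim2.const_mul _)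
  -- removing the regularisation
  have d0 : Tendsto (fun j : ℕ => 1 / ((j : ℝ) + 1)) atTop (𝓝 0) :=
    tendsto_one_div_add_atTop_nhds_zero_nat
  have dpos : ∀ j : ℕ, 0 < 1 / ((j : ℝ) + 1) := fun j => by positivity
  -- A bound uniform in `δ`: with the regularisation removed, the denominators are controlled by
  -- `expMass` instead of `1/δ`.
  have hinv : ∀ ω, expMass lam K ω ≠ ∞ → ∀ j : ℕ,
      (Z ω + 1 / ((j : ℝ) + 1))⁻¹ ≤ (expMass lam K ω).toReal := fun ω hω j => by
    have := hH.partFn_pos hK hω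
    refine le_trans ?_ (hH.inv_partFn_le hK hω)
    have := dpos j
    gcongr
    linarith
  have lim1 : ∀ N : Ω → ℝ, Measurable N →
      Integrable (fun ω => N ω * (expMass lam K ω).toReal ^ p) P → Tendsto (fun j : ℕ =>
        ∫ ω, N ω * ((Z ω + 1 / ((j : ℝ) + 1)) ^ p)⁻¹ ∂P) atTop
        (𝓝 (∫ ω, N ω * (Z ω ^ p)⁻¹ ∂P)) := by
    intro N mN iN
    refine tendsto_integral_mul mN (fun k => ((mZ.add_const _).pow_const p).inv) iN ?_ ?_
    · filter_upwards [hgood] with ω hω j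
      have h1 := hH.partFn_pos hK hω
      have h2 := dpos j
      rw [← inv_pow, abs_of_nonneg (by positivity)]
      exact pow_le_pow_left₀ (by positivity) (hinv ω hω j) _
    · filter_upwards [hgood] with ω hω
      have h1 := hH.partFn_pos hK hω
      have : Tendsto (fun j : ℕ => Z ω + 1 / ((j : ℝ) + 1)) atTop (𝓝 (Z ω)) := by
        simpa using d0.const_add (Z ω)
      exact (this.pow p).inv₀ (by positivity)
  have lim2 : Tendsto (fun j : ℕ =>
      ∫ ω, E ω * (B ω / (Z ω + 1 / ((j : ℝ) + 1)) ^ (p + 1)) ∂P) atTop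
      (𝓝 (∫ ω, E ω * (B ω / Z ω ^ (p + 1)) ∂P)) := by
    refine tendsto_integral_mul (D := fun ω => C * (expMass lam K ω).toReal ^ p) mE
      (fun k => mB.div ((mZ.add_const _).pow_const _)) ?_ ?_ ?_
    · refine ((iE p).const_mul C).congr (ae_of_all _ fun ω => ?_)
      simp only []; ring
    · filter_upwards [hgood] with ω hω j
      have h1 := hH.partFn_pos hK hω
      have h2 := dpos j
      refine abs_div_pow_succ_le h2.le (by positivity) hC0 ?_ (hinv ω hω j)
      rw [hZdef, partFn, ← integral_const_mul]
      refine norm_integral_le_of_norm_le (f := fun σ => c σ * Real.exp (H σ ω))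
        ((hH.integrable_exp hK hω).const_mul C) (ae_of_all _ fun σ => ?_)
      rw [norm_mul, Real.norm_of_nonneg (Real.exp_pos _).le]
      exact mul_le_mul_of_nonneg_right (hC σ) (Real.exp_pos _).le
    · filter_upwards [hgood] with ω hω
      have h1 := hH.partFn_pos hK hω
      have : Tendsto (fun j : ℕ => Z ω + 1 / ((j : ℝ) + 1)) atTop (𝓝 (Z ω)) := by
        simpa using d0.const_add (Z ω)
      exact tendsto_const_nhds.div (this.pow _) (by positivity)
  have lim3 := ((lim1 _ mE (iE p)).const_mul (∑ l, c (s l))).sub (lim2.const_mul (p : ℝ))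
  simp only [← key _ (dpos _)] at lim3
  have := tendsto_nhds_unique (lim1 _ (mX.mul mE) (iX p)) lim3
  simpa only [hE, hB, Pi.mul_apply, div_eq_mul_inv, mul_assoc] using this

/-- Gaussian integration by parts for replica averages. -/
theorem rep_ibp {X : S → Ω → ℝ} (hK : ExpMoments P K)
    (hG : ∀ s₀, IsGaussianProcess (Sum.elim (fun _ : Unit => X s₀) G) P)
    (mX : Measurable (Function.uncurry X)) (mG : ∀ σ, Measurable (G σ))
    (X0 : ∀ s₀, ∫ ω, X s₀ ω ∂P = 0) {U : S → S → ℝ}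
    (hU : ∀ s₀ σ, ∫ ω, X s₀ ω * G σ ω ∂P = U s₀ σ) (mU : Measurable (Function.uncurry U)) {C : ℝ}
    (hC : ∀ s₀ σ, |U s₀ σ| ≤ C) {d : S → ℝ} {H : S → Ω → ℝ} (hHG : ∀ σ ω, H σ ω = G σ ω + d σ)
    (hH : Dom K H) {c₀ : ℝ} (hX : ∀ σ ω, |X σ ω| ≤ c₀ * Real.exp (K σ ω)) {m : ℕ}
    {F : (Fin m → S) → ℝ} (hF : Integrable F (Measure.pi fun _ : Fin m => lam)) (l : Fin m) :
    rep lam P H m (fun s ω => F s * X (s l) ω)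
      = rep lam P H m (fun s _ => F s * ∑ l', U (s l) (s l'))
        - m * rep lam P H (m + 1) (fun s _ =>
          F (fun j => s j.castSucc) * U (s l.castSucc) (s (Fin.last m))) := by
  have hUe : ∀ σ σ' ω, |U σ σ'| ≤ C * Real.exp (K σ' ω) := fun σ σ' ω =>
    (hC σ σ').trans (le_mul_of_one_le_right ((abs_nonneg _).trans (hC σ σ'))
      (Real.one_le_exp (hK.nonneg σ' ω)))
  have mUl : Measurable fun q : ((Fin m → S) × S) × Ω => U (q.1.1 l) q.1.2 :=
    measurable_comp₂ mU ((measurable_pi_apply l).comp (measurable_fst.comp measurable_fst))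
      (measurable_snd.comp measurable_fst)
  have a1 := Adm.mul_field hK hF mX hX l
  have a2 : Adm lam P K fun (s : Fin m → S) (_ : Ω) => F s * ∑ l', U (s l) (s l') := by
    refine Adm.of_integrable (hF.mul_bdd (c := ∑ _ : Fin m, C) ?_ (ae_of_all _ fun s => ?_))
    · exact (Finset.measurable_sum _ fun l' _ => measurable_comp₂ mU
        (measurable_pi_apply l) (measurable_pi_apply l')).aestronglyMeasurable
    · exact (Finset.abs_sum_le_sum_abs _ _).trans (Finset.sum_le_sum fun l' _ => hC _ _)
  have a3 := Adm.succ_field (W := fun s σ (_ : Ω) => U (s l) σ) hK hF mUl fun s σ ω => hUe (s l) σ ω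
  have a4 := Adm.integral_field (W := fun s σ (_ : Ω) => U (s l) σ) hK hH hF mUl
    fun s σ ω => hUe (s l) σ ω
  rw [rep_succ (Ψ := fun s σ _ => F s * U (s l) σ) a3 hH hK, a1.rep_eq_prod hH hK,
    a2.rep_eq_prod hH hK, a4.rep_eq_prod hH hK, integral_prod _ (a1.integrable hH hK),
    integral_prod _ (a2.integrable hH hK), integral_prod _ (a4.integrable hH hK),
    ← integral_const_mul, ← integral_sub (a2.integrable hH hK).integral_prod_left
      ((a4.integrable hH hK).integral_prod_left.const_mul _)]
  -- For fixed replicas `s` this is `gaussian_ibp` with `X (s l)` and `p = m`; the remaining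
  -- quotient of integrals is the Gibbs mean over an extra replica, which `rep_succ` has already
  -- made explicit.
  refine integral_congr_ae (ae_of_all _ fun s => ?_)
  have h := gaussian_ibp (lam := lam) hK (hG (s l)) (mX.comp measurable_prodMk_left) mG (X0 (s l))
    (hU (s l)) (mU.comp measurable_prodMk_left) (hC (s l)) hHG hH (hX (s l)) m s
  simp only [mul_assoc, integral_const_mul, mul_div_assoc]
  simp only [wt]
  rw [h, mul_sub]
  congr 1
  rw [mul_left_comm]
  congr 2
  refine integral_congr_ae (ae_of_all _ fun ω => ?_)
  simp only [pow_succ, ← div_div]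
  ring

end IBP

end

/-! ### Differentiating Gibbs averages in a parameter -/

section

open Filter Topology

section Derivative

variable {S Ω : Type*} [MeasurableSpace S] [MeasurableSpace Ω] {lam : Measure S}
  [IsProbabilityMeasure lam] {P : Measure Ω} [IsProbabilityMeasure P] {K : S → Ω → ℝ}
  {H H' : ℝ → S → Ω → ℝ} {I : Set ℝ}

theorem abs_mul_exp_le {H : S → Ω → ℝ} (hH : Dom K H) {X : S → Ω → ℝ}
    {c : ℝ} (hX : ∀ σ ω, |X σ ω| ≤ c * Real.exp (K σ ω)) (σ : S) (ω : Ω) :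
    |X σ ω * Real.exp (H σ ω)| ≤ |c| * Real.exp (2 * K σ ω) := by
  rw [abs_mul, abs_of_pos (Real.exp_pos _), two_mul, Real.exp_add, ← mul_assoc]
  exact mul_le_mul ((hX σ ω).trans (mul_le_mul_of_nonneg_right (le_abs_self c)
    (Real.exp_pos _).le)) (hH.exp_le σ ω) (Real.exp_pos _).le (by positivity)

theorem hasDerivAt_partFn (hK : ExpMoments P K) (hI : IsOpen I) (hH : ∀ t ∈ I, Dom K (H t))
    (mH' : ∀ t ∈ I, Measurable (Function.uncurry (H' t))) {c : ℝ}
    (hb : ∀ t ∈ I, ∀ σ ω, |H' t σ ω| ≤ c * Real.exp (K σ ω))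
    (hd : ∀ t ∈ I, ∀ σ ω, HasDerivAt (fun t => H t σ ω) (H' t σ ω) t) {ω : Ω}
    (hω : expMass lam K ω ≠ ∞) {t : ℝ} (ht : t ∈ I) :
    HasDerivAt (fun t => partFn lam (H t) ω)
      (∫ σ, H' t σ ω * Real.exp (H t σ ω) ∂lam) t := by
  refine (hasDerivAt_integral_of_dominated_loc_of_deriv_le (hI.mem_nhds ht)
    (F' := fun t σ => H' t σ ω * Real.exp (H t σ ω))
    (bound := fun σ => |c| * Real.exp (2 * K σ ω)) ?_ ((hH t ht).integrable_exp hK hω) ?_ ?_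
    ((hK.integrable_exp_two hω).const_mul _) ?_).2
  · filter_upwards [hI.mem_nhds ht] with u hu
    exact ((hH u hu).measurable_left ω).exp.aestronglyMeasurable
  · exact (((mH' t ht).comp measurable_prodMk_right).mul
      ((hH t ht).measurable_left ω).exp).aestronglyMeasurable
  · exact ae_of_all _ fun σ u hu => abs_mul_exp_le (hH u hu) (hb u hu) σ ω
  · refine ae_of_all _ fun σ u hu => ?_
    rw [mul_comm]
    exact (hd u hu σ ω).exp

theorem hasDerivAt_wt (hK : ExpMoments P K) (hI : IsOpen I) (hH : ∀ t ∈ I, Dom K (H t))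
    (mH' : ∀ t ∈ I, Measurable (Function.uncurry (H' t))) {c : ℝ}
    (hb : ∀ t ∈ I, ∀ σ ω, |H' t σ ω| ≤ c * Real.exp (K σ ω))
    (hd : ∀ t ∈ I, ∀ σ ω, HasDerivAt (fun t => H t σ ω) (H' t σ ω) t) {ω : Ω}
    (hω : expMass lam K ω ≠ ∞) {t : ℝ} (ht : t ∈ I) {m : ℕ} (s : Fin m → S) :
    HasDerivAt (fun t => wt lam (H t) m s ω)
      ((∑ l, H' t (s l) ω - m * ((∫ σ, H' t σ ω * Real.exp (H t σ ω) ∂lam) /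
        partFn lam (H t) ω)) * wt lam (H t) m s ω) t := by
  have hZ := (hH t ht).partFn_pos hK hω
  have h1 := (HasDerivAt.fun_sum (u := Finset.univ) fun l _ => hd t ht (s l) ω).exp
  have h2 := (hasDerivAt_partFn (lam := lam) hK hI hH mH' hb hd hω ht).fun_pow m
  have := h1.fun_div h2 (pow_ne_zero _ hZ.ne')
  unfold wt
  convert! this using 1
  generalize Real.exp (∑ l, H t (s l) ω) = E
  generalize ∫ σ, H' t σ ω * Real.exp (H t σ ω) ∂lam = D
  rcases m with _ | m
  · simp
  · simp only [Nat.add_sub_cancel]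
    field_simp
    ring

/-- The derivative of a replica average with respect to a parameter of the Hamiltonian. -/
theorem hasDerivAt_rep (hK : ExpMoments P K) (hI : IsOpen I) (hH : ∀ t ∈ I, Dom K (H t))
    (mH' : ∀ t ∈ I, Measurable (Function.uncurry (H' t))) {c : ℝ}
    (hb : ∀ t ∈ I, ∀ σ ω, |H' t σ ω| ≤ c * Real.exp (K σ ω))
    (hd : ∀ t ∈ I, ∀ σ ω, HasDerivAt (fun t => H t σ ω) (H' t σ ω) t) {t : ℝ} (ht : t ∈ I)
    {m : ℕ} {F : (Fin m → S) → ℝ} (hF : Integrable F (Measure.pi fun _ : Fin m => lam)) :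
    HasDerivAt (fun t => rep lam P (H t) m fun s _ => F s)
      (∑ l, rep lam P (H t) m (fun s ω => F s * H' t (s l) ω)
        - m * rep lam P (H t) (m + 1)
          (fun s ω => F (fun j => s j.castSucc) * H' t (s (Fin.last m)) ω)) t := by
  have aF : Adm lam P K fun (s : Fin m → S) (_ : Ω) => F s := Adm.of_integrable hF
  have a1 := fun l => Adm.mul_field hK hF (mH' t ht) (hb t ht) l
  have mW : Measurable fun q : ((Fin m → S) × S) × Ω => H' t q.1.2 q.2 :=
    measurable_comp₂ (mH' t ht) (measurable_snd.comp measurable_fst) measurable_snd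
  have a2 := Adm.succ_field (W := fun _ σ ω => H' t σ ω) hK hF mW fun _ => hb t ht
  have a3 := Adm.integral_field (W := fun _ σ ω => H' t σ ω) hK (hH t ht) hF mW fun _ => hb t ht
  have hgood := ae_prod_expMass_ne_top (lam := lam) hK m
  have main := hasDerivAt_integral_of_dominated_loc_of_deriv_le (hI.mem_nhds ht)
    (μ := (Measure.pi fun _ : Fin m => lam).prod P)
    (F := fun t p => F p.1 * wt lam (H t) m p.1 p.2)
    (F' := fun t p => F p.1 * ((∑ l, H' t (p.1 l) p.2
      - m * ((∫ σ, H' t σ p.2 * Real.exp (H t σ p.2) ∂lam) / partFn lam (H t) p.2))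
        * wt lam (H t) m p.1 p.2))
    -- The sum over replicas has weight `(1, 0)` and the Gibbs mean of `H'` has weight `(0, 2)`;
    -- multiplying by the density weight `(1, m)` gives the two terms.
    (bound := fun p => m * |c| * (‖F p.1 * bnd lam K 2 m p.1 p.2‖
      + ‖F p.1 * bnd lam K 1 (m + 2) p.1 p.2‖)) ?_ (aF.integrable (hH t ht) hK) ?_ ?_
    (((hK.integrable_mul_bnd _ _ hF).norm.add (hK.integrable_mul_bnd _ _ hF).norm).const_mul _) ?_
  · have e : (fun t => rep lam P (H t) m fun s _ => F s) =ᶠ[𝓝 t]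
        fun t => ∫ p, F p.1 * wt lam (H t) m p.1 p.2 ∂((Measure.pi fun _ : Fin m => lam).prod P) := by
      filter_upwards [hI.mem_nhds ht] with u hu
      exact aF.rep_eq_prod (hH u hu) hK
    refine (main.2.congr_of_eventuallyEq e).congr_deriv ?_
    rw [rep_succ (Ψ := fun s σ ω => F (fun j => s j) * H' t σ ω) a2 (hH t ht) hK,
      a3.rep_eq_prod (hH t ht) hK,
      Finset.sum_congr rfl fun l _ => (a1 l).rep_eq_prod (hH t ht) hK,
      ← integral_finsetSum _ fun l _ => (a1 l).integrable (hH t ht) hK,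
      ← integral_const_mul, ← integral_sub
        (integrable_finsetSum _ fun l _ => (a1 l).integrable (hH t ht) hK)
        ((a3.integrable (hH t ht) hK).const_mul _)]
    refine integral_congr_ae (ae_of_all _ fun p => ?_)
    simp only [mul_assoc, integral_const_mul, mul_div_assoc]
    rw [sub_mul, mul_sub, Finset.sum_mul, Finset.mul_sum]
    ring
  · filter_upwards [hI.mem_nhds ht] with u hu
    exact aF.meas.mul ((hH u hu).measurable_wt m).aestronglyMeasurable
  · refine aF.meas.mul (Measurable.aestronglyMeasurable ?_)
    refine Measurable.mul ?_ ((hH t ht).measurable_wt m)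
    refine (Finset.measurable_sum _ fun l _ => measurable_comp₂ (mH' t ht)
      ((measurable_pi_apply l).comp measurable_fst) measurable_snd).sub (Measurable.const_mul ?_ _)
    refine Measurable.div ?_ ((hH t ht).measurable_partFn.comp measurable_snd)
    exact (StronglyMeasurable.integral_prod_left (f := fun σ ω => H' t σ ω * Real.exp (H t σ ω))
      ((mH' t ht).mul (hH t ht).meas.exp).stronglyMeasurable).measurable.comp measurable_snd
  · filter_upwards [hgood] with p hp u hu
    have hZ := (hH u hu).partFn_pos hK hp
    have h1 : |∑ l, H' u (p.1 l) p.2| ≤ m * |c| * bnd lam K 1 0 p.1 p.2 := by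
      refine (Finset.abs_sum_le_sum_abs _ _).trans ?_
      refine (Finset.sum_le_sum fun l _ => (hb u hu (p.1 l) p.2).trans
        (mul_le_mul (le_abs_self c) (abs_exp_le_bnd (lam := lam) hK l p.1 p.2) (Real.exp_pos _).le
          (abs_nonneg _))).trans ?_
      simp [mul_assoc]
    have h2 : |(∫ σ, H' u σ p.2 * Real.exp (H u σ p.2) ∂lam) / partFn lam (H u) p.2|
        ≤ |c| * bnd lam K 0 2 p.1 p.2 := by
      rw [abs_div, abs_of_pos hZ, div_eq_mul_inv]
      calc _ ≤ (|c| * (expMass lam K p.2).toReal) * (expMass lam K p.2).toReal :=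
            mul_le_mul (hK.abs_integral_le hp fun σ => abs_mul_exp_le (hH u hu) (hb u hu) σ p.2)
              ((hH u hu).inv_partFn_le hK hp) (by positivity) (by positivity)
        _ = _ := by simp only [bnd]; ring
    have h3 : |∑ l, H' u (p.1 l) p.2 - m * ((∫ σ, H' u σ p.2 * Real.exp (H u σ p.2) ∂lam) /
        partFn lam (H u) p.2)| ≤ m * |c| * bnd lam K 1 0 p.1 p.2
          + m * (|c| * bnd lam K 0 2 p.1 p.2) := by
      refine (abs_sub _ _).trans (add_le_add h1 ?_)
      rw [abs_mul, Nat.abs_cast]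
      gcongr
    have hw := (hH u hu).abs_wt_le hK hp p.1
    calc ‖F p.1 * _‖ ≤ |F p.1| * ((m * |c| * bnd lam K 1 0 p.1 p.2
          + m * (|c| * bnd lam K 0 2 p.1 p.2)) * bnd lam K 1 m p.1 p.2) := by
          rw [norm_mul, norm_mul]
          refine mul_le_mul_of_nonneg_left (mul_le_mul h3 hw (abs_nonneg _)
            ((abs_nonneg _).trans h3)) (abs_nonneg _)
      _ = _ := by
          rw [norm_mul, norm_mul, Real.norm_of_nonneg (bnd_nonneg _ _ _ _),
            Real.norm_of_nonneg (bnd_nonneg _ _ _ _), Real.norm_eq_abs]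
          simp only [bnd]; ring
  · filter_upwards [hgood] with p hp u hu
    exact (hasDerivAt_wt hK hI hH mH' hb hd hp hu p.1).const_mul _

theorem continuousOn_partFn (hK : ExpMoments P K) (hH : ∀ t ∈ I, Dom K (H t))
    (hc : ∀ σ ω, ContinuousOn (fun t => H t σ ω) I) {ω : Ω} (hω : expMass lam K ω ≠ ∞) :
    ContinuousOn (fun t => partFn lam (H t) ω) I := by
  intro t ht
  refine continuousWithinAt_of_dominated (bound := fun σ => Real.exp (2 * K σ ω)) ?_ ?_
    (hK.integrable_exp_two hω) (ae_of_all _ fun σ => (hc σ ω t ht).rexp)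
  · filter_upwards [self_mem_nhdsWithin] with u hu
    exact ((hH u hu).measurable_left ω).exp.aestronglyMeasurable
  · filter_upwards [self_mem_nhdsWithin] with u hu
    refine ae_of_all _ fun σ => ?_
    rw [Real.norm_of_nonneg (Real.exp_pos _).le]
    exact ((hH u hu).exp_le σ ω).trans (exp_le_exp_two hK σ ω)

/-- No derivative of the Hamiltonian enters, so the closed interval is allowed. It is applied both
to the function differentiated and to its derivative, again a Gibbs average. -/
theorem continuousOn_rep (hK : ExpMoments P K) (hH : ∀ t ∈ I, Dom K (H t))
    (hc : ∀ σ ω, ContinuousOn (fun t => H t σ ω) I) {m : ℕ} {F : (Fin m → S) → ℝ}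
    (hF : Integrable F (Measure.pi fun _ : Fin m => lam)) :
    ContinuousOn (fun t => rep lam P (H t) m fun s _ => F s) I := by
  have aF : Adm lam P K fun (s : Fin m → S) (_ : Ω) => F s := Adm.of_integrable hF
  refine ContinuousOn.congr (f := fun t => ∫ p, F p.1 * wt lam (H t) m p.1 p.2
    ∂((Measure.pi fun _ : Fin m => lam).prod P)) ?_ fun t ht => aF.rep_eq_prod (hH t ht) hK
  intro t ht
  have hgood := ae_prod_expMass_ne_top (lam := lam) hK m
  refine continuousWithinAt_of_dominated
    (bound := fun p => ‖F p.1 * bnd lam K 1 m p.1 p.2‖) ?_ ?_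
    (hK.integrable_mul_bnd _ _ hF).norm ?_
  · filter_upwards [self_mem_nhdsWithin] with u hu
    exact aF.meas.mul ((hH u hu).measurable_wt m).aestronglyMeasurable
  · filter_upwards [self_mem_nhdsWithin] with u hu
    filter_upwards [hgood] with p hp
    rw [norm_mul, norm_mul, Real.norm_of_nonneg (bnd_nonneg _ _ _ _)]
    exact mul_le_mul_of_nonneg_left ((hH u hu).abs_wt_le hK hp p.1) (norm_nonneg _)
  · filter_upwards [hgood] with p hp
    refine ContinuousWithinAt.mul continuousWithinAt_const ?_
    refine ContinuousWithinAt.div ?_ ((continuousOn_partFn hK hH hc hp t ht).pow m)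
      (pow_ne_zero _ ((hH t ht).partFn_pos hK hp).ne')
    refine ContinuousWithinAt.rexp ?_
    exact ContinuousOn.continuousWithinAt (continuousOn_finsetSum _ fun l _ => hc _ _) ht

end Derivative

end

/-! ### Bounded observables and interpolation between two Gaussian fields -/

section

open Filter Topology

/-- Bounded measurable real functions. -/
def BddMeas {α : Type*} [MeasurableSpace α] (g : α → ℝ) : Prop :=
  Measurable g ∧ ∃ C, ∀ x, |g x| ≤ C

namespace BddMeas

variable {α β : Type*} [MeasurableSpace α] [MeasurableSpace β] {f g : α → ℝ}

theorem const (c : ℝ) : BddMeas fun _ : α => c := ⟨measurable_const, |c|, fun _ => le_rfl⟩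

theorem add (hf : BddMeas f) (hg : BddMeas g) : BddMeas fun x => f x + g x := by
  obtain ⟨mf, C, hC⟩ := hf
  obtain ⟨mg, D, hD⟩ := hg
  exact ⟨mf.add mg, C + D, fun x => (abs_add_le _ _).trans (add_le_add (hC x) (hD x))⟩

theorem mul (hf : BddMeas f) (hg : BddMeas g) : BddMeas fun x => f x * g x := by
  obtain ⟨mf, C, hC⟩ := hf
  obtain ⟨mg, D, hD⟩ := hg
  refine ⟨mf.mul mg, C * D, fun x => ?_⟩
  rw [abs_mul]
  exact mul_le_mul (hC x) (hD x) (abs_nonneg _) ((abs_nonneg _).trans (hC x))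

theorem const_mul (c : ℝ) (hf : BddMeas f) : BddMeas fun x => c * f x := (const c).mul hf

theorem sub (hf : BddMeas f) (hg : BddMeas g) : BddMeas fun x => f x - g x := by
  simpa [sub_eq_add_neg] using hf.add (hg.const_mul (-1))

theorem pow (hf : BddMeas f) (k : ℕ) : BddMeas fun x => f x ^ k := by
  induction k with
  | zero => simpa using const 1
  | succ k ih => simpa [pow_succ] using ih.mul hf

theorem sum {ι : Type*} (I : Finset ι) {f : ι → α → ℝ} (hf : ∀ i ∈ I, BddMeas (f i)) :
    BddMeas fun x => ∑ i ∈ I, f i x := by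
  classical
  induction I using Finset.induction_on with
  | empty => simpa using const 0
  | insert i I hi ih =>
    simp only [Finset.sum_insert hi]
    exact (hf i (Finset.mem_insert_self _ _)).add
      (ih fun j hj => hf j (Finset.mem_insert_of_mem hj))

theorem comp (hf : BddMeas f) {φ : β → α} (hφ : Measurable φ) : BddMeas fun x => f (φ x) :=
  ⟨hf.1.comp hφ, hf.2.imp fun _ h _ => h _⟩

theorem integrable_mul (hg : BddMeas g) {μ : Measure α} (hf : Integrable f μ) :
    Integrable (fun x => f x * g x) μ := by
  obtain ⟨mg, C, hC⟩ := hg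
  exact hf.mul_bdd mg.aestronglyMeasurable (ae_of_all _ hC)

end BddMeas

/-- The Gibbs average of `F g`, regarded as a linear functional of `g`. -/
noncomputable def wrep {S Ω : Type*} [MeasurableSpace S] [MeasurableSpace Ω] (lam : Measure S)
    (P : Measure Ω) (H : S → Ω → ℝ) (m : ℕ) (F g : (Fin m → S) → ℝ) : ℝ :=
  rep lam P H m fun s _ => F s * g s

section Linear

variable {S Ω : Type*} [MeasurableSpace S] [MeasurableSpace Ω] {lam : Measure S}
  [IsProbabilityMeasure lam] {P : Measure Ω} [IsProbabilityMeasure P] {K H : S → Ω → ℝ}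
  {m : ℕ} {F : (Fin m → S) → ℝ}

theorem BddMeas.adm {g : (Fin m → S) → ℝ} (hg : BddMeas g)
    (hF : Integrable F (Measure.pi fun _ : Fin m => lam)) :
    Adm lam P K fun (s : Fin m → S) (_ : Ω) => F s * g s :=
  Adm.of_integrable (hg.integrable_mul hF)

theorem wrep_add (hH : Dom K H) (hK : ExpMoments P K)
    (hF : Integrable F (Measure.pi fun _ : Fin m => lam)) {g g' : (Fin m → S) → ℝ}
    (hg : BddMeas g) (hg' : BddMeas g') :
    wrep lam P H m F (fun s => g s + g' s) = wrep lam P H m F g + wrep lam P H m F g' := by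
  unfold wrep
  have h := (hg.add hg').adm (P := P) (K := K) hF
  simp only [mul_add] at h ⊢
  exact rep_add (hg.adm hF) (hg'.adm hF) hH hK h

theorem wrep_const_mul (c : ℝ) (g : (Fin m → S) → ℝ) :
    wrep lam P H m F (fun s => c * g s) = c * wrep lam P H m F g := by
  unfold wrep
  simp only [mul_left_comm _ c, rep_const_mul]

theorem wrep_sub (hH : Dom K H) (hK : ExpMoments P K)
    (hF : Integrable F (Measure.pi fun _ : Fin m => lam)) {g g' : (Fin m → S) → ℝ}
    (hg : BddMeas g) (hg' : BddMeas g') :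
    wrep lam P H m F (fun s => g s - g' s) = wrep lam P H m F g - wrep lam P H m F g' := by
  have h := wrep_add hH hK hF hg (hg'.const_mul (-1))
  rw [wrep_const_mul] at h
  simpa [sub_eq_add_neg] using h

theorem wrep_sum (hH : Dom K H) (hK : ExpMoments P K)
    (hF : Integrable F (Measure.pi fun _ : Fin m => lam)) {ι : Type*} (I : Finset ι)
    {g : ι → (Fin m → S) → ℝ} (hg : ∀ i ∈ I, BddMeas (g i)) :
    wrep lam P H m F (fun s => ∑ i ∈ I, g i s) = ∑ i ∈ I, wrep lam P H m F (g i) := by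
  unfold wrep
  have h := (BddMeas.sum I hg).adm (P := P) (K := K) hF
  simp only [Finset.mul_sum] at h ⊢
  exact rep_sum I (fun i hi => (hg i hi).adm hF) hH hK h

theorem wrep_castSucc (hH : Dom K H) (hK : ExpMoments P K)
    (hF : Integrable F (Measure.pi fun _ : Fin m => lam)) {g : (Fin m → S) → ℝ}
    (hg : BddMeas g) :
    wrep lam P H (m + 1) (fun s => F fun j => s j.castSucc) (fun s => g fun j => s j.castSucc)
      = wrep lam P H m F g :=
  rep_castSucc (Φ := fun s _ => F s * g s) (hg.adm hF) hH hK

end Linear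

/-- Covers the end points, where `√t` or `√(1 - t)` is not differentiable: continuity of `φ`
together with convergence of its derivative gives the one-sided derivative. -/
theorem hasDerivWithinAt_Icc_of_Ioo {φ D : ℝ → ℝ} {a b : ℝ} (hab : a < b)
    (hφ : ContinuousOn φ (Icc a b))
    (hD : ContinuousOn D (Icc a b)) (h : ∀ t ∈ Ioo a b, HasDerivAt φ (D t) t) {t : ℝ}
    (ht : t ∈ Icc a b) : HasDerivWithinAt φ (D t) (Icc a b) t := by
  have hcl : closure (Ioo a b) = Icc a b := closure_Ioo hab.ne
  have := hasFDerivWithinAt_closure_of_tendsto_fderiv (f := φ) (s := Ioo a b) (x := t)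
    (f' := ContinuousLinearMap.toSpanSingleton ℝ (D t))
    (fun y hy => (h y hy).differentiableAt.differentiableWithinAt) (convex_Ioo a b) isOpen_Ioo
    (fun y hy => (hφ y (hcl ▸ hy)).mono Ioo_subset_Icc_self) ?_
  · rw [hcl] at this
    exact this.hasDerivWithinAt.congr_deriv (by simp)
  · have h1 : Tendsto D (𝓝[Ioo a b] t) (𝓝 (D t)) := (hD t ht).mono Ioo_subset_Icc_self
    have h2 : Continuous fun x : ℝ => ContinuousLinearMap.toSpanSingleton ℝ x :=
      (ContinuousLinearMap.toSpanSingletonCLE (𝕜 := ℝ) (E := ℝ)).continuous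
    refine ((h2.tendsto (D t)).comp h1).congr' ?_
    filter_upwards [self_mem_nhdsWithin] with y hy
    exact ((h y hy).hasFDerivAt.fderiv).symm

/-- Mean and covariance data for two uncorrelated, jointly Gaussian random fields. -/
structure GaussPair {S Ω : Type*} [MeasurableSpace S] [MeasurableSpace Ω] (P : Measure Ω)
    (A B : S → Ω → ℝ) (CA CB : S → S → ℝ) : Prop where
  gaussian : IsGaussianProcess (Sum.elim A B) P
  measA : Measurable (Function.uncurry A)
  measB : Measurable (Function.uncurry B)
  centeredA : ∀ σ, ∫ ω, A σ ω ∂P = 0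
  centeredB : ∀ σ, ∫ ω, B σ ω ∂P = 0
  covA : ∀ σ τ, ∫ ω, A σ ω * A τ ω ∂P = CA σ τ
  covB : ∀ σ τ, ∫ ω, B σ ω * B τ ω ∂P = CB σ τ
  covAB : ∀ σ τ, ∫ ω, A σ ω * B τ ω ∂P = 0
  bddA : BddMeas (Function.uncurry CA)
  bddB : BddMeas (Function.uncurry CB)

/-- The Gaussian moment generating function, with the variance replaced by an upper bound so that
the result can be uniform over a field. -/
theorem lintegral_exp_le {Ω : Type*} [MeasurableSpace Ω] {P : Measure Ω} {X : Ω → ℝ}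
    (hX : HasGaussianLaw X P) (X0 : ∫ ω, X ω ∂P = 0) {C : ℝ} (hC : ∫ ω, X ω * X ω ∂P ≤ C)
    (a : ℝ) : ∫⁻ ω, ENNReal.ofReal (Real.exp (a * X ω)) ∂P
      ≤ ENNReal.ofReal (Real.exp (C * a ^ 2 / 2)) := by
  have hv : ((Var[X; P]).toNNReal : ℝ) = ∫ ω, X ω * X ω ∂P := by
    rw [Real.coe_toNNReal _ (variance_nonneg _ _),
      variance_of_integral_eq_zero hX.aemeasurable X0]
    congr 1; ext ω; ring
  have hmap := hX.map_eq_gaussianReal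
  have hi : Integrable (fun ω => Real.exp (a * X ω)) P := by
    have := integrable_exp_mul_gaussianReal (μ := P[X]) (v := Var[X; P].toNNReal) a
    rw [← hmap] at this
    exact this.comp_aemeasurable hX.aemeasurable
  rw [← ofReal_integral_eq_lintegral_ofReal hi (ae_of_all _ fun _ => (Real.exp_pos _).le)]
  refine ENNReal.ofReal_le_ofReal ?_
  have := mgf_gaussianReal hmap a
  rw [mgf, X0, hv] at this
  rw [this, zero_mul, zero_add]
  gcongr

namespace GaussPair

variable {S Ω : Type*} [MeasurableSpace S] [MeasurableSpace Ω] {lam : Measure S}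
  [IsProbabilityMeasure lam] {P : Measure Ω} [IsProbabilityMeasure P] {A B : S → Ω → ℝ}
  {CA CB : S → S → ℝ} {m₀ m₁ : S → ℝ}

theorem gaussA (h : GaussPair P A B CA CB) (σ : S) : HasGaussianLaw (A σ) P :=
  h.gaussian.hasGaussianLaw_eval (Sum.inl σ)

theorem gaussB (h : GaussPair P A B CA CB) (σ : S) : HasGaussianLaw (B σ) P :=
  h.gaussian.hasGaussianLaw_eval (Sum.inr σ)

/-- The dominating field `|A| + |B| + D`. -/
def domField (A B : S → Ω → ℝ) (D : ℝ) (σ : S) (ω : Ω) : ℝ := |A σ ω| + |B σ ω| + D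

/-- Bounded covariances give Gaussian moment bounds uniform in `σ`. Absolute values are removed by
`exp |x| ≤ exp x + exp (-x)`. -/
theorem expMoments (h : GaussPair P A B CA CB) {D : ℝ} (hD : 0 ≤ D) :
    ExpMoments P (domField A B D) := by
  obtain ⟨-, C1, hC1⟩ := h.bddA
  obtain ⟨-, C2, hC2⟩ := h.bddB
  refine ⟨(h.measA.abs.add h.measB.abs).add_const D, fun σ ω => by unfold domField; positivity,
    fun p => ?_⟩
  have hA : ∀ σ a, ∫⁻ ω, ENNReal.ofReal (Real.exp (a * A σ ω)) ∂P
      ≤ ENNReal.ofReal (Real.exp (C1 * a ^ 2 / 2)) := fun σ a =>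
    lintegral_exp_le (h.gaussA σ) (h.centeredA σ)
      ((h.covA σ σ).trans_le ((le_abs_self _).trans (hC1 (σ, σ)))) a
  have hB : ∀ σ a, ∫⁻ ω, ENNReal.ofReal (Real.exp (a * B σ ω)) ∂P
      ≤ ENNReal.ofReal (Real.exp (C2 * a ^ 2 / 2)) := fun σ a =>
    lintegral_exp_le (h.gaussB σ) (h.centeredB σ)
      ((h.covB σ σ).trans_le ((le_abs_self _).trans (hC2 (σ, σ)))) a
  have pt : ∀ x y : ℝ, Real.exp (p * (|x| + |y| + D)) ≤ Real.exp (p * D) *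
      (Real.exp ((2 * p) * x) + Real.exp (-(2 * p) * x)
        + (Real.exp ((2 * p) * y) + Real.exp (-(2 * p) * y))) := by
    intro x y
    have e : ∀ z : ℝ, Real.exp (2 * p * |z|) ≤
        Real.exp ((2 * p) * z) + Real.exp (-(2 * p) * z) := fun z => by
      rcases abs_choice z with hz | hz <;> rw [hz]
      · linarith [Real.exp_pos (-(2 * p) * z)]
      · rw [mul_neg, ← neg_mul]
        linarith [Real.exp_pos ((2 * p) * z)]
    rw [show (p : ℝ) * (|x| + |y| + D) = p * D + (p * |x| + p * |y|) by ring, Real.exp_add]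
    gcongr
    refine le_trans ?_ (add_le_add (e x) (e y))
    have hp : (0 : ℝ) ≤ p := Nat.cast_nonneg p
    -- Here `p|x| + p|y| ≤ 2p max(|x|, |y|)`, which is why the exponent `2p` appears and no
    -- independence is needed.
    rcases le_total |x| |y| with hxy | hxy
    · refine le_trans (Real.exp_le_exp.2 ?_) (le_add_of_nonneg_left (Real.exp_pos _).le)
      nlinarith
    · refine le_trans (Real.exp_le_exp.2 ?_) (le_add_of_nonneg_right (Real.exp_pos _).le)
      nlinarith
  refine ⟨(Real.exp (p * D)).toNNReal * ((Real.exp (C1 * (2 * p) ^ 2 / 2)).toNNReal +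
    (Real.exp (C1 * (-(2 * p)) ^ 2 / 2)).toNNReal + ((Real.exp (C2 * (2 * p) ^ 2 / 2)).toNNReal +
    (Real.exp (C2 * (-(2 * p)) ^ 2 / 2)).toNNReal)), fun σ => ?_⟩
  have mA : Measurable (A σ) := h.measA.comp measurable_prodMk_left
  have mB : Measurable (B σ) := h.measB.comp measurable_prodMk_left
  have mm : ∀ {f : Ω → ℝ} (a : ℝ), Measurable f →
      Measurable fun ω => ENNReal.ofReal (Real.exp (a * f ω)) := fun a hf =>
    (hf.const_mul a).exp.ennreal_ofReal
  calc ∫⁻ ω, ENNReal.ofReal (Real.exp (domField A B D σ ω)) ^ p ∂P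
      ≤ ∫⁻ ω, ENNReal.ofReal (Real.exp (p * D)) *
        (ENNReal.ofReal (Real.exp ((2 * p) * A σ ω)) + ENNReal.ofReal (Real.exp (-(2 * p) * A σ ω))
        + (ENNReal.ofReal (Real.exp ((2 * p) * B σ ω))
          + ENNReal.ofReal (Real.exp (-(2 * p) * B σ ω)))) ∂P := by
        refine lintegral_mono fun ω => ?_
        rw [← ENNReal.ofReal_pow (Real.exp_pos _).le, ← Real.exp_nat_mul,
          ← ENNReal.ofReal_add (by positivity) (by positivity),
          ← ENNReal.ofReal_add (by positivity) (by positivity),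
          ← ENNReal.ofReal_add (by positivity) (by positivity),
          ← ENNReal.ofReal_mul (by positivity)]
        exact ENNReal.ofReal_le_ofReal (pt _ _)
    _ ≤ _ := by
        rw [lintegral_const_mul, lintegral_add_left, lintegral_add_left (mm _ mA),
          lintegral_add_left (mm _ mB)]
        rotate_left
        · exact (mm _ mA).add (mm _ mA)
        · exact ((mm _ mA).add (mm _ mA)).add ((mm _ mB).add (mm _ mB))
        push_cast
        gcongr
        · rfl
        · exact hA σ _
        · exact hA σ _
        · exact hB σ _
        · exact hB σ _

/-- The interpolating Hamiltonian. -/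
noncomputable def path (A B : S → Ω → ℝ) (m₀ m₁ : S → ℝ) (t : ℝ) (σ : S) (ω : Ω) : ℝ :=
  √t * A σ ω + √(1 - t) * B σ ω + (m₀ σ + t * m₁ σ)

/-- The centered part of the derivative of the interpolating Hamiltonian. -/
noncomputable def slope (A B : S → Ω → ℝ) (t : ℝ) (σ : S) (ω : Ω) : ℝ :=
  1 / (2 * √t) * A σ ω - 1 / (2 * √(1 - t)) * B σ ω

theorem dom_path (h : GaussPair P A B CA CB) (h₀ : Measurable m₀) (h₁ : Measurable m₁) {D : ℝ}
    (hD : ∀ σ, |m₀ σ| + |m₁ σ| ≤ D) {t : ℝ} (ht : t ∈ Icc (0 : ℝ) 1) :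
    Dom (domField A B D) (path A B m₀ m₁ t) := by
  refine ⟨((h.measA.const_mul _).add (h.measB.const_mul _)).add
    ((h₀.comp measurable_fst).add ((h₁.comp measurable_fst).const_mul t)), fun σ ω => ?_⟩
  have e : ∀ u ∈ Icc (0 : ℝ) 1, ∀ x : ℝ, |u * x| ≤ |x| := fun u hu x => by
    rw [abs_mul, abs_of_nonneg hu.1]
    exact mul_le_of_le_one_left (abs_nonneg _) hu.2
  have s1 : √t ∈ Icc (0 : ℝ) 1 := ⟨Real.sqrt_nonneg _, Real.sqrt_le_one.2 ht.2⟩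
  have s2 : √(1 - t) ∈ Icc (0 : ℝ) 1 :=
    ⟨Real.sqrt_nonneg _, Real.sqrt_le_one.2 (by linarith [ht.1])⟩
  unfold path domField
  have := hD σ
  refine (abs_add_le _ _).trans (add_le_add ((abs_add_le _ _).trans
    (add_le_add (e _ s1 _) (e _ s2 _))) ?_)
  exact (abs_add_le _ _).trans (le_trans (add_le_add le_rfl (e t ht _)) this)

theorem hasDerivAt_path (A B : S → Ω → ℝ) (m₀ m₁ : S → ℝ) {t : ℝ} (ht : t ∈ Ioo (0 : ℝ) 1)
    (σ : S) (ω : Ω) :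
    HasDerivAt (fun t => path A B m₀ m₁ t σ ω) (slope A B t σ ω + m₁ σ) t := by
  have h1 := (Real.hasDerivAt_sqrt ht.1.ne').mul_const (A σ ω)
  have h2 := (((hasDerivAt_id t).const_sub 1).sqrt (by simp; linarith [ht.2])).mul_const (B σ ω)
  have h3 := (((hasDerivAt_id t).mul_const (m₁ σ)).const_add (m₀ σ))
  have := (h1.fun_add h2).fun_add h3
  unfold path
  convert! this using 1
  simp [slope]
  ring

theorem gaussian_slope (h : GaussPair P A B CA CB) (t : ℝ) (σ : S) :
    IsGaussianProcess (Sum.elim (fun _ : Unit => slope A B t σ)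
      fun τ ω => √t * A τ ω + √(1 - t) * B τ ω) P := by
  classical
  refine IsGaussianProcess.of_isGaussianProcess h.gaussian ?_
  rintro (u | τ)
  · refine ⟨{Sum.inl σ, Sum.inr σ}, (1 / (2 * √t)) • .proj ⟨Sum.inl σ, by simp⟩ -
        (1 / (2 * √(1 - t))) • .proj ⟨Sum.inr σ, by simp⟩, fun ω => ?_⟩
    simp [slope, Finset.restrict]
  · refine ⟨{Sum.inl τ, Sum.inr τ}, √t • .proj ⟨Sum.inl τ, by simp⟩ +
        √(1 - t) • .proj ⟨Sum.inr τ, by simp⟩, fun ω => ?_⟩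
    simp [Finset.restrict]

/-- The singular factors cancel: `√t / (2√t) = 1/2` on the diagonal terms, while the terms that
would keep a dependence on `t` multiply covariances of `A` with `B`, which vanish. -/
theorem cov_slope (h : GaussPair P A B CA CB) {t : ℝ} (ht : t ∈ Ioo (0 : ℝ) 1) (σ τ : S) :
    ∫ ω, slope A B t σ ω * (√t * A τ ω + √(1 - t) * B τ ω) ∂P = (CA σ τ - CB σ τ) / 2 := by
  have iAA := (h.gaussA σ).memLp_two.integrable_mul (h.gaussA τ).memLp_two
  have iBB := (h.gaussB σ).memLp_two.integrable_mul (h.gaussB τ).memLp_two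
  have iAB := (h.gaussA σ).memLp_two.integrable_mul (h.gaussB τ).memLp_two
  have iBA := (h.gaussA τ).memLp_two.integrable_mul (h.gaussB σ).memLp_two
  have p1 : √t ≠ 0 := (Real.sqrt_pos.2 ht.1).ne'
  have p2 : √(1 - t) ≠ 0 := (Real.sqrt_pos.2 (by linarith [ht.2])).ne'
  have e : ∀ ω, slope A B t σ ω * (√t * A τ ω + √(1 - t) * B τ ω)
      = (1 / 2 * (A σ ω * A τ ω) - 1 / 2 * (B σ ω * B τ ω))
        + (√(1 - t) / (2 * √t) * (A σ ω * B τ ω)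
        - √t / (2 * √(1 - t)) * (A τ ω * B σ ω)) := by
    intro ω
    unfold slope
    field_simp
    ring
  simp only [Pi.mul_def] at iAA iBB iAB iBA
  simp only [e]
  rw [integral_add, integral_sub (iAA.const_mul _) (iBB.const_mul _),
    integral_sub (iAB.const_mul _) (iBA.const_mul _)]
  rotate_left
  · exact (iAA.const_mul _).sub (iBB.const_mul _)
  · exact (iAB.const_mul _).sub (iBA.const_mul _)
  simp only [integral_const_mul, h.covA, h.covB, h.covAB]
  ring

end GaussPair

end

/-! ### The generator of the interpolation -/

section

open Filter Topology

/-- The generator of the interpolation, as a function of `n + 2` replicas. -/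
noncomputable def genTerm {S : Type*} (U : S → S → ℝ) (u : S → ℝ) (n : ℕ) (s : Fin (n + 2) → S) :
    ℝ :=
  (∑ l : Fin n, ∑ l' : Fin n, U (s l.castSucc.castSucc) (s l'.castSucc.castSucc))
    - 2 * n * ∑ l : Fin n, U (s l.castSucc.castSucc) (s (Fin.last n).castSucc)
    - n * U (s (Fin.last n).castSucc) (s (Fin.last n).castSucc)
    + n * (n + 1) * U (s (Fin.last n).castSucc) (s (Fin.last (n + 1)))
    + ∑ l : Fin n, u (s l.castSucc.castSucc) - n * u (s (Fin.last n).castSucc)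

/-- The right-hand side is what integration by parts produces: once for each of the `n` original
replicas, against replica `n+1`, and once for replica `n+1`, against replica `n+2`. Symmetry of `U`
merges the two groups of mixed terms into the coefficient `-2n`. -/
theorem genTerm_eq {S : Type*} {U : S → S → ℝ} (hU : ∀ σ τ, U σ τ = U τ σ) (u : S → ℝ) (n : ℕ)
    (s : Fin (n + 2) → S) :
    genTerm U u n s = (∑ l : Fin n, (((∑ l' : Fin n, U (s l.castSucc.castSucc)
        (s l'.castSucc.castSucc)) - n * U (s l.castSucc.castSucc) (s (Fin.last n).castSucc))
        + u (s l.castSucc.castSucc)))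
      - n * (((∑ l' : Fin (n + 1), U (s (Fin.last n).castSucc) (s l'.castSucc))
        - (n + 1 : ℕ) * U (s (Fin.last n).castSucc) (s (Fin.last (n + 1))))
        + u (s (Fin.last n).castSucc)) := by
  rw [Finset.sum_add_distrib, Finset.sum_sub_distrib, ← Finset.mul_sum, Fin.sum_univ_castSucc]
  simp only [hU (s (Fin.last n).castSucc) (s (Fin.castSucc (Fin.castSucc _)))]
  unfold genTerm
  push_cast
  ring

theorem bddMeas_pair {S : Type*} [MeasurableSpace S] {U : S → S → ℝ}
    (hU : BddMeas (Function.uncurry U)) {m : ℕ} (i j : Fin m) :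
    BddMeas fun s : Fin m → S => U (s i) (s j) :=
  hU.comp (φ := fun s : Fin m → S => (s i, s j))
    ((measurable_pi_apply i).prodMk (measurable_pi_apply j))

theorem bddMeas_single {S : Type*} [MeasurableSpace S] {u : S → ℝ} (hu : BddMeas u) {m : ℕ}
    (i : Fin m) : BddMeas fun s : Fin m → S => u (s i) :=
  hu.comp (measurable_pi_apply i)

theorem bddMeas_genTerm {S : Type*} [MeasurableSpace S] {U : S → S → ℝ} {u : S → ℝ}
    (hU : BddMeas (Function.uncurry U)) (hu : BddMeas u) (n : ℕ) : BddMeas (genTerm U u n) := by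
  unfold genTerm
  refine (((((BddMeas.sum _ fun l _ => BddMeas.sum _ fun l' _ => bddMeas_pair hU _ _).sub
    ((BddMeas.sum _ fun l _ => bddMeas_pair hU _ _).const_mul _)).sub
    ((bddMeas_pair hU _ _).const_mul _)).add ((bddMeas_pair hU _ _).const_mul _)).add
    (BddMeas.sum _ fun l _ => bddMeas_single hu _)).sub ((bddMeas_single hu _).const_mul _)

namespace GaussPair

variable {S Ω : Type*} [MeasurableSpace S] [MeasurableSpace Ω] {lam : Measure S}
  [IsProbabilityMeasure lam] {P : Measure Ω} [IsProbabilityMeasure P] {A B : S → Ω → ℝ}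
  {CA CB : S → S → ℝ} {m₀ m₁ : S → ℝ}

theorem measurable_slope (h : GaussPair P A B CA CB) (t : ℝ) :
    Measurable (Function.uncurry (slope A B t)) :=
  (h.measA.const_mul _).sub (h.measB.const_mul _)

/-- The slope is dominated uniformly only away from `0` and `1`; hence differentiation is carried
out on compactly contained subintervals. -/
theorem abs_slope_le {t a b : ℝ} (ht : t ∈ Ioo a b) (ha : 0 < a) (hb : b < 1) {D : ℝ}
    (hD : 0 ≤ D) (σ : S) (ω : Ω) :
    |slope A B t σ ω| ≤ (1 / (2 * √a) + 1 / (2 * √(1 - b))) * Real.exp (domField A B D σ ω) := by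
  have h1 : 1 / (2 * √t) ≤ 1 / (2 * √a) := by
    have : 0 < √a := Real.sqrt_pos.2 ha
    gcongr
    exact ht.1.le
  have h2 : 1 / (2 * √(1 - t)) ≤ 1 / (2 * √(1 - b)) := by
    have : 0 < √(1 - b) := Real.sqrt_pos.2 (by linarith)
    gcongr
    exact ht.2.le
  have hd : domField A B D σ ω + 1 ≤ Real.exp (domField A B D σ ω) := Real.add_one_le_exp _
  have hA : |A σ ω| ≤ Real.exp (domField A B D σ ω) := by
    refine le_trans ?_ hd
    unfold domField; linarith [abs_nonneg (B σ ω)]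
  have hB : |B σ ω| ≤ Real.exp (domField A B D σ ω) := by
    refine le_trans ?_ hd
    unfold domField; linarith [abs_nonneg (A σ ω)]
  unfold slope
  refine (abs_sub _ _).trans ?_
  rw [abs_mul, abs_mul, abs_of_nonneg (by positivity : 0 ≤ 1 / (2 * √t)),
    abs_of_nonneg (by positivity : 0 ≤ 1 / (2 * √(1 - t))), add_mul]
  gcongr

theorem symm_cov (h : GaussPair P A B CA CB) (σ τ : S) :
    (CA σ τ - CB σ τ) / 2 = (CA τ σ - CB τ σ) / 2 := by
  rw [← h.covA σ τ, ← h.covB σ τ, ← h.covA τ σ, ← h.covB τ σ]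
  simp only [mul_comm]

theorem bddMeas_cov (h : GaussPair P A B CA CB) :
    BddMeas (Function.uncurry fun σ τ => (CA σ τ - CB σ τ) / 2) := by
  have := (h.bddA.sub h.bddB).const_mul (1 / 2)
  convert! this using 1
  ext p
  simp only [Function.uncurry]
  ring

/-- Integration by parts handles the centered slope, and the drift `m₁` is carried along unchanged.
The sum over `l'` includes `l' = l`. -/
theorem rep_slope (h : GaussPair P A B CA CB) (h₀ : BddMeas m₀) (h₁ : BddMeas m₁) {D : ℝ}
    (hD0 : 0 ≤ D) (hD : ∀ σ, |m₀ σ| + |m₁ σ| ≤ D) {t : ℝ} (ht : t ∈ Ioo (0 : ℝ) 1) {k : ℕ}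
    {F : (Fin k → S) → ℝ} (hF : Integrable F (Measure.pi fun _ : Fin k => lam)) (l : Fin k) :
    rep lam P (path A B m₀ m₁ t) k (fun s ω => F s * (slope A B t (s l) ω + m₁ (s l)))
      = (wrep lam P (path A B m₀ m₁ t) k F (fun s => ∑ l', (CA (s l) (s l') - CB (s l) (s l')) / 2)
        - k * wrep lam P (path A B m₀ m₁ t) (k + 1) (fun s => F fun j => s j.castSucc) (fun s =>
          (CA (s l.castSucc) (s (Fin.last k)) - CB (s l.castSucc) (s (Fin.last k))) / 2))
        + wrep lam P (path A B m₀ m₁ t) k F (fun s => m₁ (s l)) := by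
  have hK := h.expMoments hD0
  have hH := h.dom_path h₀.1 h₁.1 hD (Ioo_subset_Icc_self ht)
  obtain ⟨mU, C, hC⟩ := h.bddMeas_cov
  have hX : ∀ σ ω, |slope A B t σ ω| ≤ _ := fun σ ω => abs_slope_le (A := A) (B := B)
    (a := t / 2) (b := (1 + t) / 2) ⟨by linarith [ht.1], by linarith [ht.2]⟩
    (by linarith [ht.1]) (by linarith [ht.2]) hD0 σ ω
  have ibp := rep_ibp (lam := lam) hK (h.gaussian_slope t) (h.measurable_slope t)
    (fun σ => ((h.measA.comp measurable_prodMk_left).const_mul _).add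
      ((h.measB.comp measurable_prodMk_left).const_mul _))
    (fun σ => by
      simp only [slope]
      rw [integral_sub ((h.gaussA σ).integrable.const_mul _)
        ((h.gaussB σ).integrable.const_mul _), integral_const_mul, integral_const_mul,
        h.centeredA, h.centeredB]
      simp)
    (fun σ τ => h.cov_slope ht σ τ) mU (fun σ τ => hC (σ, τ))
    (H := path A B m₀ m₁ t) (d := fun σ => m₀ σ + t * m₁ σ) (fun σ ω => rfl) hH hX hF l
  have a1 := Adm.mul_field (lam := lam) hK hF (h.measurable_slope t) hX l
  have a2 := (bddMeas_single h₁ l).adm (P := P) (K := domField A B D) hF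
  have a3 : Adm lam P (domField A B D) fun (s : Fin k → S) ω =>
      F s * slope A B t (s l) ω + F s * m₁ (s l) := by
    obtain ⟨-, C₁, hC₁⟩ := id h₁
    have := Adm.mul_field (lam := lam) (X := fun σ ω => slope A B t σ ω + m₁ σ) (c := (1 /
      (2 * √(t / 2)) + 1 / (2 * √(1 - (1 + t) / 2))) + C₁) hK hF ((h.measurable_slope t).add
      (h₁.1.comp measurable_fst)) (fun σ ω => ?_) l
    · simpa only [mul_add] using this
    · rw [add_mul]
      refine (abs_add_le _ _).trans (add_le_add (hX σ ω) ((hC₁ σ).trans ?_))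
      exact le_mul_of_one_le_right ((abs_nonneg _).trans (hC₁ σ))
        (Real.one_le_exp (hK.nonneg σ ω))
  simp only [mul_add]
  rw [rep_add a1 a2 hH hK a3, ibp]
  rfl

theorem hasDerivAt_wrep (h : GaussPair P A B CA CB) (h₀ : BddMeas m₀) (h₁ : BddMeas m₁) {D : ℝ}
    (hD0 : 0 ≤ D) (hD : ∀ σ, |m₀ σ| + |m₁ σ| ≤ D) {t : ℝ} (ht : t ∈ Ioo (0 : ℝ) 1) {n : ℕ}
    {F : (Fin n → S) → ℝ} (hF : Integrable F (Measure.pi fun _ : Fin n => lam)) :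
    HasDerivAt (fun t => rep lam P (path A B m₀ m₁ t) n fun s _ => F s)
      (wrep lam P (path A B m₀ m₁ t) (n + 2) (fun s => F fun j => s j.castSucc.castSucc)
        (genTerm (fun σ τ => (CA σ τ - CB σ τ) / 2) m₁ n)) t := by
  have hK := h.expMoments hD0
  have hH := h.dom_path h₀.1 h₁.1 hD (Ioo_subset_Icc_self ht)
  -- This neighbourhood of `t` stays at positive distance from both end points.
  have hI : ∀ u ∈ Ioo (t / 2) ((1 + t) / 2), u ∈ Ioo (0 : ℝ) 1 := fun u hu =>
    ⟨by linarith [hu.1, ht.1], by linarith [hu.2, ht.2]⟩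
  have hU := h.bddMeas_cov
  obtain ⟨m₁m, C₁, hC₁⟩ := id h₁
  have main := hasDerivAt_rep (lam := lam) hK (isOpen_Ioo (a := t / 2) (b := (1 + t) / 2))
    (H := path A B m₀ m₁) (H' := fun t σ ω => slope A B t σ ω + m₁ σ)
    (fun u hu => h.dom_path h₀.1 h₁.1 hD (Ioo_subset_Icc_self (hI u hu)))
    (fun u hu => (h.measurable_slope u).add (m₁m.comp measurable_fst))
    (c := (1 / (2 * √(t / 2)) + 1 / (2 * √(1 - (1 + t) / 2))) + C₁)
    (fun u hu σ ω => by
      rw [add_mul]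
      refine (abs_add_le _ _).trans (add_le_add (abs_slope_le hu (by linarith [ht.1])
        (by linarith [ht.2]) hD0 σ ω) ((hC₁ σ).trans ?_))
      exact le_mul_of_one_le_right ((abs_nonneg _).trans (hC₁ σ))
        (Real.one_le_exp (hK.nonneg σ ω)))
    (fun u hu σ ω => hasDerivAt_path A B m₀ m₁ (hI u hu) σ ω)
    (t := t) ⟨by linarith [ht.1], by linarith [ht.2]⟩ hF
  refine main.congr_deriv ?_
  have hF1 := integrable_castSucc hF
  have hF2 := integrable_castSucc hF1
  -- All terms are rewritten as averages over `n + 2` replicas, so that they can be combined under a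
  -- single functional.
  have lift : ∀ g : (Fin n → S) → ℝ, BddMeas g → wrep lam P (path A B m₀ m₁ t) n F g =
      wrep lam P (path A B m₀ m₁ t) (n + 2) (fun s => F fun j => s j.castSucc.castSucc)
        (fun s => g fun j => s j.castSucc.castSucc) := fun g hg => by
    rw [← wrep_castSucc hH hK hF hg, ← wrep_castSucc hH hK hF1
      (hg.comp (measurable_pi_lambda _ fun j => measurable_pi_apply _))]
  have lift1 : ∀ g : (Fin (n + 1) → S) → ℝ, BddMeas g →
      wrep lam P (path A B m₀ m₁ t) (n + 1) (fun s => F fun j => s j.castSucc) g =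
      wrep lam P (path A B m₀ m₁ t) (n + 2) (fun s => F fun j => s j.castSucc.castSucc)
        (fun s => g fun j => s j.castSucc) := fun g hg => by
    rw [← wrep_castSucc hH hK hF1 hg]
  have b2 : ∀ {k : ℕ} (i j : Fin k), BddMeas fun s : Fin k → S =>
    (CA (s i) (s j) - CB (s i) (s j)) / 2 := fun i j => bddMeas_pair hU i j
  have b1 : ∀ {k : ℕ} (i : Fin k), BddMeas fun s : Fin k → S => m₁ (s i) :=
    fun i => bddMeas_single h₁ i
  rw [funext (genTerm_eq h.symm_cov m₁ n),
    wrep_sub hH hK hF2 (BddMeas.sum _ fun l _ => ((BddMeas.sum _ fun l' _ => b2 _ _).sub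
      ((b2 _ _).const_mul _)).add (b1 _)) ((((BddMeas.sum _ fun l' _ => b2 _ _).sub
      ((b2 _ _).const_mul _)).add (b1 _)).const_mul _),
    wrep_sum hH hK hF2 _ (fun l _ => ((BddMeas.sum _ fun l' _ => b2 _ _).sub
      ((b2 _ _).const_mul _)).add (b1 _)),
    wrep_const_mul, wrep_add hH hK hF2 ((BddMeas.sum _ fun l' _ => b2 _ _).sub
      ((b2 _ _).const_mul _)) (b1 _), wrep_sub hH hK hF2 (BddMeas.sum _ fun l' _ => b2 _ _)
      ((b2 _ _).const_mul _), wrep_const_mul]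
  congr 1
  · refine Finset.sum_congr rfl fun l _ => ?_
    rw [wrep_add hH hK hF2 ((BddMeas.sum _ fun l' _ => b2 _ _).sub
      ((b2 _ _).const_mul _)) (b1 _), wrep_sub hH hK hF2 (BddMeas.sum _ fun l' _ => b2 _ _)
      ((b2 _ _).const_mul _), wrep_const_mul, h.rep_slope h₀ h₁ hD0 hD ht hF l,
      lift _ (BddMeas.sum _ fun l' _ => b2 _ _), lift1 _ (b2 _ _), lift _ (b1 _)]
  · rw [h.rep_slope h₀ h₁ hD0 hD ht hF1 (Fin.last n), lift1 _ (BddMeas.sum _ fun l' _ => b2 _ _),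
      lift1 _ (b1 _)]

theorem continuousOn_wrep (h : GaussPair P A B CA CB) (h₀ : BddMeas m₀) (h₁ : BddMeas m₁) {D : ℝ}
    (hD0 : 0 ≤ D) (hD : ∀ σ, |m₀ σ| + |m₁ σ| ≤ D) {n : ℕ}
    {F : (Fin n → S) → ℝ} (hF : Integrable F (Measure.pi fun _ : Fin n => lam)) :
    ContinuousOn (fun t => rep lam P (path A B m₀ m₁ t) n fun s _ => F s) (Icc 0 1) := by
  refine continuousOn_rep (h.expMoments hD0) (fun t ht => h.dom_path h₀.1 h₁.1 hD ht)
    (fun σ ω => Continuous.continuousOn ?_) hF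
  unfold path
  fun_prop

/-- The derivative of a replica average along the interpolation between two Gaussian fields. -/
theorem hasDerivWithinAt_rep (h : GaussPair P A B CA CB) (h₀ : BddMeas m₀) (h₁ : BddMeas m₁)
    {t : ℝ} (ht : t ∈ Icc (0 : ℝ) 1) {n : ℕ}
    {F : (Fin n → S) → ℝ} (hF : Integrable F (Measure.pi fun _ : Fin n => lam)) :
    HasDerivWithinAt (fun t => rep lam P (path A B m₀ m₁ t) n fun s _ => F s)
      (wrep lam P (path A B m₀ m₁ t) (n + 2) (fun s => F fun j => s j.castSucc.castSucc)
        (genTerm (fun σ τ => (CA σ τ - CB σ τ) / 2) m₁ n)) (Icc 0 1) t := by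
  obtain ⟨D₀, hD₀⟩ := h₀.2
  obtain ⟨D₁, hD₁⟩ := h₁.2
  have hD0 : (0 : ℝ) ≤ |D₀| + |D₁| := by positivity
  have hD : ∀ σ, |m₀ σ| + |m₁ σ| ≤ |D₀| + |D₁| := fun σ =>
    add_le_add ((hD₀ σ).trans (le_abs_self _)) ((hD₁ σ).trans (le_abs_self _))
  exact hasDerivWithinAt_Icc_of_Ioo one_pos (h.continuousOn_wrep h₀ h₁ hD0 hD hF)
    (h.continuousOn_wrep h₀ h₁ hD0 hD ((bddMeas_genTerm h.bddMeas_cov h₁ n).integrable_mul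
      (integrable_castSucc (integrable_castSucc hF))))
    (fun u hu => h.hasDerivAt_wrep h₀ h₁ hD0 hD hu hF) ht

end GaussPair

end

/-! ### Taylor expansion of the covariances -/

/-- Mean value inequality for `z ↦ f z - f'(x) z` on the segment from `x` to `y`, where its
derivative is at most `C |y - x|`. -/
theorem abs_taylor_two_le {f f' : ℝ → ℝ} {a b C : ℝ}
    (hf : ∀ x ∈ Icc a b, HasDerivWithinAt f (f' x) (Icc a b) x)
    (hL : ∀ x ∈ Icc a b, ∀ y ∈ Icc a b, |f' x - f' y| ≤ C * |x - y|) {x y : ℝ}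
    (hx : x ∈ Icc a b) (hy : y ∈ Icc a b) : |f y - f x - f' x * (y - x)| ≤ C * (y - x) ^ 2 := by
  have hsub : uIcc x y ⊆ Icc a b := ordConnected_Icc.uIcc_subset hx hy
  have hC : ∀ z ∈ uIcc x y, ‖f' z - f' x‖ ≤ |C| * |y - x| := fun z hz => by
    refine (hL z (hsub hz) x hx).trans ?_
    have : |z - x| ≤ |y - x| := abs_sub_left_of_mem_uIcc hz
    exact mul_le_mul (le_abs_self C) this (abs_nonneg _) (abs_nonneg _)
  have hd : ∀ z ∈ uIcc x y, HasDerivWithinAt (fun z => f z - f' x * z) (f' z - f' x)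
      (uIcc x y) z := fun z hz => by
    simpa using ((hf z (hsub hz)).mono hsub).fun_sub
      (((hasDerivAt_id z).const_mul (f' x)).hasDerivWithinAt)
  have h := (convex_uIcc x y).norm_image_sub_le_of_norm_hasDerivWithin_le hd hC
    left_mem_uIcc right_mem_uIcc
  rw [Real.norm_eq_abs, Real.norm_eq_abs, mul_assoc, abs_mul_abs_self, ← sq] at h
  -- For `x ≠ y` the Lipschitz hypothesis itself forces `C ≥ 0`.
  by_cases hxy : x = y
  · subst hxy; simp
  have hCnn : 0 ≤ C := by
    have h1 := (abs_nonneg _).trans (hL x hx y hy)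
    exact nonneg_of_mul_nonneg_left h1 (abs_pos.2 (sub_ne_zero.2 hxy))
  rw [abs_of_nonneg hCnn] at h
  convert h using 2
  ring

/-- Second order Taylor expansions of a `C³` function and of its derivative, with uniform
constants. -/
theorem exists_taylor_bounds {ξ : ℝ → ℝ} (hξ : ContDiffOn ℝ 3 ξ (Icc (-1) 1)) :
    ∃ (C : ℝ) (g : ℝ → ℝ), 0 ≤ C ∧ (∀ x ∈ Icc (-1 : ℝ) 1, |g x| ≤ C) ∧
      (∀ x ∈ Icc (-1 : ℝ) 1, ∀ y ∈ Icc (-1 : ℝ) 1, |ξ y - ξ x - g x * (y - x)| ≤ C * (y - x) ^ 2) ∧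
      ∀ q ∈ Ico (0 : ℝ) 1, deriv ξ q = g q ∧ |deriv (deriv ξ) q| ≤ C ∧
        ∀ x ∈ Icc (-1 : ℝ) 1,
          |g x - deriv ξ q - deriv (deriv ξ) q * (x - q)| ≤ C * (x - q) ^ 2 := by
  set J : Set ℝ := Icc (-1) 1 with hJ
  have hu : UniqueDiffOn ℝ J := uniqueDiffOn_Icc (by norm_num)
  set g := derivWithin ξ J
  set g2 := derivWithin g J
  set g3 := derivWithin g2 J
  have c1 : ContDiffOn ℝ 2 g J := hξ.derivWithin hu (by norm_num)
  have c2 : ContDiffOn ℝ 1 g2 J := c1.derivWithin hu (by norm_num)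
  have c3 : ContDiffOn ℝ 0 g3 J := c2.derivWithin hu (by norm_num)
  have d0 : ∀ x ∈ J, HasDerivWithinAt ξ (g x) J x := fun x hx =>
    (hξ.differentiableOn (by norm_num) x hx).hasDerivWithinAt
  have d1 : ∀ x ∈ J, HasDerivWithinAt g (g2 x) J x := fun x hx =>
    (c1.differentiableOn (by norm_num) x hx).hasDerivWithinAt
  have d2 : ∀ x ∈ J, HasDerivWithinAt g2 (g3 x) J x := fun x hx =>
    (c2.differentiableOn (by norm_num) x hx).hasDerivWithinAt
  obtain ⟨C1, hC1⟩ := isCompact_Icc.exists_bound_of_continuousOn c1.continuousOn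
  obtain ⟨C2, hC2⟩ := isCompact_Icc.exists_bound_of_continuousOn c2.continuousOn
  obtain ⟨C3, hC3⟩ := isCompact_Icc.exists_bound_of_continuousOn c3.continuousOn
  set C := |C1| + |C2| + |C3|
  have b1 : ∀ x ∈ J, |g x| ≤ C := fun x hx => (hC1 x hx).trans
    ((le_abs_self C1).trans (by simp only [C]; linarith [abs_nonneg C2, abs_nonneg C3]))
  have b2 : ∀ x ∈ J, ‖g2 x‖ ≤ C := fun x hx => (hC2 x hx).trans
    ((le_abs_self C2).trans (by simp only [C]; linarith [abs_nonneg C1, abs_nonneg C3]))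
  have b3 : ∀ x ∈ J, ‖g3 x‖ ≤ C := fun x hx => (hC3 x hx).trans
    ((le_abs_self C3).trans (by simp only [C]; linarith [abs_nonneg C1, abs_nonneg C2]))
  have l1 : ∀ x ∈ J, ∀ y ∈ J, |g x - g y| ≤ C * |x - y| := fun x hx y hy =>
    (convex_Icc _ _).norm_image_sub_le_of_norm_hasDerivWithin_le d1 b2 hy hx
  have l2 : ∀ x ∈ J, ∀ y ∈ J, |g2 x - g2 y| ≤ C * |x - y| := fun x hx y hy =>
    (convex_Icc _ _).norm_image_sub_le_of_norm_hasDerivWithin_le d2 b3 hy hx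
  have e1 : ∀ x ∈ Ioo (-1 : ℝ) 1, deriv ξ x = g x := fun x hx =>
    (derivWithin_of_mem_nhds (Icc_mem_nhds hx.1 hx.2)).symm
  have e2 : ∀ x ∈ Ioo (-1 : ℝ) 1, deriv (deriv ξ) x = g2 x := fun x hx => by
    have : deriv ξ =ᶠ[nhds x] g := by
      filter_upwards [Ioo_mem_nhds hx.1 hx.2] with y hy using e1 y hy
    rw [this.deriv_eq]
    exact (derivWithin_of_mem_nhds (Icc_mem_nhds hx.1 hx.2)).symm
  refine ⟨C, g, by positivity, b1, fun x hx y hy => abs_taylor_two_le d0 l1 hx hy, fun q hq => ?_⟩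
  -- Since `0 ≤ q < 1`, the point is interior and the ordinary derivatives at `q` agree with those
  -- taken within `[-1, 1]`.
  have hq' : q ∈ Ioo (-1 : ℝ) 1 := ⟨by linarith [hq.1], hq.2⟩
  have hqJ : q ∈ J := Ioo_subset_Icc_self hq'
  rw [e1 q hq', e2 q hq']
  exact ⟨rfl, b2 q hqJ, fun x hx => abs_taylor_two_le d1 l2 hqJ hx⟩

/-- Bounds on `ρ = √((M + 1 - e²) / M)` and on `ρ - 1`. -/
theorem sqrt_ratio_facts {M e : ℝ} (hM : 1 ≤ M) (he : e ^ 2 ≤ M + 1) {ρ : ℝ}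
    (hρ : ρ = √((M + 1 - e ^ 2) / M)) :
    M * ρ ^ 2 = M + 1 - e ^ 2 ∧ M * (ρ - 1) ^ 2 ≤ |1 - e ^ 2| ∧
      M * (M * (ρ - 1) ^ 2) ≤ (1 - e ^ 2) ^ 2 := by
  have hM0 : 0 < M := by linarith
  have hρ0 : 0 ≤ ρ := hρ ▸ Real.sqrt_nonneg _
  have h1 : M * ρ ^ 2 = M + 1 - e ^ 2 := by
    rw [hρ, Real.sq_sqrt (div_nonneg (by linarith) hM0.le)]
    field_simp
  -- Both bounds come from this factorisation together with `ρ + 1 ≥ 1` and `|ρ - 1| ≤ ρ + 1`.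
  have h2 : M * (ρ - 1) * (ρ + 1) = 1 - e ^ 2 := by linarith
  refine ⟨h1, ?_, ?_⟩
  · rw [← h2, abs_mul, abs_mul, abs_of_pos hM0, abs_of_nonneg (by linarith : 0 ≤ ρ + 1), mul_assoc,
      ← sq_abs (ρ - 1), sq]
    gcongr
    exact abs_le.2 ⟨by linarith, by linarith⟩
  · rw [← h2]
    have : 1 ≤ (ρ + 1) ^ 2 := by nlinarith
    calc M * (M * (ρ - 1) ^ 2) = (M * (ρ - 1)) ^ 2 * 1 := by ring
      _ ≤ (M * (ρ - 1)) ^ 2 * (ρ + 1) ^ 2 := by gcongr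
      _ = _ := by ring

theorem abs_one_sub_sq_le (e : ℝ) : |1 - e ^ 2| ≤ 1 + e ^ 2 :=
  abs_le.2 ⟨by linarith [sq_nonneg e], by linarith [sq_nonneg e]⟩

/-- Two estimates of the same quantity: the first, quadratic in the `e`'s, keeps the overlap
increment of order `1 + e² + e'²`; the second is the gain of a factor `1/N`. -/
theorem sqrt_ratio_sub_bounds {M e e' ρ ρ' : ℝ} (hM : 1 ≤ M) (he : e ^ 2 ≤ M + 1)
    (he' : e' ^ 2 ≤ M + 1) (hρ : ρ = √((M + 1 - e ^ 2) / M))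
    (hρ' : ρ' = √((M + 1 - e' ^ 2) / M)) :
    M * (ρ - ρ') ^ 2 / 2 ≤ 2 + (e ^ 2 + e' ^ 2) ∧
      M * (ρ - ρ') ^ 2 / 2 ≤ 8 * ((1 + e ^ 4 + e' ^ 4) / (M + 1)) := by
  obtain ⟨-, r2, r3⟩ := sqrt_ratio_facts hM he hρ
  obtain ⟨-, r2', r3'⟩ := sqrt_ratio_facts hM he' hρ'
  have hM0 : 0 < M := by linarith
  have h2 : M * (ρ - ρ') ^ 2 ≤ 2 * (M * (ρ - 1) ^ 2) + 2 * (M * (ρ' - 1) ^ 2) := by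
    have : 0 ≤ M * (ρ + ρ' - 2) ^ 2 := by positivity
    linear_combination this
  refine ⟨by linarith [abs_one_sub_sq_le e, abs_one_sub_sq_le e'], ?_⟩
  have h3 : M * (M * (ρ - ρ') ^ 2 / 2) ≤ 4 * (1 + e ^ 4 + e' ^ 4) := by
    have := mul_le_mul_of_nonneg_left h2 hM0.le
    linarith [sq_nonneg (1 + e ^ 2), sq_nonneg (1 + e' ^ 2), sq_nonneg (e ^ 2), sq_nonneg (e' ^ 2)]
  have h4 : M * (ρ - ρ') ^ 2 / 2 ≤ M * (M * (ρ - ρ') ^ 2 / 2) :=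
    le_mul_of_one_le_left (by positivity) hM
  rw [← mul_div_assoc, le_div_iff₀ (by linarith)]
  linarith

/-- Polarisation: `2ρρ' = ρ² + ρ'² - (ρ - ρ')²`, with `M ρ²` and `M ρ'²` known exactly. -/
theorem overlap_increment {M e e' ρ ρ' x y : ℝ} (hM : 1 ≤ M)
    (r1 : M * ρ ^ 2 = M + 1 - e ^ 2) (r1' : M * ρ' ^ 2 = M + 1 - e' ^ 2)
    (hxy : y = (M * ρ * ρ' * x + e * e') / (M + 1)) :
    (M + 1) * (y - x)
      = x * (-(M * (ρ - ρ') ^ 2 / 2) - (e ^ 2 + e' ^ 2) / 2) + e * e' := by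
  have : (M + 1) * y = M * ρ * ρ' * x + e * e' := by
    rw [hxy, mul_div_cancel₀ _ (by linarith)]
  linear_combination this + x / 2 * r1 + x / 2 * r1'

theorem scaled_increment_sq_le {e e' D : ℝ} (hD : |D| ≤ 2 * (1 + (e ^ 2 + e' ^ 2))) :
    D ^ 2 ≤ 12 * (1 + e ^ 4 + e' ^ 4) := by
  rw [← sq_abs]
  refine (pow_le_pow_left₀ (abs_nonneg _) hD 2).trans ?_
  linarith [sq_nonneg (e ^ 2 - e' ^ 2), sq_nonneg (e ^ 2 - 1), sq_nonneg (e' ^ 2 - 1)]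

/-- Expand `ξ(y)` about `x`, insert the exact increment `(M+1)(y - x)`, then expand `ξ(x)`, `x
ξ'(x)` and `ξ'(x)` about `q`. The function `g` plays the role of `ξ'` on the closed interval. What
is left is either of order `1/N` or quadratic in `x - q`. -/
theorem pair_expansion {ξ g : ℝ → ℝ} {C q ξ' ξ'' : ℝ} (hC : 0 ≤ C)
    (hg : ∀ x ∈ Icc (-1 : ℝ) 1, |g x| ≤ C)
    (hT : ∀ x ∈ Icc (-1 : ℝ) 1, ∀ y ∈ Icc (-1 : ℝ) 1,
      |ξ y - ξ x - g x * (y - x)| ≤ C * (y - x) ^ 2)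
    (hq : q ∈ Ico (0 : ℝ) 1) (hq1 : ξ' = g q) (hq2 : |ξ''| ≤ C)
    (hqT : ∀ x ∈ Icc (-1 : ℝ) 1, |g x - ξ' - ξ'' * (x - q)| ≤ C * (x - q) ^ 2)
    {M e e' ρ ρ' x y : ℝ} (hM : 1 ≤ M) (he : e ^ 2 ≤ M + 1) (he' : e' ^ 2 ≤ M + 1)
    (hρ : ρ = √((M + 1 - e ^ 2) / M)) (hρ' : ρ' = √((M + 1 - e' ^ 2) / M))
    (hx : x ∈ Icc (-1 : ℝ) 1) (hy : y ∈ Icc (-1 : ℝ) 1)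
    (hxy : y = (M * ρ * ρ' * x + e * e') / (M + 1)) :
    |((M + 1) * ξ y - (M * ξ x + e * e' * ξ')) / 2 - ξ q / 2 + (e ^ 2 + e' ^ 2) * q * ξ' / 4
      - (ξ' - 1 / 2 * (e ^ 2 + e' ^ 2) * (q * ξ'' + ξ') + e * e' * ξ'') / 2 * (x - q)|
      ≤ 10 * C * ((1 + e ^ 4 + e' ^ 4) / (M + 1)) + C * ((1 + e ^ 2 + e' ^ 2) * (x - q) ^ 2) := by
  obtain ⟨r1, -, -⟩ := sqrt_ratio_facts hM he hρ
  obtain ⟨r1', -, -⟩ := sqrt_ratio_facts hM he' hρ'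
  have hM0 : 0 < M := by linarith
  have hqI : q ∈ Icc (-1 : ℝ) 1 := ⟨by linarith [hq.1], hq.2.le⟩
  have hx1 : |x| ≤ 1 := abs_le.2 hx
  set s := e ^ 2 + e' ^ 2 with hs
  have hs0 : 0 ≤ s := by positivity
  have hee : |e * e'| ≤ s / 2 := by
    rw [abs_le]; constructor <;> nlinarith [sq_nonneg (e + e'), sq_nonneg (e - e')]
  obtain ⟨k1, k2⟩ := sqrt_ratio_sub_bounds hM he he' hρ hρ'
  have hΔ := overlap_increment hM r1 r1' hxy
  rw [← hs] at k1 hΔ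
  have k0 : 0 ≤ M * (ρ - ρ') ^ 2 / 2 := by positivity
  clear_value s
  generalize M * (ρ - ρ') ^ 2 / 2 = κ at k0 k1 k2 hΔ
  have hΔa : |(M + 1) * (y - x)| ≤ 2 * (1 + s) := by
    rw [hΔ]
    have a1 : |x * (-κ - s / 2)| ≤ 2 + s + s / 2 := by
      rw [abs_mul]
      refine (mul_le_of_le_one_left (abs_nonneg _) hx1).trans ?_
      rw [abs_le]; constructor <;> linarith
    linarith [abs_add_le (x * (-κ - s / 2)) (e * e')]
  have t1 : |(M + 1) * (ξ y - ξ x - g x * (y - x))| ≤ 12 * C * ((1 + e ^ 4 + e' ^ 4) / (M + 1)) := by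
    rw [abs_mul, abs_of_pos (by linarith : 0 < M + 1)]
    have a1 : ((M + 1) * (y - x)) ^ 2 ≤ 12 * (1 + e ^ 4 + e' ^ 4) :=
      scaled_increment_sq_le (hs ▸ hΔa)
    calc (M + 1) * |ξ y - ξ x - g x * (y - x)| ≤ (M + 1) * (C * (y - x) ^ 2) := by
          gcongr; exact hT x hx y hy
      _ = C * (((M + 1) * (y - x)) ^ 2 / (M + 1)) := by field_simp
      _ ≤ C * (12 * (1 + e ^ 4 + e' ^ 4) / (M + 1)) := by gcongr
      _ = _ := by ring
  have t2 : |g x * x * κ| ≤ 8 * C * ((1 + e ^ 4 + e' ^ 4) / (M + 1)) := by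
    rw [abs_mul, abs_mul, abs_of_nonneg k0]
    calc |g x| * |x| * κ ≤ C * 1 * (8 * ((1 + e ^ 4 + e' ^ 4) / (M + 1))) := by
          gcongr; exact hg x hx
      _ = _ := by ring
  have t3 : |ξ x - ξ q - ξ' * (x - q)| ≤ C * (x - q) ^ 2 := by
    rw [hq1]; exact hT q hqI x hx
  set E := g x - ξ' - ξ'' * (x - q) with hE
  have hEb : |E| ≤ C * (x - q) ^ 2 := hqT x hx
  have t4 : |s / 2 * (x * E + ξ'' * (x - q) ^ 2)| ≤ s * (C * (x - q) ^ 2) := by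
    have a1 : |x * E| ≤ C * (x - q) ^ 2 := by
      rw [abs_mul]
      calc |x| * |E| ≤ 1 * (C * (x - q) ^ 2) := by gcongr
        _ = _ := one_mul _
    have a2 : |ξ'' * (x - q) ^ 2| ≤ C * (x - q) ^ 2 := by
      rw [abs_mul, abs_of_nonneg (sq_nonneg (x - q))]; gcongr
    rw [abs_mul, abs_of_nonneg (by positivity : 0 ≤ s / 2)]
    calc s / 2 * |x * E + ξ'' * (x - q) ^ 2| ≤ s / 2 * (C * (x - q) ^ 2 + C * (x - q) ^ 2) := by
          gcongr; exact (abs_add_le _ _).trans (add_le_add a1 a2)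
      _ = _ := by ring
  have t5 : |e * e' * E| ≤ s / 2 * (C * (x - q) ^ 2) := by
    rw [abs_mul]; gcongr
  -- Exact decomposition of the error into the five remainders estimated in `t1`–`t5`. The term in
  -- `s` uses `x g(x) = qξ' + (qξ'' + ξ')(x - q) + xE + ξ''(x - q)²`.
  have key : ((M + 1) * ξ y - (M * ξ x + e * e' * ξ')) / 2 - ξ q / 2 + s * q * ξ' / 4
      - (ξ' - 1 / 2 * s * (q * ξ'' + ξ') + e * e' * ξ'') / 2 * (x - q)
      = ((M + 1) * (ξ y - ξ x - g x * (y - x)) - g x * x * κ + (ξ x - ξ q - ξ' * (x - q))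
        - s / 2 * (x * E + ξ'' * (x - q) ^ 2) + e * e' * E) / 2 := by
    have : (M + 1) * (ξ y - ξ x - g x * (y - x))
        = (M + 1) * ξ y - (M + 1) * ξ x - g x * ((M + 1) * (y - x)) := by ring
    rw [this, hΔ, hE]
    ring
  rw [key]
  clear key hΔ hΔa
  have hsC : 0 ≤ s * (C * (x - q) ^ 2) := by positivity
  rw [abs_le] at t1 t2 t3 t4 t5 ⊢
  have hfin : C * ((1 + e ^ 2 + e' ^ 2) * (x - q) ^ 2)
      = C * (x - q) ^ 2 + s * (C * (x - q) ^ 2) := by rw [hs]; ring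
  rw [hfin]
  have hC1 : 0 ≤ C * (x - q) ^ 2 := by positivity
  -- The constant `10` is `(12 + 8) / 2`, from `t1` and `t2`; the quadratic remainders add up to at
  -- most `C(1 + s)(x - q)²` after halving.
  constructor <;> linarith

/-- From `M(ρ² - 1) = 1 - e²` one gets `M(ρ - 1) = (1 - e²)/2 - M(ρ - 1)²/2` exactly, and the last
term is of order `1/N`. -/
theorem single_expansion {M e ρ x : ℝ} (hM : 1 ≤ M) (he : e ^ 2 ≤ M + 1)
    (hρ : ρ = √((M + 1 - e ^ 2) / M)) (hx : |x| ≤ 1) :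
    |M * x * (ρ - 1) - (1 - e ^ 2) * x / 2| ≤ 2 * ((1 + e ^ 4) / (M + 1)) := by
  obtain ⟨r1, r2, r3⟩ := sqrt_ratio_facts hM he hρ
  have h : M * x * (ρ - 1) - (1 - e ^ 2) * x / 2 = -(x * (M * (ρ - 1) ^ 2) / 2) := by
    linear_combination (x / 2) * r1
  have hM0 : 0 < M := by linarith
  rw [h, abs_neg, abs_div, abs_mul, abs_of_nonneg (by positivity : 0 ≤ M * (ρ - 1) ^ 2)]
  have h1 : M * (ρ - 1) ^ 2 ≤ 2 * (1 + e ^ 4) / M := by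
    rw [le_div_iff₀ hM0]
    nlinarith [sq_nonneg (1 + e ^ 2)]
  have h2 : 2 * (1 + e ^ 4) / M ≤ 4 * ((1 + e ^ 4) / (M + 1)) := by
    rw [← mul_div_assoc, div_le_div_iff₀ hM0 (by linarith)]
    nlinarith [sq_nonneg (e ^ 2)]
  have h3 : |x| * (M * (ρ - 1) ^ 2) ≤ M * (ρ - 1) ^ 2 :=
    mul_le_of_le_one_left (by positivity) hx
  rw [abs_of_pos (by norm_num : (0 : ℝ) < 2)]
  linarith

/-! ### The sphere: coordinates, overlaps, measurability -/

/-- Positive dimension makes the surface measure nonzero, so its normalisation is genuine. -/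
instance isProbabilityMeasure_unif (N : ℕ) : IsProbabilityMeasure (unif (N + 1)) := by
  have hd : Measurable (dilate (N + 1)) :=
    ((measurable_subtype_coe.const_smul (√((N + 1 : ℕ) : ℝ)))).subtype_mk
  refine @Measure.isProbabilityMeasure_map _ _ _ _ _ ⟨?_⟩ _ hd.aemeasurable
  rw [Measure.smul_apply, smul_eq_mul]
  refine ENNReal.inv_mul_cancel ?_ (measure_ne_top _ _)
  rw [Ne, Measure.measure_univ_eq_zero]
  exact Measure.toSphere_ne_zero _

theorem Config.sum_sq {N : ℕ} (σ : Config N) : ∑ i, σ.1 i ^ 2 = (N : ℝ) := by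
  have h := σ.2
  rw [mem_sphere_zero_iff_norm] at h
  rw [← EuclideanSpace.real_norm_sq_eq, h, Real.sq_sqrt (by positivity)]

theorem measurable_coord {N : ℕ} (i : Fin N) : Measurable fun σ : Config N => σ.1 i :=
  ((EuclideanSpace.proj (𝕜 := ℝ) i).continuous.comp continuous_subtype_val).measurable

theorem measurable_overlap {N : ℕ} : Measurable (Function.uncurry (overlap (N := N))) := by
  unfold overlap Function.uncurry
  refine Measurable.div_const (Finset.measurable_sum _ fun i _ => ?_) _
  exact ((measurable_coord i).comp measurable_fst).mul ((measurable_coord i).comp measurable_snd)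

theorem measurable_mag {N : ℕ} : Measurable (mag (N := N)) := by
  unfold mag
  exact Measurable.div_const (Finset.measurable_sum _ fun i _ => measurable_coord i) _

theorem measurable_eps {M : ℕ} : Measurable (eps (M := M)) := measurable_coord _

theorem measurable_ratio {M : ℕ} : Measurable (ratio (M := M)) := by
  unfold ratio
  exact ((((measurable_eps.pow_const 2).const_sub _)).div_const _).sqrt

theorem hat_val {M : ℕ} (σ : Config (M + 1)) :
    (hat σ).1 = open Classical in if eps σ ^ 2 ≠ (M : ℝ) + 1 then
      WithLp.toLp 2 (fun i : Fin M => σ.1 i.castSucc / ratio σ) else WithLp.toLp 2 (fun _ => 1) := by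
  unfold hat
  split_ifs <;> rfl

theorem measurable_hat {M : ℕ} : Measurable (hat (M := M)) := by
  classical
  have h : Measurable fun σ : Config (M + 1) => (hat σ).1 := by
    simp only [hat_val]
    refine Measurable.ite ((measurable_eps.pow_const 2) (measurableSet_singleton _).compl)
      ?_ measurable_const
    refine (WithLp.measurable_toLp 2 _).comp (measurable_pi_lambda _ fun i => ?_)
    exact (measurable_coord _).div measurable_ratio
  exact h.subtype_mk

theorem overlap_mem {N : ℕ} (hN : 1 ≤ N) (σ τ : Config N) : overlap σ τ ∈ Icc (-1 : ℝ) 1 := by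
  have hN' : (0 : ℝ) < N := by exact_mod_cast hN
  have h := Finset.sum_mul_sq_le_sq_mul_sq Finset.univ (fun i => σ.1 i) fun i => τ.1 i
  rw [σ.sum_sq, τ.sum_sq, ← sq] at h
  have h' := abs_le_of_sq_le_sq' h hN'.le
  unfold overlap
  rw [mem_Icc, le_div_iff₀ hN', div_le_one hN']
  exact ⟨by linarith [h'.1], h'.2⟩

theorem overlap_self {N : ℕ} (hN : 1 ≤ N) (σ : Config N) : overlap σ σ = 1 := by
  have hN' : (N : ℝ) ≠ 0 := by positivity
  unfold overlap
  simp only [← sq]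
  rw [σ.sum_sq, div_self hN']

theorem abs_mag_le {N : ℕ} (hN : 1 ≤ N) (σ : Config N) : |mag σ| ≤ 1 := by
  have h := overlap_mem hN σ ⟨WithLp.toLp 2 fun _ => 1, by simp [EuclideanSpace.norm_eq]⟩
  simpa [overlap, mag, abs_le] using h

theorem sum_hat_eq {M : ℕ} (hM : 1 ≤ M) (τ : Config M) : ∑ i, τ.1 i = M * mag τ := by
  have : (M : ℝ) ≠ 0 := by positivity
  unfold mag
  field_simp

theorem eps_sq_le {M : ℕ} (σ : Config (M + 1)) : eps σ ^ 2 ≤ (M : ℝ) + 1 := by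
  have h := σ.sum_sq
  rw [Fin.sum_univ_castSucc] at h
  have : 0 ≤ ∑ i : Fin M, σ.1 i.castSucc ^ 2 := Finset.sum_nonneg fun i _ => sq_nonneg _
  push_cast at h
  unfold eps
  linarith

/-- True at the poles too, whatever `hat` is there: the ratio is `0` and so are the first `M`
coordinates. Hence the overlap formula below has no exceptional set. -/
theorem coord_eq_ratio_mul_hat {M : ℕ} (hM : 1 ≤ M) (σ : Config (M + 1)) (i : Fin M) :
    σ.1 i.castSucc = ratio σ * (hat σ).1 i := by
  have hM' : (0 : ℝ) < M := by exact_mod_cast hM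
  by_cases hσ : eps σ ^ 2 = (M : ℝ) + 1
  · have h0 : ratio σ = 0 := by simp [ratio, hσ]
    have h := σ.sum_sq
    rw [Fin.sum_univ_castSucc] at h
    have h1 : ∑ i : Fin M, σ.1 i.castSucc ^ 2 = 0 := by
      unfold eps at hσ
      push_cast at h
      linarith
    rw [Finset.sum_eq_zero_iff_of_nonneg fun i _ => sq_nonneg _] at h1
    rw [h0, zero_mul]
    exact pow_eq_zero_iff two_ne_zero |>.1 (h1 i (Finset.mem_univ i))
  · have hr : ratio σ ≠ 0 := by
      have : 0 < (M : ℝ) + 1 - eps σ ^ 2 := by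
        have := lt_of_le_of_ne (eps_sq_le σ) hσ
        linarith
      unfold ratio
      positivity
    have : (hat σ).1 i = σ.1 i.castSucc / ratio σ := by
      rw [hat_val, if_pos hσ]
    rw [this]
    field_simp

theorem overlap_eq {M : ℕ} (hM : 1 ≤ M) (σ τ : Config (M + 1)) :
    overlap σ τ = (M * ratio σ * ratio τ * overlap (hat σ) (hat τ) + eps σ * eps τ) / (M + 1) := by
  have hM' : (M : ℝ) ≠ 0 := by positivity
  have : (M : ℝ) * ratio σ * ratio τ * overlap (hat σ) (hat τ)
      = ∑ i : Fin M, σ.1 i.castSucc * τ.1 i.castSucc := by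
    unfold overlap
    simp only [coord_eq_ratio_mul_hat hM]
    rw [mul_div_assoc', div_eq_iff hM', Finset.mul_sum, Finset.sum_mul]
    exact Finset.sum_congr rfl fun i _ => by ring
  rw [this, overlap, Fin.sum_univ_castSucc]
  push_cast
  rfl

/-- Nothing is known of `ξ` outside `[-1, 1]`, so measurability of the composition is obtained
through the restriction to the interval. -/
theorem BddMeas.of_continuousOn {α : Type*} [MeasurableSpace α] {ξ : ℝ → ℝ}
    (hξ : ContinuousOn ξ (Icc (-1) 1)) {φ : α → ℝ} (hφ : Measurable φ)
    (h : ∀ x, φ x ∈ Icc (-1 : ℝ) 1) : BddMeas fun x => ξ (φ x) := by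
  refine ⟨?_, ?_⟩
  · have : Measurable fun x : Icc (-1 : ℝ) 1 => ξ x := hξ.domRestrict.measurable
    exact this.comp (hφ.subtype_mk (h := h))
  · obtain ⟨C, hC⟩ := isCompact_Icc.exists_bound_of_continuousOn hξ
    exact ⟨C, fun x => hC _ (h x)⟩

theorem bddMeas_eps {M : ℕ} : BddMeas (eps (M := M)) :=
  ⟨measurable_eps, √((M : ℝ) + 1), fun σ => Real.abs_le_sqrt (eps_sq_le σ)⟩

theorem bddMeas_ratio {M : ℕ} : BddMeas (ratio (M := M)) := by
  refine ⟨measurable_ratio, √(((M : ℝ) + 1) / M), fun σ => ?_⟩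
  rw [ratio, abs_of_nonneg (Real.sqrt_nonneg _)]
  gcongr
  linarith [sq_nonneg (eps σ)]

theorem bddMeas_mag_hat {M : ℕ} (hM : 1 ≤ M) :
    BddMeas fun σ : Config (M + 1) => mag (hat σ) :=
  ⟨measurable_mag.comp measurable_hat, 1, fun _ => abs_mag_le hM _⟩

theorem bddMeas_overlap_hat {M : ℕ} (hM : 1 ≤ M) :
    BddMeas fun p : Config (M + 1) × Config (M + 1) => overlap (hat p.1) (hat p.2) :=
  ⟨measurable_comp₂ measurable_overlap (measurable_hat.comp measurable_fst)
    (measurable_hat.comp measurable_snd), 1, fun _ => abs_le.2 (overlap_mem hM _ _)⟩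

theorem bddMeas_oneTerm {M : ℕ} (hM : 1 ≤ M) (h q : ℝ) : BddMeas (oneTerm h q (M := M)) :=
  ((BddMeas.const 1).sub (bddMeas_eps.pow 2)).mul ((bddMeas_mag_hat hM).sub (BddMeas.const _))

theorem bddMeas_twoTerm {M : ℕ} (hM : 1 ≤ M) (ξ : ℝ → ℝ) (q : ℝ) :
    BddMeas (Function.uncurry (twoTerm ξ q (M := M))) := by
  have e1 := (bddMeas_eps (M := M)).comp (measurable_fst (β := Config (M + 1)))
  have e2 := (bddMeas_eps (M := M)).comp (measurable_snd (α := Config (M + 1)))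
  have := (((BddMeas.const (deriv ξ q)).sub ((((e1.pow 2).add (e2.pow 2)).const_mul (1 / 2)).mul
    (BddMeas.const (q * deriv (deriv ξ) q + deriv ξ q)))).add ((e1.mul e2).mul
    (BddMeas.const (deriv (deriv ξ) q)))).const_mul (1 / 2) |>.mul
    ((bddMeas_overlap_hat hM).sub (BddMeas.const q))
  convert! this using 1
  ext p
  simp only [Function.uncurry, twoTerm, pairCoef]
  ring

/-- Two independent Gaussian processes are jointly Gaussian. -/
theorem isGaussianProcess_sumElim {S T Ω : Type*} [MeasurableSpace Ω] {P : Measure Ω}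
    {X : S → Ω → ℝ} {Y : T → Ω → ℝ} (hX : IsGaussianProcess X P) (hY : IsGaussianProcess Y P)
    (hXY : IndepFun (fun ω s => X s ω) (fun ω t => Y t ω) P) :
    IsGaussianProcess (Sum.elim X Y) P := by
  refine ⟨fun I => ?_⟩
  let L : ((I.toLeft → ℝ) × (I.toRight → ℝ)) →L[ℝ] (I → ℝ) := ContinuousLinearMap.pi fun i =>
    match i with
    | ⟨Sum.inl s, hs⟩ => (ContinuousLinearMap.proj (⟨s, Finset.mem_toLeft.2 hs⟩ : I.toLeft)).comp
        (ContinuousLinearMap.fst ℝ _ _)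
    | ⟨Sum.inr t, ht⟩ => (ContinuousLinearMap.proj (⟨t, Finset.mem_toRight.2 ht⟩ : I.toRight)).comp
        (ContinuousLinearMap.snd ℝ _ _)
  have h := (hXY.comp (φ := I.toLeft.restrict) (ψ := I.toRight.restrict)
    (Finset.measurable_restrict _) (Finset.measurable_restrict _)).hasGaussianLaw
    (hX.hasGaussianLaw I.toLeft) (hY.hasGaussianLaw I.toRight)
  have h' := h.map L
  convert! h' using 1
  ext ω ⟨i, hi⟩
  rcases i with s | t <;> rfl

/-! ### The two Gaussian fields of the cavity interpolation -/

theorem integral_standard_gaussian {Ω : Type*} [MeasurableSpace Ω] {P : Measure Ω}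
    [IsProbabilityMeasure P] {z : Ω → ℝ} (hz : HasLaw z (gaussianReal 0 1) P) :
    ∫ ω, z ω ∂P = 0 ∧ ∫ ω, z ω * z ω ∂P = 1 := by
  have h0 : ∫ ω, z ω ∂P = 0 := by
    rw [hz.integral_eq, integral_id_gaussianReal]
  refine ⟨h0, ?_⟩
  have h1 : Var[z; P] = 1 := by
    rw [hz.variance_eq, variance_id_gaussianReal]
    rfl
  rw [variance_of_integral_eq_zero hz.aemeasurable h0] at h1
  simpa [sq] using h1

/-- The Gaussian field at `t = 1`. -/
def fieldA {S Ω : Type*} (β : ℝ) (HN : S → Ω → ℝ) (σ : S) (ω : Ω) : ℝ := β * HN σ ω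

/-- The Gaussian field at `t = 0`. -/
noncomputable def fieldB {Ω : Type*} {M : ℕ} (β c : ℝ) (HN1 : Config M → Ω → ℝ) (z : Ω → ℝ)
    (σ : Config (M + 1)) (ω : Ω) : ℝ := β * HN1 (hat σ) ω + eps σ * c * z ω

/-- The covariance of `fieldA`. -/
noncomputable def covarA (ξ : ℝ → ℝ) (β : ℝ) {M : ℕ} (σ τ : Config (M + 1)) : ℝ :=
  β ^ 2 * ((M + 1) * ξ (overlap σ τ))

/-- The covariance of `fieldB`. -/
noncomputable def covarB (ξ : ℝ → ℝ) (β c : ℝ) {M : ℕ} (σ τ : Config (M + 1)) : ℝ :=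
  β ^ 2 * (M * ξ (overlap (hat σ) (hat τ))) + eps σ * eps τ * c ^ 2

/-- The two fields are linear images of the jointly Gaussian family `(H_N, H_{N-1}, z)`, and
independence kills every mixed covariance. The product `ε ε' c²` in the second covariance is the
contribution of `z`. -/
theorem IsHamiltonian.gaussPair {Ω : Type*} [MeasurableSpace Ω] {P : Measure Ω}
    [IsProbabilityMeasure P] {ξ : ℝ → ℝ} (hξ : ContinuousOn ξ (Icc (-1) 1)) {M : ℕ} (hM : 1 ≤ M)
    {HN : Config (M + 1) → Ω → ℝ} {HN1 : Config M → Ω → ℝ} {z : Ω → ℝ}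
    (hN : IsHamiltonian P ξ (M + 1) HN) (hN1 : IsHamiltonian P ξ M HN1) (mz : Measurable z)
    (hz : HasLaw z (gaussianReal 0 1) P)
    (hi : IndepFun (fun ω σ => HN σ ω) (fun ω σ => HN1 σ ω) P)
    (hiz : IndepFun z (fun ω => ((fun σ => HN σ ω), (fun σ => HN1 σ ω))) P) (β c : ℝ) :
    GaussPair P (fieldA β HN) (fieldB β c HN1 z) (covarA ξ β) (covarB ξ β c) := by
  have mH : ∀ σ, Measurable (HN σ) := fun σ => hN.measurable.comp measurable_prodMk_left
  have mH1 : ∀ τ, Measurable (HN1 τ) := fun τ => hN1.measurable.comp measurable_prodMk_left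
  obtain ⟨z0, z1⟩ := integral_standard_gaussian hz
  have gz : HasGaussianLaw z P := hz.hasGaussianLaw
  have iHH1 : ∀ σ τ, ∫ ω, HN σ ω * HN1 τ ω ∂P = 0 := fun σ τ => by
    have : IndepFun (HN σ) (HN1 τ) P := hi.comp (measurable_pi_apply σ) (measurable_pi_apply τ)
    rw [this.integral_fun_mul_eq_mul_integral (mH σ).aestronglyMeasurable
      (mH1 τ).aestronglyMeasurable, hN.centered, zero_mul]
  have izH : ∀ σ, ∫ ω, HN σ ω * z ω ∂P = 0 := fun σ => by
    have : IndepFun z (HN σ) P := hiz.comp (φ := id) measurable_id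
      ((measurable_pi_apply σ).comp measurable_fst)
    rw [this.symm.integral_fun_mul_eq_mul_integral (mH σ).aestronglyMeasurable
      mz.aestronglyMeasurable, hN.centered, zero_mul]
  have izH1 : ∀ τ, ∫ ω, HN1 τ ω * z ω ∂P = 0 := fun τ => by
    have : IndepFun z (HN1 τ) P := hiz.comp (φ := id) measurable_id
      ((measurable_pi_apply τ).comp measurable_snd)
    rw [this.symm.integral_fun_mul_eq_mul_integral (mH1 τ).aestronglyMeasurable
      mz.aestronglyMeasurable, hN1.centered, zero_mul]
  have gH : ∀ σ, HasGaussianLaw (HN σ) P := hN.gaussian.hasGaussianLaw_eval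
  have gH1 : ∀ τ, HasGaussianLaw (HN1 τ) P := hN1.gaussian.hasGaussianLaw_eval
  have j : ∀ {X Y : Ω → ℝ}, HasGaussianLaw X P → HasGaussianLaw Y P →
      Integrable (fun ω => X ω * Y ω) P := fun hX hY => hX.memLp_two.integrable_mul hY.memLp_two
  have e1 := (bddMeas_eps (M := M)).comp (measurable_fst (β := Config (M + 1)))
  have e2 := (bddMeas_eps (M := M)).comp (measurable_snd (α := Config (M + 1)))
  refine ⟨?_, ?_, ?_, fun σ => ?_, fun σ => ?_, fun σ τ => ?_, fun σ τ => ?_, fun σ τ => ?_, ?_, ?_⟩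
  · classical
    have gZ : IsGaussianProcess (fun _ : Unit => z) P := by
      refine IsGaussianProcess.of_isGaussianProcess (X := fun _ : Unit => z) ?_ fun _ =>
        ⟨{()}, .proj ⟨(), by simp⟩, fun ω => rfl⟩
      refine ⟨fun I => ?_⟩
      have := gz.map (ContinuousLinearMap.pi fun _ : I => ContinuousLinearMap.id ℝ ℝ)
      exact this
    have hsum : Measurable fun p : (Config (M + 1) → ℝ) × (Config M → ℝ) =>
        (Sum.elim p.1 p.2 : Config (M + 1) ⊕ Config M → ℝ) := by
      refine measurable_pi_lambda _ ?_
      rintro (σ | τ)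
      · exact (measurable_pi_apply σ).comp measurable_fst
      · exact (measurable_pi_apply τ).comp measurable_snd
    have hind : IndepFun (fun ω s => Sum.elim HN HN1 s ω) (fun ω (_ : Unit) => z ω) P := by
      have := (hiz.comp (φ := fun (x : ℝ) (_ : Unit) => x)
        (measurable_pi_lambda _ fun _ => measurable_id) hsum).symm
      convert! this using 1
      ext ω s
      rcases s with s | s <;> rfl
    have g := isGaussianProcess_sumElim (isGaussianProcess_sumElim hN.gaussian hN1.gaussian hi)
      gZ hind
    refine IsGaussianProcess.of_isGaussianProcess g ?_
    rintro (σ | σ)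
    · exact ⟨{Sum.inl (Sum.inl σ)}, β • .proj ⟨Sum.inl (Sum.inl σ), by simp⟩, fun ω => rfl⟩
    · refine ⟨{Sum.inl (Sum.inr (hat σ)), Sum.inr ()},
        β • .proj ⟨Sum.inl (Sum.inr (hat σ)), by simp⟩ + (eps σ * c) • .proj ⟨Sum.inr (), by simp⟩,
        fun ω => rfl⟩
  · exact hN.measurable.const_mul β
  · exact ((hN1.measurable.comp ((measurable_hat.comp measurable_fst).prodMk
      measurable_snd)).const_mul β).add (((measurable_eps.comp measurable_fst).mul_const c).mul
      (mz.comp measurable_snd))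
  · simp only [fieldA, integral_const_mul, hN.centered, mul_zero]
  · simp only [fieldB]
    rw [integral_add ((gH1 _).integrable.const_mul _) (gz.integrable.const_mul _),
      integral_const_mul, integral_const_mul, hN1.centered, z0]
    simp
  · have : ∀ ω, fieldA β HN σ ω * fieldA β HN τ ω = β ^ 2 * (HN σ ω * HN τ ω) := fun ω => by
      unfold fieldA; ring
    simp only [this, integral_const_mul, hN.cov]
    unfold covarA
    push_cast
    ring
  · have : ∀ ω, fieldB β c HN1 z σ ω * fieldB β c HN1 z τ ω
        = (β ^ 2 * (HN1 (hat σ) ω * HN1 (hat τ) ω) + eps σ * eps τ * c ^ 2 * (z ω * z ω))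
          + (β * eps τ * c * (HN1 (hat σ) ω * z ω) + β * eps σ * c * (HN1 (hat τ) ω * z ω)) :=
      fun ω => by unfold fieldB; ring
    simp only [this]
    rw [integral_add, integral_add ((j (gH1 _) (gH1 _)).const_mul _) ((j gz gz).const_mul _),
      integral_add ((j (gH1 _) gz).const_mul _) ((j (gH1 _) gz).const_mul _)]
    rotate_left
    · exact ((j (gH1 _) (gH1 _)).const_mul _).add ((j gz gz).const_mul _)
    · exact ((j (gH1 _) gz).const_mul _).add ((j (gH1 _) gz).const_mul _)
    simp only [integral_const_mul, izH1, z1, hN1.cov]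
    unfold covarB
    ring
  · have : ∀ ω, fieldA β HN σ ω * fieldB β c HN1 z τ ω
        = β ^ 2 * (HN σ ω * HN1 (hat τ) ω) + β * eps τ * c * (HN σ ω * z ω) := fun ω => by
      unfold fieldA fieldB; ring
    simp only [this]
    rw [integral_add ((j (gH _) (gH1 _)).const_mul _) ((j (gH _) gz).const_mul _)]
    simp only [integral_const_mul, izH, iHH1]
    ring
  · exact ((BddMeas.of_continuousOn hξ measurable_overlap fun p =>
      overlap_mem (Nat.le_add_left 1 M) p.1 p.2).const_mul _).const_mul _
  · exact (((BddMeas.of_continuousOn hξ (bddMeas_overlap_hat hM).1 fun p =>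
      overlap_mem hM _ _).const_mul _).const_mul _).add ((e1.mul e2).mul (BddMeas.const _))

/-! ### Splitting the generator into leading part and error -/

theorem sum_ne_eq {n : ℕ} (f : Fin n → Fin n → ℝ) :
    ∑ l, ∑ l' with l' ≠ l, f l l' = (∑ l, ∑ l', f l l') - ∑ l, f l l := by
  rw [← Finset.sum_sub_distrib]
  refine Finset.sum_congr rfl fun l _ => ?_
  rw [Finset.filter_ne', Finset.sum_erase_eq_sub (Finset.mem_univ l)]

theorem two_mul_sum_lt_eq {n : ℕ} {f : Fin n → Fin n → ℝ} (hf : ∀ l l', f l l' = f l' l) :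
    2 * ∑ l, ∑ l' with l < l', f l l' = ∑ l, ∑ l' with l' ≠ l, f l l' := by
  have h1 : ∑ l, ∑ l' with l < l', f l l' = ∑ l, ∑ l' with l' < l, f l l' := by
    simp only [Finset.sum_filter]
    rw [Finset.sum_comm]
    simp only [hf]
  rw [two_mul]
  nth_rw 2 [h1]
  rw [← Finset.sum_add_distrib]
  refine Finset.sum_congr rfl fun l _ => ?_
  simp only [Finset.sum_filter, ← Finset.sum_add_distrib]
  refine Finset.sum_congr rfl fun l' _ => ?_
  rcases lt_trichotomy l l' with h | h | h
  · simp [h, h.not_gt, h.ne']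
  · simp [h]
  · simp [h, h.not_gt, h.ne]

/-- The leading part of the generator. -/
noncomputable def leadTerm {S : Type*} (T : S → S → ℝ) (O : S → ℝ) (a b : ℝ) (n : ℕ)
    (s : Fin (n + 2) → S) : ℝ :=
  a * ∑ l : Fin n, O (s l.castSucc.castSucc) - n * a * O (s (Fin.last n).castSucc)
    + 2 * b * ∑ l : Fin n, ∑ l' with l < l', T (s l.castSucc.castSucc) (s l'.castSucc.castSucc)
    - 2 * n * b * ∑ l : Fin n, T (s l.castSucc.castSucc) (s (Fin.last n).castSucc)
    + n * (n + 1) * b * T (s (Fin.last n).castSucc) (s (Fin.last (n + 1)))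

/-- The error part of the generator. -/
noncomputable def errTerm {S : Type*} (δ : S → S → ℝ) (η : S → ℝ) (n : ℕ)
    (s : Fin (n + 2) → S) : ℝ :=
  (∑ l : Fin n, ∑ l' with l' ≠ l, δ (s l.castSucc.castSucc) (s l'.castSucc.castSucc))
    - 2 * n * ∑ l : Fin n, δ (s l.castSucc.castSucc) (s (Fin.last n).castSucc)
    + n * (n + 1) * δ (s (Fin.last n).castSucc) (s (Fin.last (n + 1)))
    + ∑ l : Fin n, η (s l.castSucc.castSucc) - n * η (s (Fin.last n).castSucc)

/-- Diagonal terms `U σ σ` occur with the same coefficients as `u σ`, so only `U σ σ + u σ` matters.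
The constant `k₀` has off-diagonal weight `n(n-1) - 2n² + n(n+1) = 0` and `d₀` has weight `n - n =
0`. The `e`-terms of the first `n` replicas cancel, and those of the two extra replicas leave one
antisymmetric difference. -/
theorem genTerm_eq_lead_add_err {S : Type*} {U T δ : S → S → ℝ} {u e O η : S → ℝ}
    {k₀ k₁ d₀ a b : ℝ} (hT : ∀ σ τ, T σ τ = T τ σ)
    (hU : ∀ σ τ, U σ τ = k₀ - k₁ * (e σ + e τ) + b * T σ τ + δ σ τ)
    (hu : ∀ σ, U σ σ + u σ = d₀ - 2 * k₁ * e σ + a * O σ + η σ) (n : ℕ) (s : Fin (n + 2) → S) :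
    genTerm U u n s = leadTerm T O a b n s + errTerm δ η n s
      - k₁ * n * (n + 1) * (e (s (Fin.last (n + 1))) - e (s (Fin.last n).castSucc)) := by
  have h1 := two_mul_sum_lt_eq (f := fun l l' : Fin n =>
    T (s l.castSucc.castSucc) (s l'.castSucc.castSucc)) fun _ _ => hT _ _
  have h2 := sum_ne_eq fun l l' : Fin n => T (s l.castSucc.castSucc) (s l'.castSucc.castSucc)
  have h3 := sum_ne_eq fun l l' : Fin n => δ (s l.castSucc.castSucc) (s l'.castSucc.castSucc)
  have h4 : ∀ σ, u σ = d₀ - 2 * k₁ * e σ + a * O σ + η σ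
      - (k₀ - k₁ * (e σ + e σ) + b * T σ σ + δ σ σ) := fun σ => by
    rw [← hu, ← hU]; ring
  have h5 : 2 * b * ∑ l : Fin n, ∑ l' with l < l',
      T (s l.castSucc.castSucc) (s l'.castSucc.castSucc)
      = b * (2 * ∑ l : Fin n, ∑ l' with l < l',
        T (s l.castSucc.castSucc) (s l'.castSucc.castSucc)) := by ring
  unfold genTerm leadTerm errTerm
  rw [h5, h1, h2, h3]
  simp only [hU, h4, Finset.sum_add_distrib, Finset.sum_sub_distrib, ← Finset.mul_sum,
    Finset.sum_const, Finset.card_univ, Fintype.card_fin, nsmul_eq_mul]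
  ring

/-- Counting coefficients: `n² + 2n·n + n(n+1) = 4n² + n` for the pairs and `n + n` for the single
replicas. -/
theorem abs_errTerm_le {S : Type*} {δ : S → S → ℝ} {η : S → ℝ} {n : ℕ} {s : Fin (n + 2) → S}
    {D E : ℝ} (hδ : ∀ i j, i ≠ j → |δ (s i) (s j)| ≤ D) (hη : ∀ i, |η (s i)| ≤ E) :
    |errTerm δ η n s| ≤ (4 * n ^ 2 + n) * D + 2 * n * E := by
  have ne1 : ∀ l : Fin n, l.castSucc.castSucc ≠ (Fin.last n).castSucc := fun l h =>
    l.castSucc_lt_last.ne (Fin.castSucc_injective _ h)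
  have ne2 : (Fin.last n).castSucc ≠ Fin.last (n + 1) := (Fin.castSucc_lt_last _).ne
  have hD : 0 ≤ D := (abs_nonneg _).trans (hδ _ _ ne2)
  have b1 : |∑ l : Fin n, ∑ l' with l' ≠ l, δ (s l.castSucc.castSucc) (s l'.castSucc.castSucc)|
      ≤ n * (n * D) := by
    refine (Finset.abs_sum_le_sum_abs _ _).trans ((Finset.sum_le_card_nsmul _ _ (n * D)
      fun l _ => ?_).trans_eq (by simp))
    refine (Finset.abs_sum_le_sum_abs _ _).trans ((Finset.sum_le_sum fun l' hl' => hδ _ _ ?_).trans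
      ((Finset.sum_le_univ_sum_of_nonneg fun _ => hD).trans_eq (by simp)))
    intro h
    exact (Finset.mem_filter.1 hl').2
      (Fin.castSucc_injective _ (Fin.castSucc_injective _ h)).symm
  have b2 : |∑ l : Fin n, δ (s l.castSucc.castSucc) (s (Fin.last n).castSucc)| ≤ n * D :=
    (Finset.abs_sum_le_sum_abs _ _).trans ((Finset.sum_le_card_nsmul _ _ D
      fun l _ => hδ _ _ (ne1 l)).trans_eq (by simp))
  have b3 := hδ _ _ ne2
  have b4 : |∑ l : Fin n, η (s l.castSucc.castSucc)| ≤ n * E :=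
    (Finset.abs_sum_le_sum_abs _ _).trans ((Finset.sum_le_card_nsmul _ _ E
      fun l _ => hη _).trans_eq (by simp))
  have b5 := hη (Fin.last n).castSucc
  have hn : (0 : ℝ) ≤ n := Nat.cast_nonneg n
  unfold errTerm
  have c2 := mul_le_mul_of_nonneg_left b2 (by positivity : (0 : ℝ) ≤ 2 * n)
  have c3 := mul_le_mul_of_nonneg_left b3 (by positivity : (0 : ℝ) ≤ n * (n + 1))
  have c5 := mul_le_mul_of_nonneg_left b5 hn
  rw [← abs_of_nonneg (by positivity : (0 : ℝ) ≤ 2 * n), ← abs_mul,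
    abs_of_nonneg (by positivity : (0 : ℝ) ≤ 2 * n)] at c2
  rw [← abs_of_nonneg (by positivity : (0 : ℝ) ≤ n * (n + 1)), ← abs_mul,
    abs_of_nonneg (by positivity : (0 : ℝ) ≤ n * (n + 1))] at c3
  rw [← abs_of_nonneg hn, ← abs_mul, abs_of_nonneg hn] at c5
  rw [abs_le] at *
  constructor <;> linarith [b1.1, b1.2, b4.1, b4.2]

theorem bddMeas_leadTerm {S : Type*} [MeasurableSpace S] {T : S → S → ℝ} {O : S → ℝ}
    (hT : BddMeas (Function.uncurry T)) (hO : BddMeas O) (a b : ℝ) (n : ℕ) :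
    BddMeas (leadTerm T O a b n) := by
  unfold leadTerm
  exact ((((BddMeas.sum _ fun l _ => bddMeas_single hO _).const_mul _ |>.sub
    ((bddMeas_single hO _).const_mul _)).add ((BddMeas.sum _ fun l _ => BddMeas.sum _ fun l' _ =>
    bddMeas_pair hT _ _).const_mul _)).sub ((BddMeas.sum _ fun l _ =>
    bddMeas_pair hT _ _).const_mul _)).add ((bddMeas_pair hT _ _).const_mul _)

theorem bddMeas_errTerm {S : Type*} [MeasurableSpace S] {δ : S → S → ℝ} {η : S → ℝ}
    (hδ : BddMeas (Function.uncurry δ)) (hη : BddMeas η) (n : ℕ) :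
    BddMeas (errTerm δ η n) := by
  unfold errTerm
  exact ((((BddMeas.sum _ fun l _ => BddMeas.sum _ fun l' _ => bddMeas_pair hδ _ _).sub
    ((BddMeas.sum _ fun l _ => bddMeas_pair hδ _ _).const_mul _)).add
    ((bddMeas_pair hδ _ _).const_mul _)).add (BddMeas.sum _ fun l _ => bddMeas_single hη _)).sub
    ((bddMeas_single hη _).const_mul _)

section

variable {S Ω : Type*} [MeasurableSpace S] [MeasurableSpace Ω] {lam : Measure S}
  [IsProbabilityMeasure lam] {P : Measure Ω} [IsProbabilityMeasure P] {K H : S → Ω → ℝ}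
  {n : ℕ} {F : (Fin (n + 2) → S) → ℝ}

theorem wrep_leadTerm (hH : Dom K H) (hK : ExpMoments P K)
    (hF : Integrable F (Measure.pi fun _ : Fin (n + 2) => lam)) {T : S → S → ℝ} {O : S → ℝ}
    (hT : BddMeas (Function.uncurry T)) (hO : BddMeas O) (a b : ℝ) :
    wrep lam P H (n + 2) F (leadTerm T O a b n) =
      a * ∑ l : Fin n, wrep lam P H (n + 2) F (fun s => O (s l.castSucc.castSucc))
      - n * a * wrep lam P H (n + 2) F (fun s => O (s (Fin.last n).castSucc))
      + 2 * b * ∑ l : Fin n, ∑ l' with l < l',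
          wrep lam P H (n + 2) F (fun s => T (s l.castSucc.castSucc) (s l'.castSucc.castSucc))
      - 2 * n * b * ∑ l : Fin n,
          wrep lam P H (n + 2) F (fun s => T (s l.castSucc.castSucc) (s (Fin.last n).castSucc))
      + n * (n + 1) * b *
          wrep lam P H (n + 2) F (fun s => T (s (Fin.last n).castSucc) (s (Fin.last (n + 1)))) := by
  have o := fun i : Fin (n + 2) => bddMeas_single hO i
  have p := fun i j : Fin (n + 2) => bddMeas_pair hT i j
  have b1 : BddMeas fun s : Fin (n + 2) → S => ∑ l : Fin n, O (s l.castSucc.castSucc) :=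
    BddMeas.sum _ fun l _ => o _
  have b2 : BddMeas fun s : Fin (n + 2) → S => ∑ l : Fin n, ∑ l' with l < l',
      T (s l.castSucc.castSucc) (s l'.castSucc.castSucc) :=
    BddMeas.sum _ fun l _ => BddMeas.sum _ fun l' _ => p _ _
  have b3 : BddMeas fun s : Fin (n + 2) → S => ∑ l : Fin n,
      T (s l.castSucc.castSucc) (s (Fin.last n).castSucc) := BddMeas.sum _ fun l _ => p _ _
  unfold leadTerm
  rw [wrep_add hH hK hF ((((b1.const_mul _).sub ((o _).const_mul _)).add (b2.const_mul _)).sub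
      (b3.const_mul _)) ((p _ _).const_mul _),
    wrep_sub hH hK hF (((b1.const_mul _).sub ((o _).const_mul _)).add (b2.const_mul _))
      (b3.const_mul _),
    wrep_add hH hK hF ((b1.const_mul _).sub ((o _).const_mul _)) (b2.const_mul _),
    wrep_sub hH hK hF (b1.const_mul _) ((o _).const_mul _),
    wrep_const_mul, wrep_const_mul, wrep_const_mul, wrep_const_mul, wrep_const_mul,
    wrep_sum hH hK hF _ fun l _ => o _, wrep_sum hH hK hF _ fun l _ => p _ _,
    wrep_sum hH hK hF _ fun l _ => BddMeas.sum _ fun l' _ => p _ _]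
  simp only [wrep_sum hH hK hF _ fun l' _ => p _ _]

end

/-- The deterministic part of the interpolating Hamiltonian at `t = 0`. -/
noncomputable def drift₀ (ξ : ℝ → ℝ) (β h q : ℝ) {M : ℕ} (σ : Config (M + 1)) : ℝ :=
  h * (M * mag (hat σ)) + h * eps σ - 1 / 2 * eps σ ^ 2 * bPar ξ β h q

/-- The slope of the deterministic part of the interpolating Hamiltonian. -/
noncomputable def drift₁ (ξ : ℝ → ℝ) (β h q : ℝ) {M : ℕ} (σ : Config (M + 1)) : ℝ :=
  h * (M * mag (hat σ)) * (ratio σ - 1) + 1 / 2 * eps σ ^ 2 * bPar ξ β h q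

theorem bddMeas_drift₀ (ξ : ℝ → ℝ) (β h q : ℝ) {M : ℕ} (hM : 1 ≤ M) :
    BddMeas (drift₀ ξ β h q (M := M)) :=
  ((((bddMeas_mag_hat hM).const_mul _).const_mul _).add (bddMeas_eps.const_mul _)).sub
    (((bddMeas_eps.pow 2).const_mul _).mul (BddMeas.const _))

theorem bddMeas_drift₁ (ξ : ℝ → ℝ) (β h q : ℝ) {M : ℕ} (hM : 1 ≤ M) :
    BddMeas (drift₁ ξ β h q (M := M)) :=
  ((((bddMeas_mag_hat hM).const_mul _).const_mul _).mul (bddMeas_ratio.sub (BddMeas.const _))).add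
    (((bddMeas_eps.pow 2).const_mul _).mul (BddMeas.const _))

/-- Identifies the concrete model with the abstract interpolation; an almost everywhere equal
version of `z` may be used. -/
theorem nu_eq_rep {Ω : Type*} [MeasurableSpace Ω] {P : Measure Ω} (ξ : ℝ → ℝ) (β h q : ℝ)
    {M : ℕ} (hM : 1 ≤ M) (HN : Config (M + 1) → Ω → ℝ) (HN1 : Config M → Ω → ℝ) {z z' : Ω → ℝ}
    (hz : z =ᵐ[P] z') (t : ℝ) (m : ℕ) (g : (Fin m → Config (M + 1)) → ℝ) :
    nu P ξ β h q HN HN1 z t m g = rep (unif (M + 1)) P (GaussPair.path (fieldA β HN)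
      (fieldB β (β * √(deriv ξ q)) HN1 z') (drift₀ ξ β h q) (drift₁ ξ β h q) t) m
      fun s _ => g s := by
  refine integral_congr_ae ?_
  filter_upwards [hz] with ω hω
  have : interp ξ β h q t (fun σ => HN σ ω) (fun σ => HN1 σ ω) (z ω)
      = fun σ => GaussPair.path (fieldA β HN) (fieldB β (β * √(deriv ξ q)) HN1 z')
        (drift₀ ξ β h q) (drift₁ ξ β h q) t σ ω := by
    ext σ
    unfold interp GaussPair.path fieldA fieldB drift₀ drift₁
    rw [sum_hat_eq hM, hω]
    ring
  rw [this]
  rfl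

/-- Half of the difference of the two covariances. -/
noncomputable def covarGap (ξ : ℝ → ℝ) (β c : ℝ) {M : ℕ} (σ τ : Config (M + 1)) : ℝ :=
  (covarA ξ β σ τ - covarB ξ β c σ τ) / 2

/-- The error in the expansion of `covarGap`. -/
noncomputable def pairErr (ξ : ℝ → ℝ) (β q c : ℝ) {M : ℕ} (σ τ : Config (M + 1)) : ℝ :=
  covarGap ξ β c σ τ - (β ^ 2 * ξ q / 2
    - β ^ 2 * (q * deriv ξ q) / 4 * (eps σ ^ 2 + eps τ ^ 2) + β ^ 2 * twoTerm ξ q σ τ)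

/-- The error in the expansion of the magnetic part of `drift₁`. -/
noncomputable def singleErr (h : ℝ) {M : ℕ} (σ : Config (M + 1)) : ℝ :=
  h * (M * mag (hat σ) * (ratio σ - 1) - (1 - eps σ ^ 2) * mag (hat σ) / 2)

/-- This is where the value of `b` matters: `½ε²b` combines with `-½β²ξ'(q)ε²` to leave
`-½β²qξ'(q)ε²`, which is `-2k₁ε²`, and `½h²(1 - q)ε²`, which completes `R̂_l` to `R̂_l - r` in the
magnetic term, up to a constant. -/
theorem covarGap_self_add_drift₁ {ξ : ℝ → ℝ} {β h q c : ℝ} (hc : c ^ 2 = β ^ 2 * deriv ξ q)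
    {M : ℕ} (hM : 1 ≤ M) (σ : Config (M + 1)) :
    covarGap ξ β c σ σ + drift₁ ξ β h q σ = (β ^ 2 * ξ 1 / 2 + h ^ 2 * (1 - q) / 2)
      - 2 * (β ^ 2 * (q * deriv ξ q) / 4) * eps σ ^ 2 + h / 2 * oneTerm h q σ
      + singleErr h σ := by
  unfold covarGap covarA covarB drift₁ singleErr oneTerm bPar
  rw [overlap_self hM, overlap_self (Nat.le_add_left 1 M), hc]
  ring

theorem overlap_comm {N : ℕ} (σ τ : Config N) : overlap σ τ = overlap τ σ := by
  simp only [overlap, mul_comm]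

theorem twoTerm_comm (ξ : ℝ → ℝ) (q : ℝ) {M : ℕ} (σ τ : Config (M + 1)) :
    twoTerm ξ q σ τ = twoTerm ξ q τ σ := by
  unfold twoTerm pairCoef
  rw [overlap_comm]
  ring

theorem exists_abs_pairErr_le {ξ : ℝ → ℝ} (hξ : ContDiffOn ℝ 3 ξ (Icc (-1) 1)) :
    ∃ C : ℝ, 0 ≤ C ∧ ∀ {M : ℕ}, 1 ≤ M → ∀ {β q c : ℝ}, q ∈ Ico (0 : ℝ) 1 →
      c ^ 2 = β ^ 2 * deriv ξ q → ∀ σ τ : Config (M + 1), |pairErr ξ β q c σ τ| ≤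
        β ^ 2 * (10 * C * ((1 + eps σ ^ 4 + eps τ ^ 4) / (M + 1))
          + C * ((1 + eps σ ^ 2 + eps τ ^ 2) * (overlap (hat σ) (hat τ) - q) ^ 2)) := by
  obtain ⟨C, g, hC, hg, hT, hq⟩ := exists_taylor_bounds hξ
  refine ⟨C, hC, fun {M} hM {β q c} hqI hc σ τ => ?_⟩
  obtain ⟨q1, q2, q3⟩ := hq q hqI
  have key := pair_expansion hC hg hT hqI q1 q2 q3 (M := M) (by exact_mod_cast hM)
    (eps_sq_le σ) (eps_sq_le τ) (ρ := ratio σ) (ρ' := ratio τ) rfl rfl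
    (overlap_mem hM (hat σ) (hat τ)) (overlap_mem (Nat.le_add_left 1 M) σ τ) (overlap_eq hM σ τ)
  have := mul_le_mul_of_nonneg_left key (sq_nonneg β)
  rw [← abs_of_nonneg (sq_nonneg β), ← abs_mul, abs_of_nonneg (sq_nonneg β)] at this
  convert! this using 2
  unfold pairErr covarGap covarA covarB twoTerm pairCoef
  rw [hc]
  ring

theorem abs_singleErr_le {M : ℕ} (hM : 1 ≤ M) (h : ℝ) (σ : Config (M + 1)) :
    |singleErr h σ| ≤ |h| * (2 * ((1 + eps σ ^ 4) / (M + 1))) := by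
  unfold singleErr
  rw [abs_mul]
  gcongr
  exact single_expansion (by exact_mod_cast hM) (eps_sq_le σ) rfl (abs_mag_le hM _)

theorem bddMeas_covarGap {ξ : ℝ → ℝ} (hξ : ContinuousOn ξ (Icc (-1) 1)) (β c : ℝ) {M : ℕ}
    (hM : 1 ≤ M) : BddMeas (Function.uncurry (covarGap ξ β c (M := M))) := by
  have e1 := (bddMeas_eps (M := M)).comp (measurable_fst (β := Config (M + 1)))
  have e2 := (bddMeas_eps (M := M)).comp (measurable_snd (α := Config (M + 1)))
  have := ((((BddMeas.of_continuousOn hξ measurable_overlap fun p =>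
    overlap_mem (Nat.le_add_left 1 M) p.1 p.2).const_mul ((M : ℝ) + 1)).const_mul (β ^ 2)).sub
    ((((BddMeas.of_continuousOn hξ (bddMeas_overlap_hat hM).1 fun p =>
      overlap_mem hM _ _).const_mul (M : ℝ)).const_mul (β ^ 2)).add
      ((e1.mul e2).mul (BddMeas.const (c ^ 2))))).const_mul (1 / 2)
  convert! this using 1
  ext p
  simp only [Function.uncurry, covarGap, covarA, covarB]
  ring

theorem bddMeas_pairErr {ξ : ℝ → ℝ} (hξ : ContinuousOn ξ (Icc (-1) 1)) (β q c : ℝ) {M : ℕ}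
    (hM : 1 ≤ M) : BddMeas (Function.uncurry (pairErr ξ β q c (M := M))) := by
  have e1 := (bddMeas_eps (M := M)).comp (measurable_fst (β := Config (M + 1)))
  have e2 := (bddMeas_eps (M := M)).comp (measurable_snd (α := Config (M + 1)))
  exact (bddMeas_covarGap hξ β c hM).sub (((BddMeas.const _).sub
    (((e1.pow 2).add (e2.pow 2)).const_mul _)).add ((bddMeas_twoTerm hM ξ q).const_mul _))

theorem bddMeas_singleErr {M : ℕ} (hM : 1 ≤ M) (h : ℝ) : BddMeas (singleErr h (M := M)) := by
  have e2 := (BddMeas.const (1 : ℝ)).sub ((bddMeas_eps (M := M)).pow 2)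
  have := ((((bddMeas_mag_hat hM).const_mul (M : ℝ)).mul (bddMeas_ratio.sub (BddMeas.const 1))).sub
    ((e2.mul (bddMeas_mag_hat hM)).const_mul (1 / 2))).const_mul h
  convert! this using 1
  ext σ
  unfold singleErr
  ring

/-- The bound on the error term, summed over replicas. -/
theorem abs_errTerm_pairErr_le {ξ : ℝ → ℝ} {C β h q c : ℝ} (hC : 0 ≤ C) {M : ℕ} (hM : 1 ≤ M)
    (hδ : ∀ σ τ : Config (M + 1), |pairErr ξ β q c σ τ| ≤
        β ^ 2 * (10 * C * ((1 + eps σ ^ 4 + eps τ ^ 4) / (M + 1))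
          + C * ((1 + eps σ ^ 2 + eps τ ^ 2) * (overlap (hat σ) (hat τ) - q) ^ 2)))
    (n : ℕ) (s : Fin (n + 2) → Config (M + 1)) :
    |errTerm (pairErr ξ β q c) (singleErr h) n s| ≤
      ((4 * n ^ 2 + n) * (10 * C) + 4 * n + 1) / ((M : ℝ) + 1) * (β ^ 2 + |h|)
        * (1 + ∑ l, eps (s l) ^ 4)
      + ((4 * n ^ 2 + n) * (10 * C) + 4 * n + 1) * β ^ 2 * ∑ l, ∑ l' with l' ≠ l,
          (1 + eps (s l) ^ 2) * (overlap (hat (s l)) (hat (s l')) - q) ^ 2 := by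
  set Q := 1 + ∑ l, eps (s l) ^ 4 with hQ
  set w : Fin (n + 2) → Fin (n + 2) → ℝ := fun l l' =>
    (1 + eps (s l) ^ 2) * (overlap (hat (s l)) (hat (s l')) - q) ^ 2 with hw
  set W := ∑ l, ∑ l' with l' ≠ l, w l l' with hW
  have w0 : ∀ l l', 0 ≤ w l l' := fun l l' => by positivity
  have e0 : ∀ l, 0 ≤ eps (s l) ^ 4 := fun l => by positivity
  have hQ1 : ∀ l, eps (s l) ^ 4 ≤ Q - 1 := fun l => by
    have := Finset.single_le_sum (fun l _ => e0 l) (Finset.mem_univ l)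
    linarith
  have hQ2 : ∀ i j, i ≠ j → eps (s i) ^ 4 + eps (s j) ^ 4 ≤ Q - 1 := fun i j hij => by
    have := Finset.sum_le_univ_sum_of_nonneg (s := {i, j}) e0
    rw [Finset.sum_pair hij] at this
    linarith
  have hQ0 : 0 ≤ Q := by linarith [hQ1 0, e0 0]
  have hwW : ∀ i j, i ≠ j → w i j ≤ W := fun i j hij => by
    have h1 : w i j ≤ ∑ l' with l' ≠ i, w i l' :=
      Finset.single_le_sum (f := w i) (fun l' _ => w0 i l') (by simpa using hij.symm)
    exact h1.trans (Finset.single_le_sum (f := fun l => ∑ l' with l' ≠ l, w l l')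
      (fun l _ => Finset.sum_nonneg fun l' _ => w0 l l') (Finset.mem_univ i))
  have hM0 : (0 : ℝ) < M + 1 := by positivity
  have hW0 : 0 ≤ W := Finset.sum_nonneg fun l _ => Finset.sum_nonneg fun l' _ => w0 l l'
  have b := abs_errTerm_le (δ := pairErr ξ β q c) (η := singleErr h) (s := s)
    -- The factor `2W` comes from `1 + e² + e'² ≤ (1 + e²) + (1 + e'²)`: each half is a term of `W`
    -- for one order of the pair.
    (D := β ^ 2 * (10 * C * (Q / (M + 1)) + C * (2 * W))) (E := |h| * (2 * (Q / (M + 1))))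
    (fun i j hij => by
      refine (hδ _ _).trans ?_
      have h1 : 1 + eps (s i) ^ 4 + eps (s j) ^ 4 ≤ Q := by linarith [hQ2 i j hij]
      have h2 : (1 + eps (s i) ^ 2 + eps (s j) ^ 2) *
          (overlap (hat (s i)) (hat (s j)) - q) ^ 2 ≤ 2 * W := by
        have h3 : (1 + eps (s i) ^ 2 + eps (s j) ^ 2) *
          (overlap (hat (s i)) (hat (s j)) - q) ^ 2 ≤ w i j + w j i := by
          simp only [hw]
          rw [overlap_comm (hat (s j))]
          nlinarith [sq_nonneg (overlap (hat (s i)) (hat (s j)) - q)]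
        linarith [hwW i j hij, hwW j i hij.symm]
      gcongr)
    (fun i => by
      refine (abs_singleErr_le hM h _).trans ?_
      have h1 : 1 + eps (s i) ^ 4 ≤ Q := by linarith [hQ1 i]
      gcongr)
  refine b.trans ?_
  have hn : (0 : ℝ) ≤ n := Nat.cast_nonneg n
  have hx : 0 ≤ Q / (M + 1) := by positivity
  have p1 : 0 ≤ (4 * n + 1) * (β ^ 2 * (Q / (M + 1))) := by positivity
  have p2 : 0 ≤ ((4 * n ^ 2 + n) * (10 * C) + 1) * (|h| * (Q / (M + 1))) := by positivity
  have p3 : 0 ≤ ((4 * n ^ 2 + n) * (8 * C) + 4 * n + 1) * (β ^ 2 * W) := by positivity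
  have e : ((4 * n ^ 2 + n) * (10 * C) + 4 * n + 1) / ((M : ℝ) + 1) * (β ^ 2 + |h|) * Q
      = ((4 * n ^ 2 + n) * (10 * C) + 4 * n + 1) * (β ^ 2 + |h|) * (Q / (M + 1)) := by ring
  rw [e]
  linear_combination p1 + p2 + p3

/-- A law only provides almost everywhere measurability of `z`, whereas the abstract theorem asks
for jointly measurable fields. -/
theorem exists_measurable_version {Ω : Type*} [MeasurableSpace Ω] {P : Measure Ω}
    {z : Ω → ℝ} (hz : HasLaw z (gaussianReal 0 1) P) {β : Type*} [MeasurableSpace β] {Y : Ω → β}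
    (hi : IndepFun z Y P) : ∃ z' : Ω → ℝ, Measurable z' ∧ z =ᵐ[P] z' ∧
      HasLaw z' (gaussianReal 0 1) P ∧ IndepFun z' Y P :=
  ⟨hz.aemeasurable.mk z, hz.aemeasurable.measurable_mk, hz.aemeasurable.ae_eq_mk,
    hz.congr hz.aemeasurable.ae_eq_mk.symm,
    hi.congr hz.aemeasurable.ae_eq_mk (Filter.EventuallyEq.refl _ _)⟩

end SphericalSK

open SphericalSK
-- The derivative formula
theorem theorem1 (ξ : ℝ → ℝ) (hξ : ContDiffOn ℝ 3 ξ (Icc (-1) 1)) (n : ℕ) :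
    ∃ L : ℝ, 0 < L ∧
    ∀ (M : ℕ) (_ : 1 ≤ M) (β h q : ℝ) (_ : q ∈ Ico (0 : ℝ) 1)
      (_ : h ^ 2 + β ^ 2 * deriv ξ q = q / (1 - q) ^ 2) (_ : 0 ≤ deriv ξ q),
    ∃ R : (Fin (n + 2) → Config (M + 1)) → ℝ,
      Measurable R ∧
      (∀ s, |R s| ≤
        L / ((M : ℝ) + 1) * (β ^ 2 + |h|) * (1 + ∑ l, eps (s l) ^ 4)
        + L * β ^ 2 * ∑ l, ∑ l' with l' ≠ l,
            (1 + eps (s l) ^ 2) * (overlap (hat (s l)) (hat (s l')) - q) ^ 2) ∧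
      ∀ {Ω : Type*} [MeasurableSpace Ω] (P : Measure Ω) [IsProbabilityMeasure P]
        (HN : Config (M + 1) → Ω → ℝ) (HN1 : Config M → Ω → ℝ) (z : Ω → ℝ)
        (_ : IsHamiltonian P ξ (M + 1) HN) (_ : IsHamiltonian P ξ M HN1)
        (_ : HasLaw z (gaussianReal 0 1) P)
        (_ : IndepFun (fun ω σ => HN σ ω) (fun ω σ => HN1 σ ω) P)
        (_ : IndepFun z (fun ω => ((fun σ => HN σ ω), (fun σ => HN1 σ ω))) P)
        (f : (Fin n → Config (M + 1)) → ℝ)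
        (_ : Integrable f (Measure.pi fun _ : Fin n => unif (M + 1)))
        (t : ℝ) (_ : t ∈ Icc (0 : ℝ) 1),
        let ν (g : (Fin (n + 2) → Config (M + 1)) → ℝ) : ℝ :=
          nu P ξ β h q HN HN1 z t (n + 2) fun s => f (fun l => s (Fin.castAdd 2 l)) * g s
        let old (l : Fin n) : Fin (n + 2) := Fin.castAdd 2 l
        let new₁ : Fin (n + 2) := Fin.natAdd n 0
        let new₂ : Fin (n + 2) := Fin.natAdd n 1
        HasDerivWithinAt (fun u => nu P ξ β h q HN HN1 z u n f)
          (h / 2 * ∑ l, ν (fun s => oneTerm h q (s (old l)))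
            - n * (h / 2) * ν (fun s => oneTerm h q (s new₁))
            + 2 * β ^ 2 * ∑ l, ∑ l' with l < l',
                ν (fun s => twoTerm ξ q (s (old l)) (s (old l')))
            - 2 * n * β ^ 2 * ∑ l, ν (fun s => twoTerm ξ q (s (old l)) (s new₁))
            + n * (n + 1) * β ^ 2 * ν (fun s => twoTerm ξ q (s new₁) (s new₂))
            + ν R)
          (Icc 0 1) t := by
  obtain ⟨C, hC, hδ⟩ := exists_abs_pairErr_le hξ
  -- `C` depends only on `ξ`. The first two summands come from `abs_errTerm_le` with the constants
  -- `10 C` per pair and `2` per single replica; the `1` ensures positivity.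
  refine ⟨(4 * n ^ 2 + n) * (10 * C) + 4 * n + 1, by positivity, ?_⟩
  intro M hM β h q hq _ hq'
  -- Nonnegativity of `ξ'(q)` is what gives the field `z` the variance that cancels `ε ε' β² ξ'(q)`.
  have hc : (β * √(deriv ξ q)) ^ 2 = β ^ 2 * deriv ξ q := by rw [mul_pow, Real.sq_sqrt hq']
  have bδ := bddMeas_pairErr hξ.continuousOn β q (β * √(deriv ξ q)) hM
  have bη := bddMeas_singleErr hM h
  refine ⟨errTerm (pairErr ξ β q (β * √(deriv ξ q))) (singleErr h) n,
    (bddMeas_errTerm bδ bη n).1, abs_errTerm_pairErr_le hC hM (hδ hM hq hc) n, ?_⟩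
  intro Ω _ P _ HN HN1 z hN hN1 hz hi hiz f hf t ht
  obtain ⟨z', mz, hzz, hz', hiz'⟩ := exists_measurable_version hz hiz
  have G := hN.gaussPair hξ.continuousOn hM hN1 mz hz' hi hiz' β (β * √(deriv ξ q))
  have d₀ := bddMeas_drift₀ ξ β h q hM
  have d₁ := bddMeas_drift₁ ξ β h q hM
  obtain ⟨D₀, hD₀⟩ := d₀.2
  obtain ⟨D₁, hD₁⟩ := d₁.2
  have hK := G.expMoments (add_nonneg (abs_nonneg D₀) (abs_nonneg D₁))
  have hH := G.dom_path d₀.1 d₁.1 (fun σ => add_le_add ((hD₀ σ).trans (le_abs_self _))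
    ((hD₁ σ).trans (le_abs_self _))) ht
  have hF := integrable_castSucc (integrable_castSucc hf)
  have main := G.hasDerivWithinAt_rep (lam := unif (M + 1)) d₀ d₁ ht hf
  have bO := bddMeas_oneTerm hM h q (M := M)
  have bT := bddMeas_twoTerm hM ξ q (M := M)
  have be : BddMeas fun σ : Config (M + 1) => eps σ ^ 2 := bddMeas_eps.pow 2
  intro ν old new₁ new₂
  simp only [ν, nu_eq_rep ξ β h q hM HN HN1 hzz]
  refine main.congr_deriv ?_
  have hgen := genTerm_eq_lead_add_err (U := covarGap ξ β (β * √(deriv ξ q)))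
    (δ := pairErr ξ β q (β * √(deriv ξ q))) (e := fun σ => eps σ ^ 2)
    (k₀ := β ^ 2 * ξ q / 2) (k₁ := β ^ 2 * (q * deriv ξ q) / 4)
    (d₀ := β ^ 2 * ξ 1 / 2 + h ^ 2 * (1 - q) / 2) (a := h / 2) (b := β ^ 2)
    (twoTerm_comm ξ q (M := M)) (fun σ τ => by unfold pairErr; ring)
    (covarGap_self_add_drift₁ (h := h) hc hM) n
  -- Exchangeability of replicas `n+1` and `n+2`, neither of which `f` sees, removes the leftover
  -- `ε²` difference.
  have swap : wrep (unif (M + 1)) P (GaussPair.path (fieldA β HN)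
      (fieldB β (β * √(deriv ξ q)) HN1 z') (drift₀ ξ β h q) (drift₁ ξ β h q) t) (n + 2)
      (fun s => f fun j => s j.castSucc.castSucc) (fun s => eps (s (Fin.last (n + 1))) ^ 2)
      = wrep (unif (M + 1)) P (GaussPair.path (fieldA β HN)
      (fieldB β (β * √(deriv ξ q)) HN1 z') (drift₀ ξ β h q) (drift₁ ξ β h q) t) (n + 2)
      (fun s => f fun j => s j.castSucc.castSucc) (fun s => eps (s (Fin.last n).castSucc) ^ 2) := by
    obtain ⟨me, c, hc⟩ := be
    exact rep_last_swap hf me hc hH hK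
  change wrep (unif (M + 1)) P _ (n + 2) (fun s => f fun j => s j.castSucc.castSucc)
    (genTerm (covarGap ξ β (β * √(deriv ξ q))) (drift₁ ξ β h q) n) = _
  rw [funext hgen, wrep_sub hH hK hF ((bddMeas_leadTerm bT bO _ _ n).add (bddMeas_errTerm bδ bη n))
    (((bddMeas_single be _).sub (bddMeas_single be _)).const_mul _), wrep_const_mul,
    wrep_sub hH hK hF (bddMeas_single be _) (bddMeas_single be _), swap, sub_self, mul_zero,
    sub_zero, wrep_add hH hK hF (bddMeas_leadTerm bT bO _ _ n) (bddMeas_errTerm bδ bη n),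
    wrep_leadTerm hH hK hF bT bO]
  -- The double `castSucc` and the `last` indices agree by definition with `Fin.castAdd 2` and
  -- `Fin.natAdd n`.
  rfl
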